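/- **Setting.** Let $S$ be a real analytic function on an open neighborhood $D$ of the origin in $\mathbb{R}^2$ with $S(0,0)=0$ and $\nabla S(0,0)=(0,0)$. Let $H=S_{xx}S_{yy}-S_{xy}^2$ be its Hessian determinant. Assume that $H(0,0)=0$ and that neither $S$ nor $H$ vanishes identically near the origin. Let $\phi\in C_c^\infty(\mathbb{R}^2)$ be supported in $D$, and for Schwartz functions $f$ on $\mathbb{R}^3$ put $$Tf(x_1,x_2,x_3)=\int_{\mathbb{R}^2} f(x_1-t_1,\,x_2-t_2,\,x_3-S(t_1,t_2))\,\phi(t_1,t_2)\,dt_1\,dt_2 .$$ For $1\le p,q\le\infty$, $T$ is *bounded from $L^p$ to $L^q$* if there is a finite $C$ with $\|Tf\|_{L^q(\mathbb{R}^3)}\le C\|f\|_{L^p(\mathbb{R}^3)}$ for all Schwartz functions $f$ (with $1/\infty=0$ below). For $g$ real analytic near the origin, not identically zero, with $g(0,0)=0$, its *growth exponent* is the supremum of all $\varepsilon>0$ for which $|g|^{-\varepsilon}$ is integrable on some neighborhood of the origin. (Equivalently, it is the number $\epsilon_0\in(0,1]$ such that for some $k\in\{0,1\}$ and every sufficiently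 small neighborhood $V$ of the origin, the measure of $\{t\in V:|g(t)|<\delta\}$ is comparable to $\delta^{\epsilon_0}|\ln\delta|^k$ for $0<\delta<\frac12$.) Let $\eta$ and $\eta'$ be the growth exponents of $S$ and of $H$. Write $S(x,y)=\sum_{a,b}S_{a,b}x^ay^b$ near the origin. The *Newton polygon* $N(S)$ is the convex hull of the union of the quadrants $\{(x,y): x\ge a,\ y\ge b\}$ over all $(a,b)$ with $S_{a,b}\ne0$. Its boundary consists of an unbounded vertical ray, an unbounded horizontal ray, and finitely many (possibly no) compact edges. The *Newton distance* $d(S)$ is the infimum of all $x$ with $(x,x)\in N(S)$. For a compact edge $e$, let $S_e(x,y)=\sum_{(a,b)\in e}S_{a,b}x^ay^b$, and let $o(e)$ be the maximal order of a complex zero $y\neq0$ of the polynomial $S_e(1,y)$. **Theorem.** Suppose that the point $(d(S),d(S))$, where the line $y=x$ meets the boundary of $N(S)$, is a vertex of $N(S)$, or lies on the horizontal or the vertical ray, or lies in the interior of a compact edge $e$ with $o(e)\le d(S)$. Suppose also that $\phi\ge0$ and $\phi(0,0)>0$. 1. If $1\le p,q\le\infty$ and $\frac1q<\frac1p-\frac{\eta}{\eta+1}$,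 then $T$ is not bounded from $L^p$ to $L^q$. 2. If moreover $\eta\le\frac{2\eta'}{1+2\eta'}$, $1\le p,q\le\infty$, and $(\frac1p,\frac1q)$ lies outside the closed trapezoid in the $xy$ plane bounded by the lines $y=x$, $y=x-\frac{\eta}{\eta+1}$, $y=\frac x3$ and $y=3x-2$, then $T$ is not bounded from $L^p$ to $L^q$. -/

import Mathlib

open MeasureTheory Topology
open scoped ENNReal NNReal ContDiff SchwartzMap

noncomputable section

namespace Averaging

/-- The Taylor coefficient `g_{a,b}` of `x ^ a * y ^ b` in the expansion of `g` at the origin. -/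
def taylorCoeff (g : ℝ × ℝ → ℝ) (a b : ℕ) : ℝ :=
  iteratedDeriv a (fun x => iteratedDeriv b (fun y => g (x, y)) 0) 0 /
    ((a.factorial : ℝ) * (b.factorial : ℝ))

/-- The Newton polygon `N(g)`: the convex hull of the union of the quadrants
`{x ≥ a, y ≥ b}` over all `(a, b)` with `g_{a,b} ≠ 0`. -/
def newtonPolygon (g : ℝ × ℝ → ℝ) : Set (ℝ × ℝ) :=
  convexHull ℝ {z | ∃ a b : ℕ, taylorCoeff g a b ≠ 0 ∧ (a : ℝ) ≤ z.1 ∧ (b : ℝ) ≤ z.2}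

/-- The Newton distance `d(g)`: the infimum of all `x` with `(x, x) ∈ N(g)`. -/
def newtonDistance (g : ℝ × ℝ → ℝ) : ℝ :=
  sInf {x : ℝ | (x, x) ∈ newtonPolygon g}

/-- `e` is the compact (bounded) edge of `N(g)` with endpoints `v ≠ w`: a face of `N(g)` that is
a nondegenerate segment. -/
def IsCompactEdge (g : ℝ × ℝ → ℝ) (e : Set (ℝ × ℝ)) (v w : ℝ × ℝ) : Prop :=
  v ≠ w ∧ e = segment ℝ v w ∧ IsExposed ℝ (newtonPolygon g) e

/-- The unbounded vertical ray in the boundary of `N(g)`: the face where `x` is minimal. -/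
def verticalRay (g : ℝ × ℝ → ℝ) : Set (ℝ × ℝ) :=
  {z | z ∈ newtonPolygon g ∧ ∀ w ∈ newtonPolygon g, z.1 ≤ w.1}

/-- The unbounded horizontal ray in the boundary of `N(g)`: the face where `y` is minimal. -/
def horizontalRay (g : ℝ × ℝ → ℝ) : Set (ℝ × ℝ) :=
  {z | z ∈ newtonPolygon g ∧ ∀ w ∈ newtonPolygon g, z.2 ≤ w.2}

/-- The one-variable polynomial `g_e(1, y)`, where `g_e(x, y)` is the sum of the terms
`g_{a,b} x ^ a y ^ b` with `(a, b) ∈ e`.  The sum is finite when `e` is bounded. -/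
def edgePolynomial (g : ℝ × ℝ → ℝ) (e : Set (ℝ × ℝ)) : Polynomial ℝ :=
  ∑ᶠ ab ∈ {ab : ℕ × ℕ | ((ab.1 : ℝ), (ab.2 : ℝ)) ∈ e},
    Polynomial.monomial ab.2 (taylorCoeff g ab.1 ab.2)

/-- `o(e)`: the maximal order of a (complex) zero `y ≠ 0` of the polynomial `g_e(1, y)`. -/
def edgeOrder (g : ℝ × ℝ → ℝ) (e : Set (ℝ × ℝ)) : ℕ :=
  sSup {n : ℕ | ∃ y : ℂ, y ≠ 0 ∧
    n = ((edgePolynomial g e).map (algebraMap ℝ ℂ)).rootMultiplicity y}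

/-- The diagonal enters `N(g)` at a vertex, on the horizontal or the vertical ray, or in the
interior of a compact edge `e` with `o(e) ≤ d(g)`.  The point of entry is `(d(g), d(g))`. -/
def DiagonalCondition (g : ℝ × ℝ → ℝ) : Prop :=
  (newtonDistance g, newtonDistance g) ∈ (newtonPolygon g).extremePoints ℝ ∨
  (newtonDistance g, newtonDistance g) ∈ horizontalRay g ∨
  (newtonDistance g, newtonDistance g) ∈ verticalRay g ∨
  ∃ (e : Set (ℝ × ℝ)) (v w : ℝ × ℝ), IsCompactEdge g e v w ∧
    (newtonDistance g, newtonDistance g) ∈ openSegment ℝ v w ∧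
    (edgeOrder g e : ℝ) ≤ newtonDistance g

/-- The growth exponent of `g` at the origin: the supremum of the `ε > 0` for which
`|g| ^ (-ε)` is integrable on some neighborhood of the origin. -/
def growthExponent (g : ℝ × ℝ → ℝ) : ℝ :=
  sSup {ε : ℝ | 0 < ε ∧ ∃ V ∈ 𝓝 (0 : ℝ × ℝ), IntegrableOn (fun t => |g t| ^ (-ε)) V volume}

/-- The partial derivative in the first variable. -/
def pderivX (g : ℝ × ℝ → ℝ) (t : ℝ × ℝ) : ℝ := fderiv ℝ g t (1, 0)

/-- The partial derivative in the second variable. -/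
def pderivY (g : ℝ × ℝ → ℝ) (t : ℝ × ℝ) : ℝ := fderiv ℝ g t (0, 1)

/-- The Hessian determinant of `g`. -/
def hessianDet (g : ℝ × ℝ → ℝ) (t : ℝ × ℝ) : ℝ :=
  pderivX (pderivX g) t * pderivY (pderivY g) t - pderivX (pderivY g) t ^ 2

/-- The averaging operator
`T f (x) = ∫ f (x₁ - t₁, x₂ - t₂, x₃ - S(t₁, t₂)) φ(t₁, t₂) dt₁ dt₂`. -/
def avgOp (S φ : ℝ × ℝ → ℝ) (f : ℝ × ℝ × ℝ → ℂ) (x : ℝ × ℝ × ℝ) : ℂ :=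
  ∫ t : ℝ × ℝ, f (x.1 - t.1, x.2.1 - t.2, x.2.2 - S t) * (φ t : ℂ)

/-- An operator defined on Schwartz functions is bounded from `L^p(ℝ³)` to `L^q(ℝ³)`. -/
def IsLpLqBounded (T : (ℝ × ℝ × ℝ → ℂ) → (ℝ × ℝ × ℝ → ℂ)) (p q : ℝ≥0∞) : Prop :=
  ∃ C : ℝ≥0, ∀ f : 𝓢(ℝ × ℝ × ℝ, ℂ),
    eLpNorm (T f) q volume ≤ C * eLpNorm f p volume

/-- The closed trapezoid bounded by the lines `y = x`, `y = x - η / (η + 1)`, `y = x / 3` and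
`y = 3 x - 2`. -/
def closedTrapezoid (η : ℝ) : Set (ℝ × ℝ) :=
  {z | z.2 ≤ z.1 ∧ z.1 - η / (η + 1) ≤ z.2 ∧ z.1 / 3 ≤ z.2 ∧ 3 * z.1 - 2 ≤ z.2}

end Averaging

end

/-! Boundedness is refuted by testing `T` on bump functions. Near the origin `φ ≥ c₀ > 0`, so if `f
= 1` at all points `x - (t, S t)` with `x ∈ E` and `t ∈ W`, then `T f ≥ c₀ |W|` on `E`. With `f`
supported in `U` this gives `c₀ |W| |E| ^ (1/q) ≤ C |U| ^ (1/p)`. When the three measures are powers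
of a parameter `δ → 0`, the exponents must satisfy a linear inequality.

Four families suffice (`exponents_of_isLpLqBounded`). Boxes of size `δ`, tested on a neighborhood of
the graph of `S`, give `3/p ≤ 2 + 1/q`. Neighborhoods of the reflected graph, tested on boxes of
size `δ`, give `1/p ≤ 3/q`. Boxes of size `1/δ` give `1/q ≤ 1/p`. Finally, let `κ₁ x + κ₂ y = 1` be
a supporting line of the Newton polygon at `(d, d)`, so that `κ₁ + κ₂ = 1/d`. On a box with sides of
order `δ ^ κ₁`, `δ ^ κ₂` every monomial of `S` is `O(δ)`, hence `S = O(δ)`, and with `s = 1/d` the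
test gives `1/p - 1/q ≤ s/(s+1)`.

It remains to replace `s` by `η`. Since `x/(x+1)` increases, only `1/d ≤ η` is needed
(`one_div_newtonDistance_le_growthExponent`); this is one half of Varchenko's theorem in adapted
coordinates. For `ε < 1/d` one picks positive weights with `κ₁ + κ₂ > ε` such that all exponents of
`S` lie on or above the line `κ · z = 1` and such that, at each real point except the origin, the
part of `S` on that line has a nonzero pure derivative of some order `m` with `m ε < 1`
(`HasGoodWeights`). At a vertex or on a ray, tilting the line leaves a single monomial on it; on a
compact edge, `o(e) ≤ d` bounds the order off the axes and the lattice points of the edge bound it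
on the axes. The dilations `(δ ^ κ₁ x, δ ^ κ₂ y)` turn dyadic shells into one compact shell, where
the rescaled `S` is close to its principal part. One-variable sublevel estimates bound the integral
there uniformly, so the shell at scale `δ` contributes `O(δ ^ (κ₁ + κ₂ - ε))`, and the sum over
shells is geometric. -/

/-! ### Sublevel sets of functions of one variable -/

/-- Iterated Rolle theorem for a chain of derivatives `g 0, g 1, …, g m`. -/
theorem exists_zero_of_chain (m : ℕ) (I : Set ℝ) (hI : Convex ℝ I) (g : ℕ → ℝ → ℝ)
    (hg : ∀ k < m, ∀ y ∈ I, HasDerivAt (g k) (g (k + 1) y) y) (z : ℕ → ℝ)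
    (hz : ∀ i < m, z i < z (i + 1)) (hzI : ∀ i ≤ m, z i ∈ I) (hz0 : ∀ i ≤ m, g 0 (z i) = 0) :
    ∃ ξ ∈ I, g m ξ = 0 := by
  induction m generalizing g z with
  | zero => exact ⟨z 0, hzI 0 le_rfl, hz0 0 le_rfl⟩
  | succ m ih =>
    have key : ∀ i : ℕ, ∃ ξ, i ≤ m → ξ ∈ Set.Ioo (z i) (z (i + 1)) ∧ g 1 ξ = 0 := by
      intro i
      by_cases hi : i ≤ m
      · have hsub : Set.Icc (z i) (z (i + 1)) ⊆ I :=
          hI.ordConnected.out (hzI i (by omega)) (hzI (i + 1) (by omega))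
        obtain ⟨ξ, hξ, h0⟩ := exists_hasDerivAt_eq_zero (f := g 0) (f' := g 1) (hz i (by omega))
          (fun y hy => (hg 0 (by omega) y (hsub hy)).continuousAt.continuousWithinAt)
          (by rw [hz0 i (by omega), hz0 (i + 1) (by omega)])
          (fun y hy => hg 0 (by omega) y (hsub (Set.Ioo_subset_Icc_self hy)))
        exact ⟨ξ, fun _ => ⟨hξ, h0⟩⟩
      · exact ⟨0, fun h => absurd h hi⟩
    choose w hw using key
    refine ih (fun k => g (k + 1)) (fun k hk => hg (k + 1) (by omega)) w (fun i hi => ?_)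
      (fun i hi => ?_) (fun i hi => (hw i hi).2)
    · exact (hw i (by omega)).1.2.trans (hw (i + 1) (by omega)).1.1
    · exact hI.ordConnected.out (hzI i (by omega)) (hzI (i + 1) (by omega))
        (Set.Ioo_subset_Icc_self (hw i hi).1)

/-- A set of large measure contains many separated points. -/
theorem exists_separated_finset (m : ℕ) (h : ℝ) (hh : 0 < h) (E : Set ℝ)
    (hE : ENNReal.ofReal (2 * m * h) < volume E) :
    ∃ s : Finset ℝ, s.card = m + 1 ∧ ↑s ⊆ E ∧ ∀ x ∈ s, ∀ y ∈ s, x ≠ y → h ≤ |x - y| := by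
  induction m generalizing E with
  | zero =>
    have : E.Nonempty := by
      rw [Set.nonempty_iff_ne_empty]
      rintro rfl
      simp at hE
    obtain ⟨x, hx⟩ := this
    exact ⟨{x}, by simp, by simpa using hx, by simp +contextual⟩
  | succ m ih =>
    have : E.Nonempty := by
      rw [Set.nonempty_iff_ne_empty]
      rintro rfl
      simp at hE
    obtain ⟨x, hx⟩ := this
    have hvol : volume (Set.Ioo (x - h) (x + h)) = ENNReal.ofReal (2 * h) := by
      rw [Real.volume_Ioo]; congr 1; ring
    -- Greedy choice: discarding the points closer than `h` to `x` costs at most `2 * h` in measure,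
    -- which leaves room for the other points.
    have h1 : ENNReal.ofReal (2 * m * h) < volume (E \ Set.Ioo (x - h) (x + h)) := by
      have h2 : volume E ≤ volume (E \ Set.Ioo (x - h) (x + h)) + ENNReal.ofReal (2 * h) := by
        rw [← hvol]
        refine (measure_mono ?_).trans (measure_union_le _ _)
        intro y hy
        by_cases hy' : y ∈ Set.Ioo (x - h) (x + h)
        · exact Or.inr hy'
        · exact Or.inl ⟨hy, hy'⟩
      by_contra! hcon
      have h3 := h2.trans (add_le_add_left hcon _)
      rw [← ENNReal.ofReal_add (by positivity) (by positivity)] at h3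
      refine absurd (hE.trans_le h3) ?_
      push_cast
      rw [not_lt]
      apply ENNReal.ofReal_le_ofReal
      linarith
    obtain ⟨s, hs, hsE, hsep⟩ := ih _ h1
    have hxs : ∀ y ∈ s, h ≤ |x - y| := by
      intro y hy
      have := (hsE hy).2
      rw [Set.mem_Ioo, not_and_or, not_lt, not_lt] at this
      rcases this with h4 | h4
      · rw [abs_of_nonneg] <;> linarith
      · rw [abs_of_nonpos] <;> linarith
    have hxn : x ∉ s := fun hxs' => by
      have := hxs x hxs'
      simp at this
      linarith
    refine ⟨insert x s, by rw [Finset.card_insert_of_notMem hxn, hs], ?_, ?_⟩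
    · intro y hy
      rcases Finset.mem_insert.1 (by exact_mod_cast hy) with rfl | hy
      · exact hx
      · exact (hsE hy).1
    · intro y hy z hz hyz
      rcases Finset.mem_insert.1 hy with rfl | hy <;> rcases Finset.mem_insert.1 hz with rfl | hz
      · exact absurd rfl hyz
      · exact hxs z hz
      · rw [abs_sub_comm]; exact hxs _ ‹_›
      · exact hsep y hy z hz hyz

open Polynomial in
/-- Lower bound on the size of a function at one of several separated points, in terms of a lower
bound for a higher derivative. -/
theorem derivative_bound_of_separated (m : ℕ) (I : Set ℝ) (hI : Convex ℝ I) (g : ℕ → ℝ → ℝ)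
    (hg : ∀ k < m, ∀ y ∈ I, HasDerivAt (g k) (g (k + 1) y) y) (c σ h : ℝ) (hh : 0 < h)
    (hc : ∀ y ∈ I, c ≤ |g m y|)
    (s : Finset ℝ) (hs : s.card = m + 1) (hsI : ↑s ⊆ I) (hsσ : ∀ y ∈ s, |g 0 y| ≤ σ)
    (hsep : ∀ x ∈ s, ∀ y ∈ s, x ≠ y → h ≤ |x - y|) :
    c * h ^ m ≤ (m + 1).factorial * σ := by
  set P : ℝ[X] := Lagrange.interpolate s id (g 0) with hP
  have hinj : Set.InjOn (id : ℝ → ℝ) s := Function.injective_id.injOn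
  -- The function minus its interpolating polynomial vanishes at all `m + 1` nodes, so Rolle gives a
  -- zero of its `m`-th derivative.
  have hex : ∃ ξ ∈ I, g m ξ - (derivative^[m] P).eval ξ = 0 := by
    let z : ℕ → ℝ := fun i => if hi : i < m + 1 then s.orderEmbOfFin hs ⟨i, hi⟩ else 0
    have hzs : ∀ i ≤ m, z i ∈ s := by
      intro i hi
      simp only [z, dif_pos (Nat.lt_succ_of_le hi)]
      exact s.orderEmbOfFin_mem hs _
    refine exists_zero_of_chain m I hI (fun k y => g k y - (derivative^[k] P).eval y) ?_ z ?_
      (fun i hi => hsI (hzs i hi)) (fun i hi => ?_)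
    · intro k hk y hy
      rw [Function.iterate_succ_apply']
      exact (hg k hk y hy).sub ((derivative^[k] P).hasDerivAt y)
    · intro i hi
      simp only [z, dif_pos (show i < m + 1 by omega), dif_pos (show i + 1 < m + 1 by omega)]
      apply (s.orderEmbOfFin hs).strictMono
      simp
    · have := Lagrange.eval_interpolate_at_node (r := g 0) hinj (hzs i hi)
      simp only [id] at this
      rw [Function.iterate_zero, id, hP, this, sub_self]
  obtain ⟨ξ, hξI, hξ⟩ := hex
  -- `P` has degree at most `m`, so its `m`-th derivative is constant: `m!` times the sum of `g 0 i
  -- / ∏ (i - j)`. Separation makes each denominator at least `h ^ m` in absolute value.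
  rw [hP, Lagrange.iterate_derivative_interpolate _ hinj (by omega), hs, Nat.sub_self] at hξ
  simp only [Finset.powersetCard_zero, Finset.sum_singleton, Finset.prod_empty, mul_one,
    eval_mul, eval_natCast, eval_finsetSum, eval_C, id] at hξ
  have hξ' : |g m ξ| ≤ m.factorial * ((m + 1) * (σ / h ^ m)) := by
    rw [sub_eq_zero.1 hξ, abs_mul, Nat.abs_cast]
    gcongr
    refine (Finset.abs_sum_le_sum_abs _ _).trans ?_
    have : ∀ i ∈ s, |g 0 i / ∏ j ∈ s.erase i, (i - j)| ≤ σ / h ^ m := by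
      intro i hi
      rw [abs_div, Finset.abs_prod]
      have h1 : h ^ m ≤ ∏ j ∈ s.erase i, |i - j| := by
        have hcard : (s.erase i).card = m := by rw [Finset.card_erase_of_mem hi, hs]; rfl
        calc h ^ m = ∏ j ∈ s.erase i, h := by rw [Finset.prod_const, hcard]
          _ ≤ _ := Finset.prod_le_prod (fun _ _ => hh.le) fun j hj =>
            hsep i hi j (Finset.mem_of_mem_erase hj) (Finset.ne_of_mem_erase hj).symm
      have h2 := hsσ i hi
      have h3 : 0 < h ^ m := by positivity
      exact div_le_div₀ ((abs_nonneg _).trans h2) h2 h3 h1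
    refine (Finset.sum_le_card_nsmul _ _ _ this).trans ?_
    rw [hs]; simp
  have h3 : 0 < h ^ m := by positivity
  have h4 := (hc ξ hξI).trans hξ'
  calc c * h ^ m ≤ (m.factorial * ((m + 1) * (σ / h ^ m))) * h ^ m := by gcongr
    _ = (m + 1).factorial * σ := by
      rw [Nat.factorial_succ]; push_cast; field_simp

/-- Sublevel set estimate: if the `m`-th derivative is at least `c` then `{|g| ≤ σ}` has measure
at most a constant times `(σ / c) ^ (1 / m)`. -/
theorem volume_sublevel_le (m : ℕ) (hm : 0 < m) (I : Set ℝ) (hI : Convex ℝ I) (g : ℕ → ℝ → ℝ)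
    (hg : ∀ k < m, ∀ y ∈ I, HasDerivAt (g k) (g (k + 1) y) y) (c σ : ℝ) (hc0 : 0 < c)
    (hσ : 0 < σ) (hc : ∀ y ∈ I, c ≤ |g m y|) :
    volume {y | y ∈ I ∧ |g 0 y| ≤ σ} ≤
      ENNReal.ofReal (2 * m * (2 * (m + 1).factorial * σ / c) ^ (1 / m : ℝ)) := by
  by_contra! hcon
  -- The value for which `c * h ^ m = 2 * (m + 1)! * σ`, twice what separated points allow.
  set h : ℝ := (2 * (m + 1).factorial * σ / c) ^ (1 / m : ℝ) with hh
  have hpos : 0 < h := by positivity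
  obtain ⟨s, hs, hsE, hsep⟩ := exists_separated_finset m h hpos _ hcon
  have := derivative_bound_of_separated m I hI g hg c σ h hpos hc s hs (fun y hy => (hsE hy).1)
    (fun y hy => (hsE hy).2) hsep
  have hpow : h ^ m = 2 * (m + 1).factorial * σ / c := by
    rw [hh, one_div, Real.rpow_inv_natCast_pow (by positivity) hm.ne']
  rw [hpow, mul_div_cancel₀ _ hc0.ne'] at this
  have : 0 < ((m + 1).factorial : ℝ) * σ := by positivity
  linarith

/-- Dyadic bound of a negative power by indicator functions of sublevel sets. -/
theorem enorm_rpow_neg_le_tsum (x ε : ℝ) (hε : 0 < ε) :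
    ‖x‖ₑ ^ (-ε) ≤ 1 + ∑' k : ℕ, ENNReal.ofReal (2 ^ ((k + 1 : ℝ) * ε)) *
      ({z : ℝ | |z| ≤ (1 / 2) ^ k}.indicator 1 x) := by
  have hterm : ∀ k : ℕ, |x| ≤ (1 / 2) ^ k → (1 / 2) ^ (k + 1) < |x| →
      ‖x‖ₑ ^ (-ε) ≤ 1 + ∑' k : ℕ, ENNReal.ofReal (2 ^ ((k + 1 : ℝ) * ε)) *
      ({z : ℝ | |z| ≤ (1 / 2) ^ k}.indicator 1 x) := by
    intro k hk1 hk2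
    refine le_trans ?_ le_add_self
    refine le_trans ?_ (ENNReal.le_tsum k)
    rw [Set.indicator_of_mem (by exact hk1), Pi.one_apply, mul_one]
    have hx : 0 < |x| := lt_trans (by positivity) hk2
    rw [Real.enorm_eq_ofReal_abs, ENNReal.ofReal_rpow_of_pos hx]
    apply ENNReal.ofReal_le_ofReal
    calc |x| ^ (-ε) ≤ ((1 / 2 : ℝ) ^ (k + 1)) ^ (-ε) :=
          Real.rpow_le_rpow_of_nonpos (by positivity) hk2.le (by linarith)
      _ = 2 ^ ((k + 1 : ℝ) * ε) := by
        rw [one_div, inv_pow, ← Real.rpow_natCast, ← Real.rpow_neg (by norm_num),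
          ← Real.rpow_mul (by norm_num)]
        push_cast
        congr 1
        ring
  rcases lt_or_ge 1 |x| with h1 | h1
  · refine le_trans ?_ le_self_add
    rw [ENNReal.rpow_neg, ENNReal.inv_le_one, Real.enorm_eq_ofReal_abs]
    exact ENNReal.one_le_rpow (by simpa using h1.le) hε
  -- At `x = 0` the left side is `⊤`; no indicator vanishes there and every weight is at least `1`,
  -- so the series is `⊤` too.
  rcases eq_or_ne x 0 with rfl | hx
  · have : ∑' k : ℕ, ENNReal.ofReal (2 ^ ((k + 1 : ℝ) * ε)) *
        ({z : ℝ | |z| ≤ (1 / 2) ^ k}.indicator 1 (0 : ℝ)) = ⊤ := by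
      rw [eq_top_iff, ← ENNReal.tsum_const_eq_top_of_ne_zero (α := ℕ) one_ne_zero]
      refine ENNReal.tsum_le_tsum fun k => ?_
      rw [Set.indicator_of_mem (by simp), Pi.one_apply, mul_one, ENNReal.one_le_ofReal]
      exact Real.one_le_rpow (by norm_num) (by positivity)
    rw [this]; simp
  · obtain ⟨k, hk1, hk2⟩ := exists_nat_pow_near_of_lt_one (abs_pos.2 hx) h1
      (by norm_num : (0 : ℝ) < 1 / 2) (by norm_num)
    exact hterm k hk2 hk1

/-- The constant in `lintegral_enorm_rpow_neg_le`. -/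
noncomputable def negPowBound (m : ℕ) (c ε : ℝ) (L : ℝ≥0∞) : ℝ≥0∞ :=
  L + ∑' k : ℕ, ENNReal.ofReal (2 ^ ((k + 1 : ℝ) * ε)) *
    ENNReal.ofReal (2 * m * (2 * (m + 1).factorial * (1 / 2) ^ k / c) ^ (1 / m : ℝ))

/-- The `k`-th term is a constant times `2 ^ (k (ε - 1/m))`: a geometric series, convergent because
`m ε < 1`. -/
theorem negPowBound_lt_top (m : ℕ) (hm : 0 < m) (c ε : ℝ) (hc : 0 < c) (hε : m * ε < 1)
    (L : ℝ≥0∞) (hL : L < ⊤) : negPowBound m c ε L < ⊤ := by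
  refine ENNReal.add_lt_top.2 ⟨hL, ?_⟩
  have hm' : (0 : ℝ) < m := by exact_mod_cast hm
  have key : ∀ k : ℕ, ENNReal.ofReal (2 ^ ((k + 1 : ℝ) * ε)) *
      ENNReal.ofReal (2 * m * (2 * (m + 1).factorial * (1 / 2) ^ k / c) ^ (1 / m : ℝ)) =
      ENNReal.ofReal ((2 ^ ε * (2 * m * (2 * (m + 1).factorial / c) ^ (1 / m : ℝ))) *
        (2 ^ (ε - 1 / m : ℝ)) ^ k) := by
    intro k
    rw [← ENNReal.ofReal_mul (by positivity)]
    congr 1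
    have h1 : (2 * (m + 1).factorial * (1 / 2) ^ k / c : ℝ) ^ (1 / m : ℝ) =
        (2 * (m + 1).factorial / c) ^ (1 / m : ℝ) * ((1 / 2) ^ k) ^ (1 / m : ℝ) := by
      rw [← Real.mul_rpow (by positivity) (by positivity)]
      congr 1; ring
    have h2 : (((1 / 2 : ℝ)) ^ k) ^ (1 / m : ℝ) = 2 ^ (-(1 / m : ℝ) * k) := by
      rw [one_div, inv_pow, ← Real.rpow_natCast, ← Real.rpow_neg (by norm_num),
          ← Real.rpow_mul (by norm_num)]
      congr 1; ring
    have h3 : ((2 : ℝ) ^ (ε - 1 / m : ℝ)) ^ k = 2 ^ (k * ε) * 2 ^ (-(1 / m : ℝ) * k) := by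
      rw [← Real.rpow_natCast, ← Real.rpow_mul (by norm_num), ← Real.rpow_add (by norm_num)]
      congr 1; ring
    have h4 : (2 : ℝ) ^ ((k + 1 : ℝ) * ε) = 2 ^ ε * 2 ^ (k * ε) := by
      rw [← Real.rpow_add (by norm_num)]; congr 1; ring
    rw [h1, h2, h3, h4]; ring
  simp_rw [key]
  have hsum : Summable fun k : ℕ =>
      (2 ^ ε * (2 * m * (2 * (m + 1).factorial / c) ^ (1 / m : ℝ))) *
        ((2 : ℝ) ^ (ε - 1 / m : ℝ)) ^ k := by
    refine Summable.mul_left _ (summable_geometric_of_lt_one (by positivity) ?_)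
    apply Real.rpow_lt_one_of_one_lt_of_neg (by norm_num)
    rw [sub_neg, lt_div_iff₀ hm']
    linarith
  rw [← ENNReal.ofReal_tsum_of_nonneg (fun k => by positivity) hsum]
  exact ENNReal.ofReal_lt_top

/-- Uniform local integrability of a negative power of a function with a large derivative. -/
theorem lintegral_enorm_rpow_neg_le (m : ℕ) (hm : 0 < m) (I : Set ℝ) (hI : Convex ℝ I)
    (hIm : MeasurableSet I) (g : ℕ → ℝ → ℝ)
    (hg : ∀ k < m, ∀ y ∈ I, HasDerivAt (g k) (g (k + 1) y) y) (c ε : ℝ) (hc0 : 0 < c)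
    (hε : 0 < ε) (hc : ∀ y ∈ I, c ≤ |g m y|) :
    ∫⁻ y in I, ‖g 0 y‖ₑ ^ (-ε) ≤ negPowBound m c ε (volume I) := by
  have hcont : ContinuousOn (g 0) I := fun y hy => (hg 0 hm y hy).continuousAt.continuousWithinAt
  have hset : ∀ k : ℕ, MeasurableSet {z : ℝ | |z| ≤ (1 / 2) ^ k} := fun k =>
    measurableSet_le measurable_norm measurable_const
  calc ∫⁻ y in I, ‖g 0 y‖ₑ ^ (-ε)
      ≤ ∫⁻ y in I, (1 + ∑' k : ℕ, ENNReal.ofReal (2 ^ ((k + 1 : ℝ) * ε)) *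
        ({z : ℝ | |z| ≤ (1 / 2) ^ k}.indicator 1 (g 0 y))) :=
        lintegral_mono fun y => enorm_rpow_neg_le_tsum _ _ hε
    _ = volume I + ∑' k : ℕ, ENNReal.ofReal (2 ^ ((k + 1 : ℝ) * ε)) *
        ∫⁻ y in I, ({z : ℝ | |z| ≤ (1 / 2) ^ k}.indicator 1 (g 0 y)) := by
      rw [lintegral_add_left measurable_const, setLIntegral_one, lintegral_tsum]
      · congr 2
        funext k
        rw [lintegral_const_mul' _ _ ENNReal.ofReal_ne_top]
      · intro k
        exact (((measurable_one.indicator (hset k)).comp_aemeasurable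
          (hcont.aemeasurable hIm))).const_mul _
    _ ≤ negPowBound m c ε (volume I) := by
      refine add_le_add le_rfl (ENNReal.tsum_le_tsum fun k => mul_le_mul_right ?_ _)
      refine le_trans ?_ (volume_sublevel_le m hm I hI g hg c ((1 / 2) ^ k) hc0 (by positivity) hc)
      have hme : MeasurableSet {y | y ∈ I ∧ |g 0 y| ≤ (1 / 2) ^ k} := by
        obtain ⟨u, hu, hu'⟩ := continuousOn_iff_isClosed.1 hcont.abs (Set.Iic ((1 / 2) ^ k))
          isClosed_Iic
        have : {y | y ∈ I ∧ |g 0 y| ≤ (1 / 2) ^ k} = u ∩ I := by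
          rw [← hu', Set.inter_comm]; rfl
        rw [this]
        exact hu.measurableSet.inter hIm
      rw [← setLIntegral_one, ← lintegral_indicator hIm, ← lintegral_indicator hme]
      refine lintegral_mono fun y => ?_
      refine Set.indicator_apply_le' (fun h1 => ?_) (fun _ => zero_le)
      refine Set.indicator_apply_le' (fun h2 => ?_) (fun _ => zero_le)
      rw [Set.indicator_of_mem (show y ∈ {y | y ∈ I ∧ |g 0 y| ≤ (1 / 2) ^ k} from ⟨h1, h2⟩)]
      rfl

/-! ### Double power series -/

/-- The sum of a double power series. -/
noncomputable def series2 (u : ℕ × ℕ → ℝ) (x y : ℝ) : ℝ := ∑' ab : ℕ × ℕ, u ab * x ^ ab.1 * y ^ ab.2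

/-- The double power series converges absolutely on the open bidisc of radius `ρ`. -/
def ConvOn (u : ℕ × ℕ → ℝ) (ρ : ℝ) : Prop :=
  ∀ r, 0 ≤ r → r < ρ → Summable fun ab : ℕ × ℕ => |u ab| * r ^ (ab.1 + ab.2)

/-- The coefficients of the derivative in the second variable. -/
def dY (u : ℕ × ℕ → ℝ) (ab : ℕ × ℕ) : ℝ := (ab.2 + 1) * u (ab.1, ab.2 + 1)

theorem shift_injective : Function.Injective fun ab : ℕ × ℕ => (ab.1, ab.2 + 1) := by
  rintro ⟨a, b⟩ ⟨a', b'⟩ h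
  simpa using h

/-- The factor produced by differentiation is absorbed by a slightly larger radius `r'`, since `(n +
1) (r / r') ^ n` is bounded; the index shift costs one further factor `1 / r'`. -/
theorem ConvOn.dY {u : ℕ × ℕ → ℝ} {ρ : ℝ} (hu : ConvOn u ρ) : ConvOn (dY u) ρ := by
  intro r hr hrρ
  obtain ⟨r', hr1, hr2⟩ := exists_between hrρ
  have hr' : 0 < r' := hr.trans_lt hr1
  have hq : r / r' < 1 := (div_lt_one hr').2 hr1
  have hq0 : 0 ≤ r / r' := by positivity
  obtain ⟨K, hK⟩ : ∃ K : ℝ, ∀ n : ℕ, (n + 1 : ℝ) * (r / r') ^ n ≤ K := by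
    have h1 := (tendsto_pow_const_mul_const_pow_of_abs_lt_one 1
      (show |r / r'| < 1 by rwa [abs_of_nonneg hq0])).add
        (tendsto_pow_atTop_nhds_zero_of_lt_one hq0 hq)
    obtain ⟨K, hK⟩ := h1.bddAbove_range
    refine ⟨K, fun n => ?_⟩
    have := hK ⟨n, rfl⟩
    simp only [pow_one] at this
    linarith
  have h2 := ((hu r' hr'.le hr2).comp_injective shift_injective).mul_left (K / r')
  refine Summable.of_nonneg_of_le (fun ab => by positivity) (fun ab => ?_) h2
  have h3 := hK (ab.1 + ab.2)
  simp only [_root_.dY, Function.comp, abs_mul]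
  have h4 : r ^ (ab.1 + ab.2) = (r / r') ^ (ab.1 + ab.2) * r' ^ (ab.1 + ab.2) := by
    rw [div_pow, div_mul_cancel₀ _ (by positivity)]
  have h5 : |(ab.2 + 1 : ℝ)| ≤ ((ab.1 + ab.2 : ℕ) + 1 : ℝ) := by
    rw [abs_of_nonneg (by positivity)]
    push_cast
    linarith [(Nat.cast_nonneg ab.1 : (0 : ℝ) ≤ ab.1)]
  calc |(ab.2 + 1 : ℝ)| * |u (ab.1, ab.2 + 1)| * r ^ (ab.1 + ab.2)
      ≤ ((ab.1 + ab.2 : ℕ) + 1 : ℝ) * |u (ab.1, ab.2 + 1)| * r ^ (ab.1 + ab.2) := by gcongr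
    _ = (((ab.1 + ab.2 : ℕ) + 1 : ℝ) * (r / r') ^ (ab.1 + ab.2)) *
        (|u (ab.1, ab.2 + 1)| * r' ^ (ab.1 + ab.2)) := by rw [h4]; ring
    _ ≤ K * (|u (ab.1, ab.2 + 1)| * r' ^ (ab.1 + ab.2)) := by gcongr
    _ = _ := by rw [← add_assoc, pow_succ]; field_simp

theorem ConvOn.iterate_dY {u : ℕ × ℕ → ℝ} {ρ : ℝ} (hu : ConvOn u ρ) (k : ℕ) :
    ConvOn (_root_.dY^[k] u) ρ := by
  induction k with
  | zero => exact hu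
  | succ k ih => rw [Function.iterate_succ_apply']; exact ih.dY

theorem ConvOn.swap {u : ℕ × ℕ → ℝ} {ρ : ℝ} (hu : ConvOn u ρ) : ConvOn (u ∘ Prod.swap) ρ := by
  intro r hr hrρ
  refine ((hu r hr hrρ).comp_injective Prod.swap_injective).congr fun ab => ?_
  simp [add_comm]

theorem series2_swap (u : ℕ × ℕ → ℝ) (x y : ℝ) : series2 (u ∘ Prod.swap) y x = series2 u x y := by
  unfold series2
  rw [← (Equiv.prodComm ℕ ℕ).tsum_eq]
  refine tsum_congr fun ab => ?_
  simp
  ring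

theorem abs_term_le (u : ℕ × ℕ → ℝ) {x y r : ℝ} (hx : |x| ≤ r) (hy : |y| ≤ r) (ab : ℕ × ℕ) :
    |u ab * x ^ ab.1 * y ^ ab.2| ≤ |u ab| * r ^ (ab.1 + ab.2) := by
  rw [abs_mul, abs_mul, abs_pow, abs_pow, pow_add, mul_assoc]
  have : 0 ≤ r := (abs_nonneg x).trans hx
  gcongr

theorem ConvOn.summable {u : ℕ × ℕ → ℝ} {ρ : ℝ} (hu : ConvOn u ρ) {x y : ℝ} (hx : |x| < ρ)
    (hy : |y| < ρ) : Summable fun ab : ℕ × ℕ => u ab * x ^ ab.1 * y ^ ab.2 :=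
  Summable.of_norm_bounded
    (hu (max |x| |y|) ((abs_nonneg x).trans (le_max_left _ _)) (max_lt hx hy))
    fun ab => abs_term_le u (le_max_left _ _) (le_max_right _ _) ab

/-- Differentiation term by term, with the differentiated series dominated at an intermediate radius
`r`. -/
theorem ConvOn.hasDerivAt {u : ℕ × ℕ → ℝ} {ρ : ℝ} (hu : ConvOn u ρ) {x y : ℝ} (hx : |x| < ρ)
    (hy : |y| < ρ) : HasDerivAt (fun y => series2 u x y) (series2 (_root_.dY u) x y) y := by
  obtain ⟨r, hr1, hr2⟩ := exists_between (max_lt hx hy)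
  have hxr : |x| < r := (le_max_left _ _).trans_lt hr1
  have hyr : |y| < r := (le_max_right _ _).trans_lt hr1
  have hr0 : 0 ≤ r := (abs_nonneg x).trans hxr.le
  -- Terms not reached by the shift are constant in `y`; the factor `ab.2 = 0` kills their
  -- derivatives, whatever the truncated exponent `ab.2 - 1` is.
  have hzero : ∀ ab : ℕ × ℕ, ab ∉ Set.range (fun ab : ℕ × ℕ => (ab.1, ab.2 + 1)) → ab.2 = 0 := by
    rintro ⟨a, b⟩ h
    by_contra hb
    exact h ⟨(a, b - 1), by simp only [Prod.mk.injEq, true_and]; exact Nat.succ_pred hb⟩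
  let f' : ℕ × ℕ → ℝ → ℝ := fun ab z => u ab * x ^ ab.1 * (ab.2 * z ^ (ab.2 - 1))
  have hder : series2 (_root_.dY u) x y = ∑' ab : ℕ × ℕ, f' ab y := by
    rw [← shift_injective.tsum_eq (f := fun ab => f' ab y)]
    · refine tsum_congr fun ab => ?_
      simp only [_root_.dY, f', Nat.add_sub_cancel]
      push_cast
      ring
    · intro ab hab
      by_contra hcon
      exact hab (by simp [f', hzero ab hcon])
  have hsum : Summable fun ab : ℕ × ℕ => |u ab| * r ^ ab.1 * (ab.2 * r ^ (ab.2 - 1)) := by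
    rw [← shift_injective.summable_iff]
    · refine (hu.dY r hr0 hr2).congr fun ab => ?_
      simp only [_root_.dY, abs_mul, pow_add, Function.comp, Nat.add_sub_cancel]
      rw [abs_of_nonneg (by positivity : (0 : ℝ) ≤ ab.2 + 1)]
      push_cast
      ring
    · intro ab hab
      simp [hzero ab hab]
  have hterm : ∀ (ab : ℕ × ℕ) (z : ℝ), z ∈ Set.Ioo (-r) r →
      HasDerivAt (fun z => u ab * x ^ ab.1 * z ^ ab.2) (f' ab z) z :=
    fun ab z _ => (hasDerivAt_pow ab.2 z).const_mul _
  have hbd : ∀ (ab : ℕ × ℕ) (z : ℝ), z ∈ Set.Ioo (-r) r →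
      ‖f' ab z‖ ≤ |u ab| * r ^ ab.1 * (ab.2 * r ^ (ab.2 - 1)) := by
    intro ab z hz
    have hz' : |z| ≤ r := (abs_lt.2 hz).le
    simp only [f']
    rw [Real.norm_eq_abs, abs_mul, abs_mul, abs_mul, abs_pow, abs_pow, Nat.abs_cast]
    gcongr
  rw [hder]
  exact hasDerivAt_tsum_of_isPreconnected hsum isOpen_Ioo isPreconnected_Ioo hterm hbd
    (abs_lt.1 hyr) (hu.summable hx hy) (abs_lt.1 hyr)

theorem ConvOn.iteratedDeriv_eq {u : ℕ × ℕ → ℝ} {ρ : ℝ} (hu : ConvOn u ρ) {x : ℝ} (hx : |x| < ρ)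
    (f : ℝ → ℝ) (hf : ∀ y, |y| < ρ → f y = series2 u x y) (k : ℕ) :
    ∀ y, |y| < ρ → iteratedDeriv k f y = series2 (_root_.dY^[k] u) x y := by
  induction k with
  | zero => simpa using hf
  | succ k ih =>
    intro y hy
    rw [iteratedDeriv_succ, Function.iterate_succ_apply']
    have : iteratedDeriv k f =ᶠ[𝓝 y] fun y => series2 (_root_.dY^[k] u) x y := by
      filter_upwards [(isOpen_lt continuous_abs continuous_const).mem_nhds hy] with z hz
      exact ih z hz
    rw [this.deriv_eq]
    exact ((hu.iterate_dY k).hasDerivAt hx hy).deriv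

/-- The factorials on both sides replace the product `(b + 1) ⋯ (b + k)`; the case `b = 0` extracts
a Taylor coefficient. -/
theorem iterate_dY_apply (u : ℕ × ℕ → ℝ) (k a b : ℕ) :
    b.factorial * dY^[k] u (a, b) = (b + k).factorial * u (a, b + k) := by
  induction k generalizing b with
  | zero => simp
  | succ k ih =>
    rw [Function.iterate_succ_apply', dY]
    have h := ih (b + 1)
    rw [Nat.factorial_succ, show b + 1 + k = b + (k + 1) by ring] at h
    push_cast at h
    rw [← h]
    ring

theorem series2_zero (u : ℕ × ℕ → ℝ) : series2 u 0 0 = u (0, 0) := by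
  unfold series2
  rw [tsum_eq_single (0, 0)]
  · simp
  · rintro ⟨a, b⟩ hab
    by_cases ha : a = 0
    · by_cases hb : b = 0
      · exact absurd (by rw [ha, hb]) hab
      · simp [hb]
    · simp [ha]

/-- The coefficients of a convergent expansion are the Taylor coefficients. -/
theorem ConvOn.taylorCoeff_eq {u : ℕ × ℕ → ℝ} {ρ : ℝ} (hρ : 0 < ρ) (hu : ConvOn u ρ)
    (g : ℝ × ℝ → ℝ) (hg : ∀ x y, |x| < ρ → |y| < ρ → g (x, y) = series2 u x y) (a b : ℕ) :
    Averaging.taylorCoeff g a b = u (a, b) := by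
  unfold Averaging.taylorCoeff
  -- After the inner derivatives at `y = 0`, the swap makes `x` the second variable, so that the
  -- same lemma on `dY` handles the outer ones.
  have h1 : ∀ x, |x| < ρ → iteratedDeriv b (fun y => g (x, y)) 0 =
      series2 ((_root_.dY^[b] u) ∘ Prod.swap) 0 x := by
    intro x hx
    rw [hu.iteratedDeriv_eq hx (fun y => g (x, y)) (fun y hy => hg x y hx hy) b 0 (by simpa),
      series2_swap]
  rw [(hu.iterate_dY b).swap.iteratedDeriv_eq (by simpa) _ h1 a 0 (by simpa), series2_zero]
  have h2 := iterate_dY_apply ((_root_.dY^[b] u) ∘ Prod.swap) a 0 0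
  have h3 := iterate_dY_apply u b a 0
  simp only [Nat.factorial_zero, Nat.cast_one, one_mul, zero_add, Function.comp,
    Prod.swap_prod_mk] at h2 h3
  rw [h2, h3, div_eq_iff (by positivity)]
  ring

/-- Joint continuity of a double series in a parameter and the two variables. -/
theorem ConvOn.continuousOn_param {c : ℕ × ℕ → ℝ} {ρ r : ℝ} (hc : ConvOn c ρ) (hr0 : 0 ≤ r)
    (hr : r < ρ) (w : ℝ → ℕ × ℕ → ℝ) (hw : ∀ ab, ContinuousOn (fun δ => w δ ab) (Set.Icc 0 1))
    (hwc : ∀ δ ∈ Set.Icc (0 : ℝ) 1, ∀ ab, |w δ ab| ≤ |c ab|) :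
    ContinuousOn (fun p : ℝ × ℝ × ℝ => series2 (w p.1) p.2.1 p.2.2)
      (Set.Icc 0 1 ×ˢ Set.Icc (-r) r ×ˢ Set.Icc (-r) r) := by
  unfold series2
  refine continuousOn_tsum (u := fun ab => |c ab| * r ^ (ab.1 + ab.2)) (fun ab => ?_)
    (hc r hr0 hr) (fun ab p hp => ?_)
  · refine ContinuousOn.mul (ContinuousOn.mul ?_ (by fun_prop)) (by fun_prop)
    exact (hw ab).comp continuousOn_fst fun p hp => hp.1
  · refine (abs_term_le _ (abs_le.2 hp.2.1) (abs_le.2 hp.2.2) ab).trans ?_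
    exact mul_le_mul_of_nonneg_right (hwc _ hp.1 ab) (by positivity)

/-- Continuity in the parameter and domination by `c` survive differentiation, so
`ConvOn.continuousOn_param` also applies to the derivatives. -/
theorem iterate_dY_param {c : ℕ × ℕ → ℝ} (w : ℝ → ℕ × ℕ → ℝ)
    (hw : ∀ ab, ContinuousOn (fun δ => w δ ab) (Set.Icc 0 1))
    (hwc : ∀ δ ∈ Set.Icc (0 : ℝ) 1, ∀ ab, |w δ ab| ≤ |c ab|) (k : ℕ) :
    (∀ ab, ContinuousOn (fun δ => dY^[k] (w δ) ab) (Set.Icc 0 1)) ∧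
    ∀ δ ∈ Set.Icc (0 : ℝ) 1, ∀ ab, |dY^[k] (w δ) ab| ≤ |dY^[k] c ab| := by
  induction k with
  | zero => exact ⟨hw, hwc⟩
  | succ k ih =>
    simp only [Function.iterate_succ_apply']
    refine ⟨fun ab => (ih.1 _).const_mul _, fun δ hδ ab => ?_⟩
    simp only [dY, abs_mul]
    exact mul_le_mul_of_nonneg_left (ih.2 δ hδ _) (abs_nonneg _)

/-- An analytic function of two variables is the sum of a double power series. -/
theorem AnalyticAt.exists_series2 {S : ℝ × ℝ → ℝ} (hS : AnalyticAt ℝ S 0) :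
    ∃ (u : ℕ × ℕ → ℝ) (ρ : ℝ), 0 < ρ ∧ ConvOn u ρ ∧
      ∀ x y, |x| < ρ → |y| < ρ → S (x, y) = series2 u x y := by
  obtain ⟨p, R, hp⟩ := hS
  obtain ⟨r, hr0, hrR⟩ := ENNReal.lt_iff_exists_nnreal_btwn.1 hp.r_pos
  have hr : 0 < (r : ℝ) := by exact_mod_cast hr0
  obtain ⟨C, hC0, hC⟩ := p.norm_mul_pow_le_of_lt_radius (hrR.trans_le hp.r_le)
  let e (n : ℕ) (s : Finset (Fin n)) : Fin n → ℝ × ℝ :=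
    fun i => if i ∈ s then (1, 0) else (0, 1)
  -- The coefficient of `x ^ a * y ^ (n - a)` in the homogeneous part of degree `n`: a sum over the
  -- choices of the `a` slots that receive the first basis vector. No symmetry of `p n` is assumed.
  let v (n a : ℕ) : ℝ := ∑ s ∈ (Finset.univ : Finset (Fin n)).powersetCard a, p n (e n s)
  let u : ℕ × ℕ → ℝ := fun ab => v (ab.1 + ab.2) ab.1
  have hv : ∀ n a, |v n a| ≤ 2 ^ n * ‖p n‖ := by
    intro n a
    refine (Finset.abs_sum_le_sum_abs _ _).trans ?_
    have h1 : ∀ s ∈ (Finset.univ : Finset (Fin n)).powersetCard a, |p n (e n s)| ≤ ‖p n‖ := by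
      intro s _
      refine ((p n).le_opNorm _).trans ?_
      have : ∏ i, ‖e n s i‖ = 1 := by
        refine Finset.prod_eq_one fun i _ => ?_
        by_cases hi : i ∈ s <;> simp [e, hi]
      rw [this, mul_one]
    refine (Finset.sum_le_card_nsmul _ _ _ h1).trans ?_
    rw [nsmul_eq_mul, Finset.card_powersetCard, Finset.card_univ, Fintype.card_fin]
    gcongr
    exact_mod_cast Nat.choose_le_two_pow n a
  -- There may be up to `2 ^ n` choices of slots in degree `n`, which costs a factor `2` in the
  -- radius.
  have hu : ConvOn u (r / 2) := by
    intro t ht htr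
    have hq0 : 0 ≤ 2 * t / r := by positivity
    have hq : 2 * t / r < 1 := by rw [div_lt_one hr]; linarith
    have hs := summable_geometric_of_lt_one hq0 hq
    refine Summable.of_nonneg_of_le (fun ab => by positivity) (fun ab => ?_)
      ((hs.mul_of_nonneg hs (fun _ => by positivity) (fun _ => by positivity)).mul_left C)
    have h1 := hC (ab.1 + ab.2)
    have h2 := hv (ab.1 + ab.2) ab.1
    calc |u ab| * t ^ (ab.1 + ab.2)
        ≤ 2 ^ (ab.1 + ab.2) * ‖p (ab.1 + ab.2)‖ * t ^ (ab.1 + ab.2) := by gcongr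
      _ = (‖p (ab.1 + ab.2)‖ * r ^ (ab.1 + ab.2)) * (2 * t / r) ^ (ab.1 + ab.2) := by
        rw [div_pow, mul_pow]; field_simp
      _ ≤ C * (2 * t / r) ^ (ab.1 + ab.2) := by gcongr
      _ = _ := by rw [pow_add]
  refine ⟨u, r / 2, by positivity, hu, fun x y hx hy => ?_⟩
  have hball : (x, y) ∈ Metric.eball (0 : ℝ × ℝ) R := by
    refine Metric.eball_subset_eball hrR.le ?_
    rw [Metric.eball_coe, mem_ball_zero_iff, Prod.norm_def]
    simp only [Real.norm_eq_abs]
    exact max_lt (by linarith) (by linarith)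
  have hpn : ∀ n, p n (fun _ => (x, y)) =
      ∑ ab ∈ Finset.HasAntidiagonal.antidiagonal n, u ab * x ^ ab.1 * y ^ ab.2 := by
    intro n
    have h1 : (fun _ : Fin n => (x, y)) =
        (fun _ => x • ((1, 0) : ℝ × ℝ)) + fun _ => y • ((0, 1) : ℝ × ℝ) := by
      funext i; simp
    have h2 : ∀ s : Finset (Fin n), p n (s.piecewise (fun _ => x • ((1, 0) : ℝ × ℝ))
        (fun _ => y • ((0, 1) : ℝ × ℝ))) = x ^ s.card * y ^ (n - s.card) * p n (e n s) := by
      intro s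
      have h3 : s.piecewise (fun _ => x • ((1, 0) : ℝ × ℝ)) (fun _ => y • ((0, 1) : ℝ × ℝ)) =
          fun i => (if i ∈ s then x else y) • e n s i := by
        funext i
        by_cases hi : i ∈ s <;> simp [e, hi]
      rw [h3, (p n).map_smul_univ, smul_eq_mul]
      congr 1
      rw [Finset.prod_ite, Finset.prod_const, Finset.prod_const]
      congr 2
      · simp
      · rw [Finset.filter_not, Finset.card_sdiff_of_subset (Finset.filter_subset _ _)]
        simp
    rw [h1, (p n).map_add_univ]
    simp_rw [h2]
    rw [← Finset.powerset_univ, Finset.sum_powerset, Finset.card_univ, Fintype.card_fin,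
      Finset.Nat.sum_antidiagonal_eq_sum_range_succ_mk]
    refine Finset.sum_congr rfl fun a ha => ?_
    have han : a + (n - a) = n := by have := Finset.mem_range.1 ha; omega
    have hua : u (a, n - a) = v n a := by simp only [u]; rw [han]
    rw [hua]
    simp only [v, Finset.sum_mul]
    refine Finset.sum_congr rfl fun s hs => ?_
    rw [(Finset.mem_powersetCard.1 hs).2]
    ring
  have hsum := hp.hasSum hball
  rw [zero_add] at hsum
  have hF := hu.summable hx hy
  rw [← hsum.tsum_eq]
  set F : ℕ × ℕ → ℝ := fun ab => u ab * x ^ ab.1 * y ^ ab.2 with hFdef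
  have hF' := (Finset.HasAntidiagonal.sigmaAntidiagonalEquivProd (A := ℕ)).summable_iff.2 hF
  have h1 : series2 u x y =
      ∑' c, (F ∘ (Finset.HasAntidiagonal.sigmaAntidiagonalEquivProd (A := ℕ))) c :=
    ((Finset.HasAntidiagonal.sigmaAntidiagonalEquivProd (A := ℕ)).tsum_eq F).symm
  rw [h1, hF'.tsum_sigma' fun n => (hasSum_fintype _).summable]
  refine tsum_congr fun n => ?_
  rw [hpn, tsum_fintype, ← Finset.sum_attach]
  rfl

/-! ### Integrability of negative powers by anisotropic scaling -/

/-- By joint continuity the `m`-th `y`-derivative stays above half its size at `(0, x₀, y₀)` for all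
nearby parameters and points. The one-variable estimate then holds on every vertical segment with
one constant, and integration in `x` finishes. -/
theorem local_bound_of_ne_zero_Y {c : ℕ × ℕ → ℝ} {ρ σ : ℝ} (hc : ConvOn c ρ) (hσ0 : 0 < σ)
    (hσ : σ < ρ) (w : ℝ → ℕ × ℕ → ℝ) (hw : ∀ ab, ContinuousOn (fun δ => w δ ab) (Set.Icc 0 1))
    (hwc : ∀ δ ∈ Set.Icc (0 : ℝ) 1, ∀ ab, |w δ ab| ≤ |c ab|) (x₀ y₀ : ℝ) (hx₀ : |x₀| ≤ σ)
    (hy₀ : |y₀| ≤ σ) (m : ℕ) (hm : series2 (dY^[m] (w 0)) x₀ y₀ ≠ 0) (ε : ℝ) (hε0 : 0 < ε)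
    (hε : m * ε < 1) :
    ∃ r₀ > 0, ∃ δ₁ > 0, ∃ C < (⊤ : ℝ≥0∞), ∀ δ, 0 ≤ δ → δ ≤ δ₁ →
      ∫⁻ t in Set.Icc (x₀ - r₀) (x₀ + r₀) ×ˢ Set.Icc (y₀ - r₀) (y₀ + r₀),
        ‖series2 (w δ) t.1 t.2‖ₑ ^ (-ε) ≤ C := by
  obtain ⟨r, hr1, hr2⟩ := exists_between hσ
  have hr0 : 0 < r := hσ0.trans hr1
  obtain ⟨hw', hwc'⟩ := iterate_dY_param w hw hwc m
  have hcont := (hc.iterate_dY m).continuousOn_param hr0.le hr2 (fun δ => dY^[m] (w δ)) hw' hwc'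
  have hmem : ((0 : ℝ), x₀, y₀) ∈ Set.Icc (0 : ℝ) 1 ×ˢ Set.Icc (-r) r ×ˢ Set.Icc (-r) r :=
    ⟨by simp, abs_le.1 (hx₀.trans hr1.le), abs_le.1 (hy₀.trans hr1.le)⟩
  set c₀ := |series2 (dY^[m] (w 0)) x₀ y₀| / 2 with hc₀
  have hc₀pos : 0 < c₀ := by have := abs_pos.2 hm; positivity
  have hev := (hcont _ hmem).abs.eventually (lt_mem_nhds (a := c₀) (by
    have := abs_pos.2 hm
    simp only [hc₀]
    linarith))
  obtain ⟨τ, hτ, hτs⟩ := Metric.mem_nhdsWithin_iff.1 hev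
  have hbound : ∀ δ x y, 0 ≤ δ → δ ≤ 1 → |x| ≤ r → |y| ≤ r → δ < τ → |x - x₀| < τ →
      |y - y₀| < τ → c₀ ≤ |series2 (dY^[m] (w δ)) x y| := by
    intro δ x y h1 h2 h3 h4 h5 h6 h7
    have : (δ, x, y) ∈ Metric.ball ((0 : ℝ), x₀, y₀) τ := by
      rw [Metric.mem_ball, Prod.dist_eq, Prod.dist_eq, Real.dist_eq, Real.dist_eq, Real.dist_eq]
      simp [abs_of_nonneg h1, h5, h6, h7]
    exact le_of_lt (hτs ⟨this, ⟨h1, h2⟩, abs_le.1 h3, abs_le.1 h4⟩)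
  set r₀ := min (τ / 2) (r - σ) with hr₀
  have hr₀pos : 0 < r₀ := lt_min (by positivity) (by linarith)
  have hr₀τ : r₀ < τ := (min_le_left _ _).trans_lt (by linarith)
  have hr₀r : r₀ ≤ r - σ := min_le_right _ _
  have hnear : ∀ z₀ z : ℝ, |z₀| ≤ σ → z ∈ Set.Icc (z₀ - r₀) (z₀ + r₀) → |z| ≤ r ∧ |z - z₀| < τ := by
    intro z₀ z h1 h2
    have h3 : |z - z₀| ≤ r₀ := by rw [abs_le]; constructor <;> linarith [h2.1, h2.2]
    refine ⟨?_, h3.trans_lt hr₀τ⟩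
    calc |z| = |(z - z₀) + z₀| := by ring_nf
      _ ≤ _ := abs_add_le _ _
      _ ≤ r := by linarith
  set I := Set.Icc (x₀ - r₀) (x₀ + r₀) with hI
  set J := Set.Icc (y₀ - r₀) (y₀ + r₀) with hJ
  have hb : ∀ δ, 0 ≤ δ → δ ≤ min (τ / 2) 1 → ∀ x ∈ I, ∀ y ∈ J,
      c₀ ≤ |series2 (dY^[m] (w δ)) x y| := by
    intro δ h1 h2 x hx y hy
    exact hbound δ x y h1 (h2.trans (min_le_right _ _)) (hnear _ _ hx₀ hx).1 (hnear _ _ hy₀ hy).1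
      ((h2.trans (min_le_left _ _)).trans_lt (by linarith)) (hnear _ _ hx₀ hx).2
      (hnear _ _ hy₀ hy).2
  have hvolI : volume I < ⊤ := by rw [hI, Real.volume_Icc]; exact ENNReal.ofReal_lt_top
  have hvolJ : volume J < ⊤ := by rw [hJ, Real.volume_Icc]; exact ENNReal.ofReal_lt_top
  have hfub : ∀ (f : ℝ × ℝ → ℝ≥0∞) (C : ℝ≥0∞), (∀ x ∈ I, ∫⁻ y in J, f (x, y) ≤ C) →
      ∫⁻ t in I ×ˢ J, f t ≤ C * volume I := by
    intro f C h
    rw [Measure.volume_eq_prod, ← Measure.prod_restrict]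
    refine (lintegral_prod_le _).trans ?_
    rw [← setLIntegral_const]
    exact setLIntegral_mono measurable_const h
  refine ⟨r₀, hr₀pos, min (τ / 2) 1, lt_min (by positivity) one_pos, ?_⟩
  -- The sublevel estimate needs `m > 0`; for `m = 0` the function itself is bounded below.
  rcases Nat.eq_zero_or_pos m with rfl | hmpos
  · refine ⟨ENNReal.ofReal c₀ ^ (-ε) * volume J * volume I,
      ENNReal.mul_lt_top (ENNReal.mul_lt_top ?_ hvolJ) hvolI, fun δ h1 h2 => ?_⟩
    · rw [ENNReal.ofReal_rpow_of_pos hc₀pos]; exact ENNReal.ofReal_lt_top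
    refine hfub _ _ fun x hx => ?_
    rw [← setLIntegral_const]
    refine setLIntegral_mono measurable_const fun y hy => ?_
    rw [ENNReal.rpow_neg, ENNReal.rpow_neg, ENNReal.inv_le_inv]
    refine ENNReal.rpow_le_rpow ?_ hε0.le
    rw [Real.enorm_eq_ofReal_abs]
    exact ENNReal.ofReal_le_ofReal (hb δ h1 h2 x hx y hy)
  · refine ⟨negPowBound m c₀ ε (volume J) * volume I,
      ENNReal.mul_lt_top (negPowBound_lt_top m hmpos c₀ ε hc₀pos hε _ hvolJ) hvolI,
      fun δ h1 h2 => ?_⟩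
    refine hfub _ _ fun x hx => ?_
    have hδ : δ ∈ Set.Icc (0 : ℝ) 1 := ⟨h1, h2.trans (min_le_right _ _)⟩
    have hwδ : ConvOn (w δ) ρ := fun s hs0 hs => Summable.of_nonneg_of_le
      (fun ab => by positivity)
      (fun ab => mul_le_mul_of_nonneg_right (hwc δ hδ ab) (by positivity)) (hc s hs0 hs)
    refine lintegral_enorm_rpow_neg_le m hmpos J (convex_Icc _ _) measurableSet_Icc
      (fun k y => series2 (dY^[k] (w δ)) x y) (fun k _ y hy => ?_) c₀ ε hc₀pos hε0
      (hb δ h1 h2 x hx)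
    simp only [Function.iterate_succ_apply']
    exact (hwδ.iterate_dY k).hasDerivAt ((hnear _ _ hx₀ hx).1.trans_lt hr2)
      ((hnear _ _ hy₀ hy).1.trans_lt hr2)

/-- The same bound from an `x`-derivative, by reflection in the diagonal. -/
theorem local_bound_of_ne_zero_X {c : ℕ × ℕ → ℝ} {ρ σ : ℝ} (hc : ConvOn c ρ) (hσ0 : 0 < σ)
    (hσ : σ < ρ) (w : ℝ → ℕ × ℕ → ℝ) (hw : ∀ ab, ContinuousOn (fun δ => w δ ab) (Set.Icc 0 1))
    (hwc : ∀ δ ∈ Set.Icc (0 : ℝ) 1, ∀ ab, |w δ ab| ≤ |c ab|) (x₀ y₀ : ℝ) (hx₀ : |x₀| ≤ σ)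
    (hy₀ : |y₀| ≤ σ) (m : ℕ) (hm : series2 (dY^[m] (w 0 ∘ Prod.swap)) y₀ x₀ ≠ 0) (ε : ℝ)
    (hε0 : 0 < ε) (hε : m * ε < 1) :
    ∃ r₀ > 0, ∃ δ₁ > 0, ∃ C < (⊤ : ℝ≥0∞), ∀ δ, 0 ≤ δ → δ ≤ δ₁ →
      ∫⁻ t in Set.Icc (x₀ - r₀) (x₀ + r₀) ×ˢ Set.Icc (y₀ - r₀) (y₀ + r₀),
        ‖series2 (w δ) t.1 t.2‖ₑ ^ (-ε) ≤ C := by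
  obtain ⟨r₀, hr₀, δ₁, hδ₁, C, hC, h⟩ := local_bound_of_ne_zero_Y hc.swap hσ0 hσ
    (fun δ => w δ ∘ Prod.swap) (fun ab => hw _) (fun δ hδ ab => hwc δ hδ _) y₀ x₀ hy₀ hx₀ m hm ε
    hε0 hε
  refine ⟨r₀, hr₀, δ₁, hδ₁, C, hC, fun δ h1 h2 => le_trans (le_of_eq ?_) (h δ h1 h2)⟩
  rw [Measure.volume_eq_prod, ← Measure.prod_restrict, ← Measure.prod_restrict,
    ← lintegral_prod_swap]
  simp only [series2_swap, Prod.fst_swap, Prod.snd_swap]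

/-- Change of variables under a diagonal scaling. -/
theorem lintegral_comp_diag (a b : ℝ) (ha : 0 < a) (hb : 0 < b) (f : ℝ × ℝ → ℝ≥0∞) :
    ∫⁻ t, f t = ENNReal.ofReal (a * b) * ∫⁻ t : ℝ × ℝ, f (a * t.1, b * t.2) := by
  have hmap : Measure.map (Prod.map (a * ·) (b * ·)) (volume : Measure (ℝ × ℝ)) =
      ENNReal.ofReal (a * b)⁻¹ • volume := by
    rw [Measure.volume_eq_prod, ← Measure.map_prod_map _ _ (measurable_const_mul a)
      (measurable_const_mul b), Real.map_volume_mul_left ha.ne', Real.map_volume_mul_left hb.ne',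
      Measure.prod_smul_left, Measure.prod_smul_right, smul_smul, ← ENNReal.ofReal_mul (by positivity),
      abs_of_pos (by positivity), abs_of_pos (by positivity), mul_inv]
  have hemb : MeasurableEmbedding (Prod.map (a * ·) (b * ·) : ℝ × ℝ → ℝ × ℝ) :=
    (measurableEmbedding_mulLeft₀ ha.ne').prodMap (measurableEmbedding_mulLeft₀ hb.ne')
  have h1 := hemb.lintegral_map f (μ := volume)
  rw [hmap, lintegral_smul_measure] at h1
  change _ = ∫⁻ t : ℝ × ℝ, f (a * t.1, b * t.2) at h1
  rw [← h1, smul_eq_mul, ← mul_assoc, ← ENNReal.ofReal_mul (by positivity),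
    mul_inv_cancel₀ (by positivity), ENNReal.ofReal_one, one_mul]

/-- Integrability near the origin of a negative power of a double power series, under a condition
on its quasi-homogeneous principal part for the weights `κ₁, κ₂`. -/
theorem exists_lintegral_rpow_neg_lt_top {c : ℕ × ℕ → ℝ} {ρ : ℝ} (hρ : 0 < ρ) (hc : ConvOn c ρ)
    (κ₁ κ₂ : ℝ) (hκ₁ : 0 < κ₁) (hκ₂ : 0 < κ₂)
    (hκ : ∀ ab, c ab ≠ 0 → 1 ≤ κ₁ * ab.1 + κ₂ * ab.2) (ε : ℝ) (hε0 : 0 < ε) (hε : ε < κ₁ + κ₂)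
    (hprin : ∀ x y : ℝ, (x ≠ 0 ∨ y ≠ 0) → ∃ m : ℕ, m * ε < 1 ∧
      (series2 (dY^[m] (fun ab => if κ₁ * ab.1 + κ₂ * ab.2 = 1 then c ab else 0)) x y ≠ 0 ∨
      series2 (dY^[m] ((fun ab : ℕ × ℕ => if κ₁ * ab.1 + κ₂ * ab.2 = 1 then c ab else 0) ∘
        Prod.swap)) y x ≠ 0))
    (S : ℝ × ℝ → ℝ) (hS : ∀ x y, |x| < ρ → |y| < ρ → S (x, y) = series2 c x y) :
    ∃ V ∈ 𝓝 (0 : ℝ × ℝ), ∫⁻ t in V, ‖S t‖ₑ ^ (-ε) < ⊤ := by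
  set σ := ρ / 2 with hσdef
  have hσ0 : 0 < σ := by positivity
  have hσ : σ < ρ := by rw [hσdef]; linarith
  -- The coefficients of `S (δ ^ κ₁ x, δ ^ κ₂ y) / δ`. The exponents of `δ` are nonnegative where `c
  -- ab ≠ 0`, and `0 ^ 0 = 1` makes `w 0` exactly the principal part.
  let w : ℝ → ℕ × ℕ → ℝ := fun δ ab => c ab * δ ^ (κ₁ * ab.1 + κ₂ * ab.2 - 1)
  have hw : ∀ ab, ContinuousOn (fun δ => w δ ab) (Set.Icc 0 1) := by
    intro ab
    by_cases h : c ab = 0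
    · simp only [w, h, zero_mul]; exact continuousOn_const
    · exact (continuous_const.mul
        (Real.continuous_rpow_const (by linarith [hκ ab h]))).continuousOn
  have hwc : ∀ δ ∈ Set.Icc (0 : ℝ) 1, ∀ ab, |w δ ab| ≤ |c ab| := by
    intro δ hδ ab
    by_cases h : c ab = 0
    · simp [w, h]
    · simp only [w, abs_mul]
      rw [abs_of_nonneg (Real.rpow_nonneg hδ.1 _)]
      exact mul_le_of_le_one_right (abs_nonneg _)
        (Real.rpow_le_one hδ.1 hδ.2 (by linarith [hκ ab h]))
  have hw0 : w 0 = fun ab => if κ₁ * ab.1 + κ₂ * ab.2 = 1 then c ab else 0 := by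
    funext ab
    simp only [w]
    split_ifs with h
    · rw [h, sub_self, Real.rpow_zero, mul_one]
    · rw [Real.zero_rpow (sub_ne_zero.2 h), mul_zero]
  have hscale : ∀ δ x y, 0 < δ → δ ≤ 1 → |x| ≤ σ → |y| ≤ σ →
      S (δ ^ κ₁ * x, δ ^ κ₂ * y) = δ * series2 (w δ) x y := by
    intro δ x y hδ0 hδ1 hx hy
    have hle : ∀ κ z : ℝ, 0 < κ → |z| ≤ σ → |δ ^ κ * z| < ρ := by
      intro κ z hκ hz
      rw [abs_mul, abs_of_pos (Real.rpow_pos_of_pos hδ0 _)]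
      exact (mul_le_of_le_one_left (abs_nonneg _)
        (Real.rpow_le_one hδ0.le hδ1 hκ.le)).trans_lt (hz.trans_lt hσ)
    rw [hS _ _ (hle _ _ hκ₁ hx) (hle _ _ hκ₂ hy)]
    unfold series2
    rw [← tsum_mul_left]
    refine tsum_congr fun ab => ?_
    have h1 : δ ^ (κ₁ * ab.1 + κ₂ * ab.2 - 1) = (δ ^ κ₁) ^ ab.1 * (δ ^ κ₂) ^ ab.2 / δ := by
      rw [Real.rpow_sub hδ0, Real.rpow_add hδ0, Real.rpow_one, Real.rpow_mul hδ0.le,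
        Real.rpow_mul hδ0.le, Real.rpow_natCast, Real.rpow_natCast]
    simp only [w]
    rw [h1, mul_pow, mul_pow]
    field_simp
  -- A compact shell avoiding the origin: the box of half-width `σ` without the open box obtained
  -- from it by the dilation with `δ = 1/2`.
  let K : Set (ℝ × ℝ) := {t | (|t.1| ≤ σ ∧ |t.2| ≤ σ) ∧
    (2 ^ (-κ₁) * σ ≤ |t.1| ∨ 2 ^ (-κ₂) * σ ≤ |t.2|)}
  have hKcl : IsClosed K := by
    have e1 : Continuous fun t : ℝ × ℝ => |t.1| := continuous_fst.abs
    have e2 : Continuous fun t : ℝ × ℝ => |t.2| := continuous_snd.abs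
    exact ((isClosed_le e1 continuous_const).inter (isClosed_le e2 continuous_const)).inter
      ((isClosed_le continuous_const e1).union (isClosed_le continuous_const e2))
  have hKc : IsCompact K := by
    refine (isCompact_Icc.prod isCompact_Icc : IsCompact
      (Set.Icc (-σ) σ ×ˢ Set.Icc (-σ) σ)).of_isClosed_subset hKcl ?_
    intro t ht
    exact ⟨abs_le.1 ht.1.1, abs_le.1 ht.1.2⟩
  -- The local bounds are summed over a finite cover of `K`, with the smallest of the thresholds for
  -- `δ`.
  obtain ⟨δ₁, hδ₁, C, hC, hKb⟩ : ∃ δ₁ > 0, ∃ C < (⊤ : ℝ≥0∞), ∀ δ, 0 ≤ δ → δ ≤ δ₁ →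
      ∫⁻ t in K, ‖series2 (w δ) t.1 t.2‖ₑ ^ (-ε) ≤ C := by
    refine hKc.induction_on (p := fun s => ∃ δ₁ > 0, ∃ C < (⊤ : ℝ≥0∞), ∀ δ, 0 ≤ δ → δ ≤ δ₁ →
      ∫⁻ t in s, ‖series2 (w δ) t.1 t.2‖ₑ ^ (-ε) ≤ C) ?_ ?_ ?_ ?_
    · exact ⟨1, one_pos, 0, ENNReal.zero_lt_top, by simp⟩
    · rintro s t hst ⟨δ₁, hδ₁, C, hC, h⟩
      exact ⟨δ₁, hδ₁, C, hC, fun δ h1 h2 => (lintegral_mono_set hst).trans (h δ h1 h2)⟩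
    · rintro s t ⟨δ₁, hδ₁, C, hC, h⟩ ⟨δ₁', hδ₁', C', hC', h'⟩
      refine ⟨min δ₁ δ₁', lt_min hδ₁ hδ₁', C + C', ENNReal.add_lt_top.2 ⟨hC, hC'⟩,
        fun δ h1 h2 => (lintegral_union_le _ _ _).trans (add_le_add (h δ h1 ?_) (h' δ h1 ?_))⟩
      · exact h2.trans (min_le_left _ _)
      · exact h2.trans (min_le_right _ _)
    · rintro ⟨x₀, y₀⟩ ht
      have hne : x₀ ≠ 0 ∨ y₀ ≠ 0 := by
        by_contra! hcon
        have := ht.2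
        simp only [hcon.1, hcon.2, abs_zero] at this
        have h1 : (0 : ℝ) < 2 ^ (-κ₁) * σ := by positivity
        have h2 : (0 : ℝ) < 2 ^ (-κ₂) * σ := by positivity
        rcases this with h | h <;> linarith
      obtain ⟨m, hmε, hm⟩ := hprin x₀ y₀ hne
      rw [← hw0] at hm
      have : ∃ r₀ > 0, ∃ δ₁ > 0, ∃ C < (⊤ : ℝ≥0∞), ∀ δ, 0 ≤ δ → δ ≤ δ₁ →
          ∫⁻ t in Set.Icc (x₀ - r₀) (x₀ + r₀) ×ˢ Set.Icc (y₀ - r₀) (y₀ + r₀),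
            ‖series2 (w δ) t.1 t.2‖ₑ ^ (-ε) ≤ C := by
        rcases hm with hm | hm
        · exact local_bound_of_ne_zero_Y hc hσ0 hσ w hw hwc x₀ y₀ ht.1.1 ht.1.2 m hm ε hε0 hmε
        · exact local_bound_of_ne_zero_X hc hσ0 hσ w hw hwc x₀ y₀ ht.1.1 ht.1.2 m hm ε hε0 hmε
      obtain ⟨r₀, hr₀, h⟩ := this
      refine ⟨_, mem_nhdsWithin_of_mem_nhds (prod_mem_nhds
        (Icc_mem_nhds (a := x₀ - r₀) (b := x₀ + r₀) ?_ ?_)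
        (Icc_mem_nhds (a := y₀ - r₀) (b := y₀ + r₀) ?_ ?_)), h⟩ <;> linarith
  obtain ⟨j₀, hj₀⟩ := exists_pow_lt_of_lt_one hδ₁ (show (1 / 2 : ℝ) < 1 by norm_num)
  let δ : ℕ → ℝ := fun j => (1 / 2) ^ (j₀ + j)
  have hδ0 : ∀ j, 0 < δ j := fun j => by positivity
  have hδ1 : ∀ j, δ j ≤ 1 := fun j => pow_le_one₀ (by norm_num) (by norm_num)
  have hδδ₁ : ∀ j, δ j ≤ δ₁ := fun j =>
    (pow_le_pow_of_le_one (by norm_num) (by norm_num) (Nat.le_add_right _ _)).trans hj₀.le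
  let A : ℕ → Set (ℝ × ℝ) := fun j => {t | ((δ j ^ κ₁)⁻¹ * t.1, (δ j ^ κ₂)⁻¹ * t.2) ∈ K}
  let V : Set (ℝ × ℝ) := {t | |t.1| ≤ δ 0 ^ κ₁ * σ ∧ |t.2| ≤ δ 0 ^ κ₂ * σ}
  have hVn : V ∈ 𝓝 (0 : ℝ × ℝ) := by
    have h1 : (0 : ℝ) < δ 0 ^ κ₁ * σ := mul_pos (Real.rpow_pos_of_pos (hδ0 0) _) hσ0
    have h2 : (0 : ℝ) < δ 0 ^ κ₂ * σ := mul_pos (Real.rpow_pos_of_pos (hδ0 0) _) hσ0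
    have h3 : ∀ᶠ t : ℝ × ℝ in 𝓝 0, |t.1| < δ 0 ^ κ₁ * σ :=
      (continuous_fst.abs.tendsto' (0 : ℝ × ℝ) 0 (by simp)).eventually (gt_mem_nhds h1)
    have h4 : ∀ᶠ t : ℝ × ℝ in 𝓝 0, |t.2| < δ 0 ^ κ₂ * σ :=
      (continuous_snd.abs.tendsto' (0 : ℝ × ℝ) 0 (by simp)).eventually (gt_mem_nhds h2)
    filter_upwards [h3, h4] with t h5 h6
    exact ⟨h5.le, h6.le⟩
  have hcover : V ⊆ {0} ∪ ⋃ j, A j := by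
    intro t ht
    by_cases ht0 : t = 0
    · exact Or.inl ht0
    refine Or.inr ?_
    -- The first scale whose box no longer contains `t`; the scale before it is the one whose shell
    -- contains `t`.
    let P : ℕ → Prop := fun j => ¬ (|t.1| ≤ δ j ^ κ₁ * σ ∧ |t.2| ≤ δ j ^ κ₂ * σ)
    have hPex : ∃ j, P j := by
      have htend : Filter.Tendsto δ Filter.atTop (𝓝 0) := by
        have h1 := (tendsto_pow_atTop_nhds_zero_of_lt_one (show (0 : ℝ) ≤ 1 / 2 by norm_num)
          (by norm_num)).comp (Filter.tendsto_add_atTop_nat j₀)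
        refine h1.congr fun j => ?_
        simp only [Function.comp, δ, add_comm]
      have hlim : ∀ κ : ℝ, 0 < κ → Filter.Tendsto (fun j => δ j ^ κ * σ) Filter.atTop (𝓝 0) := by
        intro κ hκ
        have := (htend.rpow_const (p := κ) (Or.inr hκ.le)).mul_const σ
        rwa [Real.zero_rpow hκ.ne', zero_mul] at this
      have hor : t.1 ≠ 0 ∨ t.2 ≠ 0 := by
        by_contra! hcon
        exact ht0 (Prod.ext hcon.1 hcon.2)
      rcases hor with h | h
      · obtain ⟨j, hj⟩ := ((hlim κ₁ hκ₁).eventually (gt_mem_nhds (abs_pos.2 h))).exists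
        exact ⟨j, fun hh => absurd hh.1 (not_le.2 hj)⟩
      · obtain ⟨j, hj⟩ := ((hlim κ₂ hκ₂).eventually (gt_mem_nhds (abs_pos.2 h))).exists
        exact ⟨j, fun hh => absurd hh.2 (not_le.2 hj)⟩
    classical
    have hj := Nat.find_spec hPex
    have hjmin := fun k => Nat.find_min hPex (m := k)
    set j := Nat.find hPex
    obtain ⟨i, hi⟩ : ∃ i, j = i + 1 := by
      refine Nat.exists_eq_succ_of_ne_zero fun h0 => ?_
      rw [h0] at hj
      exact hj ht
    have h1 := not_not.1 (hjmin i (by omega))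
    rw [hi] at hj
    refine Set.mem_iUnion.2 ⟨i, ?_⟩
    have hstep : ∀ κ : ℝ, δ (i + 1) ^ κ = 2 ^ (-κ) * δ i ^ κ := by
      intro κ
      have : δ (i + 1) = (1 / 2) * δ i := by simp only [δ, ← add_assoc]; rw [pow_succ']
      rw [this, Real.mul_rpow (by norm_num) (hδ0 i).le, one_div, Real.inv_rpow (by norm_num),
        Real.rpow_neg (by norm_num)]
    have hpos : ∀ κ : ℝ, 0 < δ i ^ κ := fun κ => Real.rpow_pos_of_pos (hδ0 i) κ
    have habs : ∀ κ z : ℝ, |(δ i ^ κ)⁻¹ * z| = |z| / δ i ^ κ := by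
      intro κ z
      rw [abs_mul, abs_of_pos (inv_pos.2 (hpos κ)), div_eq_inv_mul]
    refine ⟨⟨?_, ?_⟩, ?_⟩
    · rw [habs, div_le_iff₀ (hpos _), mul_comm]; exact h1.1
    · rw [habs, div_le_iff₀ (hpos _), mul_comm]; exact h1.2
    · simp only [P] at hj
      rw [not_and_or, not_le, not_le, hstep, hstep] at hj
      simp only [habs]
      rcases hj with h | h
      · left; rw [le_div_iff₀ (hpos _)]; linarith
      · right; rw [le_div_iff₀ (hpos _)]; linarith
  -- The Jacobian gives `δ ^ (κ₁ + κ₂)` and the factor `δ` in `S` gives `δ ^ (-ε)`; the total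
  -- exponent is positive, so these bounds form a convergent geometric series.
  have hA : ∀ j, ∫⁻ t in A j, ‖S t‖ₑ ^ (-ε) ≤ ENNReal.ofReal (δ j ^ (κ₁ + κ₂ - ε)) * C := by
    intro j
    have hp1 : 0 < δ j ^ κ₁ := Real.rpow_pos_of_pos (hδ0 j) _
    have hp2 : 0 < δ j ^ κ₂ := Real.rpow_pos_of_pos (hδ0 j) _
    have hAm : MeasurableSet (A j) := by
      refine hKcl.measurableSet.preimage (f := fun t : ℝ × ℝ =>
        ((δ j ^ κ₁)⁻¹ * t.1, (δ j ^ κ₂)⁻¹ * t.2)) (by fun_prop)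
    rw [← lintegral_indicator hAm, lintegral_comp_diag _ _ hp1 hp2]
    have hind : ∀ t : ℝ × ℝ, (A j).indicator (fun t => ‖S t‖ₑ ^ (-ε))
        (δ j ^ κ₁ * t.1, δ j ^ κ₂ * t.2) =
        ENNReal.ofReal (δ j ^ (-ε)) *
          K.indicator (fun t => ‖series2 (w (δ j)) t.1 t.2‖ₑ ^ (-ε)) t := by
      intro t
      have hiff : (δ j ^ κ₁ * t.1, δ j ^ κ₂ * t.2) ∈ A j ↔ t ∈ K := by
        simp only [A, Set.mem_ofPred_eq, inv_mul_cancel_left₀ hp1.ne', inv_mul_cancel_left₀ hp2.ne']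
      by_cases ht : t ∈ K
      · rw [Set.indicator_of_mem ht, Set.indicator_of_mem (hiff.2 ht),
          hscale _ _ _ (hδ0 j) (hδ1 j) ht.1.1 ht.1.2, enorm_mul, ENNReal.rpow_neg,
          ENNReal.mul_rpow_of_nonneg _ _ hε0.le, ENNReal.mul_inv, ← ENNReal.rpow_neg,
          ← ENNReal.rpow_neg, Real.enorm_eq_ofReal (hδ0 j).le, ENNReal.ofReal_rpow_of_pos (hδ0 j)]
        · left
          rw [Real.enorm_eq_ofReal (hδ0 j).le, ENNReal.ofReal_rpow_of_pos (hδ0 j)]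
          simpa using Real.rpow_pos_of_pos (hδ0 j) _
        · left
          rw [Real.enorm_eq_ofReal (hδ0 j).le, ENNReal.ofReal_rpow_of_pos (hδ0 j)]
          exact ENNReal.ofReal_ne_top
      · rw [Set.indicator_of_notMem ht, Set.indicator_of_notMem (fun h => ht (hiff.1 h)), mul_zero]
    simp_rw [hind]
    rw [lintegral_const_mul' _ _ ENNReal.ofReal_ne_top, lintegral_indicator hKcl.measurableSet,
      ← mul_assoc, ← ENNReal.ofReal_mul (by positivity)]
    have hexp : δ j ^ κ₁ * δ j ^ κ₂ * δ j ^ (-ε) = δ j ^ (κ₁ + κ₂ - ε) := by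
      rw [← Real.rpow_add (hδ0 j), ← Real.rpow_add (hδ0 j), sub_eq_add_neg]
    rw [hexp]
    exact mul_le_mul_right (hKb _ (hδ0 j).le (hδδ₁ j)) _
  refine ⟨V, hVn, ?_⟩
  calc ∫⁻ t in V, ‖S t‖ₑ ^ (-ε) ≤ ∫⁻ t in {0} ∪ ⋃ j, A j, ‖S t‖ₑ ^ (-ε) :=
        lintegral_mono_set hcover
    _ ≤ (∫⁻ t in {0}, ‖S t‖ₑ ^ (-ε)) + ∫⁻ t in ⋃ j, A j, ‖S t‖ₑ ^ (-ε) := lintegral_union_le _ _ _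
    _ = ∫⁻ t in ⋃ j, A j, ‖S t‖ₑ ^ (-ε) := by
      rw [setLIntegral_measure_zero _ _ (measure_singleton _), zero_add]
    _ ≤ ∑' j, ∫⁻ t in A j, ‖S t‖ₑ ^ (-ε) := lintegral_iUnion_le _ _
    _ ≤ ∑' j, ENNReal.ofReal (δ j ^ (κ₁ + κ₂ - ε)) * C := ENNReal.tsum_le_tsum hA
    _ < ⊤ := by
      rw [ENNReal.tsum_mul_right]
      refine ENNReal.mul_lt_top ?_ hC
      have hgeo : ∀ j, δ j ^ (κ₁ + κ₂ - ε) =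
          ((1 / 2) ^ (κ₁ + κ₂ - ε)) ^ j₀ * ((1 / 2 : ℝ) ^ (κ₁ + κ₂ - ε)) ^ j := by
        intro j
        simp only [δ]
        rw [← pow_add, ← Real.rpow_natCast, ← Real.rpow_natCast, ← Real.rpow_mul (by norm_num),
          ← Real.rpow_mul (by norm_num), mul_comm]
      have hsum : Summable fun j => δ j ^ (κ₁ + κ₂ - ε) := by
        simp_rw [hgeo]
        refine Summable.mul_left _ (summable_geometric_of_lt_one (by positivity) ?_)
        exact Real.rpow_lt_one (by norm_num) (by norm_num) (by linarith)
      rw [← ENNReal.ofReal_tsum_of_nonneg (fun j => (Real.rpow_pos_of_pos (hδ0 j) _).le) hsum]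
      exact ENNReal.ofReal_lt_top

/-! ### Newton polygons -/

/-- The Newton polygon of a family of coefficients. -/
def polygon (c : ℕ × ℕ → ℝ) : Set (ℝ × ℝ) :=
  convexHull ℝ {z | ∃ a b : ℕ, c (a, b) ≠ 0 ∧ (a : ℝ) ≤ z.1 ∧ (b : ℝ) ≤ z.2}

theorem mem_polygon {c : ℕ × ℕ → ℝ} {a b : ℕ} (h : c (a, b) ≠ 0) : ((a : ℝ), (b : ℝ)) ∈ polygon c :=
  subset_convexHull ℝ _ ⟨a, b, h, le_rfl, le_rfl⟩

theorem add_mem_polygon {c : ℕ × ℕ → ℝ} {z q : ℝ × ℝ} (hz : z ∈ polygon c) (hq : 0 ≤ q) :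
    z + q ∈ polygon c := by
  have hconv : Convex ℝ {z | z + q ∈ polygon c} :=
    (convex_convexHull ℝ _).translate_preimage_left q
  refine convexHull_min ?_ hconv hz
  rintro z ⟨a, b, h, ha, hb⟩
  exact subset_convexHull ℝ _ ⟨a, b, h, ha.trans (le_add_of_nonneg_right hq.1),
    hb.trans (le_add_of_nonneg_right hq.2)⟩

theorem le_of_mem_polygon {c : ℕ × ℕ → ℝ} {κ₁ κ₂ t : ℝ} (hκ₁ : 0 ≤ κ₁) (hκ₂ : 0 ≤ κ₂)
    (h : ∀ a b, c (a, b) ≠ 0 → t ≤ κ₁ * a + κ₂ * b) {z : ℝ × ℝ} (hz : z ∈ polygon c) :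
    t ≤ κ₁ * z.1 + κ₂ * z.2 := by
  have hconv : Convex ℝ {z : ℝ × ℝ | t ≤ κ₁ * z.1 + κ₂ * z.2} := by
    intro z hz w hw s s' hs hs' hss
    simp only [Set.mem_ofPred_eq, Prod.fst_add, Prod.snd_add, Prod.smul_fst, Prod.smul_snd,
      smul_eq_mul] at *
    have : s' = 1 - s := by linarith
    subst this
    nlinarith
  refine convexHull_min ?_ hconv hz
  rintro z ⟨a, b, hab, ha, hb⟩
  refine (h a b hab).trans ?_
  gcongr

theorem polygon_swap {c : ℕ × ℕ → ℝ} {z : ℝ × ℝ} (hz : z ∈ polygon c) :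
    z.swap ∈ polygon (c ∘ Prod.swap) := by
  have hconv : Convex ℝ {z : ℝ × ℝ | z.swap ∈ polygon (c ∘ Prod.swap)} := by
    intro z hz w hw s s' hs hs' hss
    exact convex_convexHull ℝ _ hz hw hs hs' hss
  refine convexHull_min ?_ hconv hz
  rintro z ⟨a, b, hab, ha, hb⟩
  exact subset_convexHull ℝ _ ⟨b, a, hab, hb, ha⟩

theorem exists_ne_zero_of_mem_polygon {c : ℕ × ℕ → ℝ} {z : ℝ × ℝ} (hz : z ∈ polygon c) :
    ∃ a b, c (a, b) ≠ 0 := by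
  obtain ⟨w, a, b, h, -⟩ := convexHull_nonempty_iff.1 ⟨z, hz⟩
  exact ⟨a, b, h⟩

/-- A lexicographic half-plane: an open half-plane together with a half-line of its boundary. With
`convexHull_min` it carries a property of the lattice points of a face over to the whole face. -/
theorem convex_lex (α β α' β' t t' : ℝ) :
    Convex ℝ {z : ℝ × ℝ | t < α * z.1 + β * z.2 ∨
      (α * z.1 + β * z.2 = t ∧ t' ≤ α' * z.1 + β' * z.2)} := by
  rw [convex_iff_forall_pos]
  intro z hz w hw s s' hs hs' hss
  simp only [Set.mem_ofPred_eq, Prod.fst_add, Prod.snd_add, Prod.smul_fst, Prod.smul_snd,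
    smul_eq_mul] at *
  have e1 : ∀ α β : ℝ, α * (s * z.1 + s' * w.1) + β * (s * z.2 + s' * w.2) =
      s * (α * z.1 + β * z.2) + s' * (α * w.1 + β * w.2) := by intros; ring
  rw [e1, e1]
  generalize α * z.1 + β * z.2 = Z at *
  generalize α * w.1 + β * w.2 = W at *
  generalize α' * z.1 + β' * z.2 = Z' at *
  generalize α' * w.1 + β' * w.2 = W' at *
  have : s' = 1 - s := by linarith
  subst this
  rcases hz with hz | ⟨hz, hz'⟩ <;> rcases hw with hw | ⟨hw, hw'⟩
  · left; nlinarith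
  · left; subst hw; nlinarith
  · left; subst hz; nlinarith
  · right; subst hz; exact ⟨by rw [hw]; ring, by nlinarith⟩

/-- A linear functional that is smaller than `t'` at a point of the face `κ · z = 1` of the polygon
is smaller than `t'` at a lattice point of the face. -/
theorem exists_lattice_point_on_face {c : ℕ × ℕ → ℝ} {κ₁ κ₂ α β t' : ℝ} (hκ₁ : 0 < κ₁)
    (hκ₂ : 0 < κ₂) (h : ∀ a b, c (a, b) ≠ 0 → 1 ≤ κ₁ * a + κ₂ * b) {z : ℝ × ℝ}
    (hz : z ∈ polygon c) (hz1 : κ₁ * z.1 + κ₂ * z.2 = 1) (hzt : α * z.1 + β * z.2 < t') :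
    ∃ a b, c (a, b) ≠ 0 ∧ κ₁ * a + κ₂ * b = 1 ∧ α * a + β * b < t' := by
  by_contra! hcon
  have := convexHull_min (t := {z : ℝ × ℝ | 1 < κ₁ * z.1 + κ₂ * z.2 ∨
      (κ₁ * z.1 + κ₂ * z.2 = 1 ∧ t' ≤ α * z.1 + β * z.2)}) ?_ (convex_lex _ _ _ _ _ _) hz
  · rcases this with h1 | h1
    · linarith
    · linarith [h1.2]
  · rintro w ⟨a, b, hab, ha, hb⟩
    have h1 := h a b hab
    have h2 : κ₁ * a ≤ κ₁ * w.1 := by gcongr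
    have h3 : κ₂ * b ≤ κ₂ * w.2 := by gcongr
    rcases lt_or_eq_of_le (show 1 ≤ κ₁ * w.1 + κ₂ * w.2 by linarith) with h4 | h4
    · exact Or.inl h4
    -- Both weights are positive, so a point of the quadrant above `(a, b)` on the line must be `(a,
    -- b)` itself.
    · right
      have h5 : (a : ℝ) = w.1 := mul_left_cancel₀ hκ₁.ne' (by linarith)
      have h6 : (b : ℝ) = w.2 := mul_left_cancel₀ hκ₂.ne' (by linarith)
      rw [← h5, ← h6]
      rw [← h5, ← h6] at h4
      exact ⟨h4.symm, hcon a b hab h4.symm⟩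

theorem clm_apply_prod (f : (ℝ × ℝ) →L[ℝ] ℝ) (z : ℝ × ℝ) :
    f z = f (1, 0) * z.1 + f (0, 1) * z.2 := by
  have : z = z.1 • ((1, 0) : ℝ × ℝ) + z.2 • ((0, 1) : ℝ × ℝ) := by ext <;> simp
  conv_lhs => rw [this]
  rw [map_add, map_smul, map_smul, smul_eq_mul, smul_eq_mul]
  ring

/-- Used to read off the signs of the coefficients of a separating functional from the unbounded
directions of the polygon. -/
theorem nonneg_of_forall_lt {α A B : ℝ} (h : ∀ s : ℝ, 0 < s → A < B + s * α) : 0 ≤ α := by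
  by_contra! hα
  have h1 := h ((|B - A| + 1) / (-α)) (div_pos (by positivity) (by linarith))
  rw [div_mul_eq_mul_div, ← neg_neg α, neg_neg (-α), mul_neg, neg_div,
    mul_div_cancel_right₀ _ (by linarith)] at h1
  linarith [le_abs_self (B - A)]

/-- A supporting line of the Newton polygon at the point where the diagonal enters it. -/
theorem exists_supporting_weights {c : ℕ × ℕ → ℝ} {d : ℝ} (hd : 0 < d) (hne : ∃ a b, c (a, b) ≠ 0)
    (hdN : ∀ x < d, (x, x) ∉ polygon c) :
    ∃ κ₁ κ₂ : ℝ, 0 ≤ κ₁ ∧ 0 ≤ κ₂ ∧ κ₁ + κ₂ = 1 / d ∧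
      ∀ a b, c (a, b) ≠ 0 → 1 ≤ κ₁ * a + κ₂ * b := by
  -- Otherwise points `(x, x)` with `x` slightly below `d` would lie in the polygon.
  have hp : (d, d) ∉ interior (polygon c) := by
    intro h
    have hcont : Filter.Tendsto (fun x : ℝ => (x, x)) (𝓝 d) (𝓝 (d, d)) :=
      (continuous_id.prodMk continuous_id).tendsto d
    have h1 := (hcont.eventually (mem_interior_iff_mem_nhds.1 h)).filter_mono
      (nhdsWithin_le_nhds (s := Set.Iio d))
    obtain ⟨x, hx1, hx2⟩ := (h1.and self_mem_nhdsWithin).exists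
    exact hdN x hx2 hx1
  obtain ⟨f, hf⟩ := geometric_hahn_banach_open_point
    ((convex_convexHull ℝ _).interior : Convex ℝ (interior (polygon c))) isOpen_interior hp
  have hint : ∀ a b, c (a, b) ≠ 0 → ∀ s t : ℝ, 0 < s → 0 < t →
      ((a + s : ℝ), (b + t : ℝ)) ∈ interior (polygon c) := by
    intro a b hab s t hs ht
    refine mem_interior.2 ⟨Set.Ioi (a : ℝ) ×ˢ Set.Ioi (b : ℝ), ?_, isOpen_Ioi.prod isOpen_Ioi,
      ⟨by simpa, by simpa⟩⟩
    intro z hz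
    exact subset_convexHull ℝ _ ⟨a, b, hab, le_of_lt hz.1, le_of_lt hz.2⟩
  -- Separation is only from the interior, hence the positive shifts `s` and `t`; they are sent to
  -- `0` at the end. The sign change makes the weights nonnegative.
  have hf' : ∀ a b, c (a, b) ≠ 0 → ∀ s t : ℝ, 0 < s → 0 < t →
      (-f (1, 0) + -f (0, 1)) * d < -f (1, 0) * (a + s) + -f (0, 1) * (b + t) := by
    intro a b hab s t hs ht
    have := hf _ (hint a b hab s t hs ht)
    rw [clm_apply_prod f, clm_apply_prod f (d, d)] at this
    simp only at this
    linarith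
  generalize -f (1, 0) = α at hf'
  generalize -f (0, 1) = β at hf'
  obtain ⟨a₀, b₀, h0⟩ := hne
  have hα : 0 ≤ α := nonneg_of_forall_lt (A := (α + β) * d) (B := α * a₀ + β * (b₀ + 1))
    fun s hs => by linarith [hf' a₀ b₀ h0 s 1 hs one_pos]
  have hβ : 0 ≤ β := nonneg_of_forall_lt (A := (α + β) * d) (B := α * (a₀ + 1) + β * b₀)
    fun s hs => by linarith [hf' a₀ b₀ h0 1 s one_pos hs]
  have hpos : 0 < α + β := by
    rcases lt_or_eq_of_le (add_nonneg hα hβ) with h | h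
    · exact h
    · have h1 : α = 0 := by linarith
      have h2 : β = 0 := by linarith
      have := hf' a₀ b₀ h0 1 1 one_pos one_pos
      simp [h1, h2] at this
  -- Normalized so that the functional equals `1` at `(d, d)`.
  refine ⟨α / ((α + β) * d), β / ((α + β) * d), by positivity, by positivity, ?_, ?_⟩
  · field_simp
  · intro a b hab
    rw [div_mul_eq_mul_div, div_mul_eq_mul_div, ← add_div, le_div_iff₀ (by positivity), one_mul]
    refine le_of_forall_pos_le_add fun τ hτ => ?_
    have := hf' a b hab (τ / (α + β)) (τ / (α + β)) (by positivity) (by positivity)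
    have e : α * (τ / (α + β)) + β * (τ / (α + β)) = τ := by field_simp
    linarith

/-! ### Principal parts -/

/-- The part of a family of coefficients on the line `κ₁ a + κ₂ b = 1`. -/
noncomputable def principal (c : ℕ × ℕ → ℝ) (κ₁ κ₂ : ℝ) (ab : ℕ × ℕ) : ℝ :=
  open Classical in if κ₁ * ab.1 + κ₂ * ab.2 = 1 then c ab else 0

/-- There are weights for which the principal part satisfies the hypotheses of
`exists_lintegral_rpow_neg_lt_top`. -/
def HasGoodWeights (c : ℕ × ℕ → ℝ) (ε : ℝ) : Prop :=
  ∃ κ₁ κ₂ : ℝ, 0 < κ₁ ∧ 0 < κ₂ ∧ ε < κ₁ + κ₂ ∧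
    (∀ ab, c ab ≠ 0 → 1 ≤ κ₁ * ab.1 + κ₂ * ab.2) ∧
    ∀ x y : ℝ, (x ≠ 0 ∨ y ≠ 0) → ∃ m : ℕ, m * ε < 1 ∧
      (series2 (dY^[m] (principal c κ₁ κ₂)) x y ≠ 0 ∨
      series2 (dY^[m] (principal c κ₁ κ₂ ∘ Prod.swap)) y x ≠ 0)

theorem principal_swap (c : ℕ × ℕ → ℝ) (κ₁ κ₂ : ℝ) :
    principal (c ∘ Prod.swap) κ₁ κ₂ = principal c κ₂ κ₁ ∘ Prod.swap := by
  funext ab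
  simp only [principal, Function.comp, Prod.fst_swap, Prod.snd_swap, add_comm]

theorem HasGoodWeights.swap {c : ℕ × ℕ → ℝ} {ε : ℝ} (h : HasGoodWeights (c ∘ Prod.swap) ε) :
    HasGoodWeights c ε := by
  obtain ⟨κ₁, κ₂, h1, h2, h3, h4, h5⟩ := h
  refine ⟨κ₂, κ₁, h2, h1, by linarith, fun ab hab => ?_, fun x y hxy => ?_⟩
  · have := h4 ab.swap (by simpa using hab)
    simp only [Prod.fst_swap, Prod.snd_swap] at this
    linarith
  · obtain ⟨m, hm, h6⟩ := h5 y x hxy.symm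
    refine ⟨m, hm, ?_⟩
    rw [principal_swap, Function.comp_assoc, Prod.swap_swap_eq, Function.comp_id] at h6
    exact h6.symm

/-- As `κ₁ ≠ 0`, the line `κ₁ a + κ₂ b = 1` meets each height `b` only once. -/
theorem principal_eq_zero_of_ne {c : ℕ × ℕ → ℝ} {κ₁ κ₂ : ℝ} (hκ₁ : 0 < κ₁) {a₀ b a : ℕ}
    (h : principal c κ₁ κ₂ (a₀, b) ≠ 0) (ha : a ≠ a₀) : principal c κ₁ κ₂ (a, b) = 0 := by
  unfold principal at *
  rw [if_neg]
  intro h1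
  split_ifs at h with h2
  · simp only at h1 h2
    exact ha (by exact_mod_cast mul_left_cancel₀ hκ₁.ne' (by linarith : κ₁ * a = κ₁ * a₀))
  · exact h rfl

/-- At `y = 0` only terms with second exponent `b₀` survive `b₀` differentiations, and the line
carries just one of them; the value is `b₀!` times its coefficient times `x ^ a₀`. -/
theorem series2_iterate_dY_axis {c : ℕ × ℕ → ℝ} {κ₁ κ₂ : ℝ} (hκ₁ : 0 < κ₁) {a₀ b₀ : ℕ}
    (h : principal c κ₁ κ₂ (a₀, b₀) ≠ 0) {x : ℝ} (hx : x ≠ 0) :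
    series2 (dY^[b₀] (principal c κ₁ κ₂)) x 0 ≠ 0 := by
  have hval : ∀ a, dY^[b₀] (principal c κ₁ κ₂) (a, 0) =
      b₀.factorial * principal c κ₁ κ₂ (a, b₀) := by
    intro a
    have := iterate_dY_apply (principal c κ₁ κ₂) b₀ a 0
    simpa using this
  unfold series2
  rw [tsum_eq_single (a₀, 0)]
  · simp only [hval, pow_zero, mul_one]
    have : (b₀.factorial : ℝ) ≠ 0 := by positivity
    exact mul_ne_zero (mul_ne_zero this h) (pow_ne_zero _ hx)
  · rintro ⟨a, b⟩ hab
    by_cases hb : b = 0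
    · subst hb
      have ha : a ≠ a₀ := fun h => hab (by rw [h])
      simp [hval, principal_eq_zero_of_ne hκ₁ h ha]
    · simp [hb]

/-- It suffices to check the condition on the principal part off the axes. -/
theorem hasGoodWeights_of_axes {c : ℕ × ℕ → ℝ} {ε κ₁ κ₂ : ℝ} (hκ₁ : 0 < κ₁) (hκ₂ : 0 < κ₂)
    (hε : ε < κ₁ + κ₂) (hκ : ∀ ab, c ab ≠ 0 → 1 ≤ κ₁ * ab.1 + κ₂ * ab.2) {a b a' b' : ℕ}
    (hab : c (a, b) ≠ 0) (hab1 : κ₁ * a + κ₂ * b = 1) (hbε : b * ε < 1)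
    (hab' : c (a', b') ≠ 0) (hab1' : κ₁ * a' + κ₂ * b' = 1) (haε : a' * ε < 1)
    (hoff : ∀ x y : ℝ, x ≠ 0 → y ≠ 0 → ∃ m : ℕ, m * ε < 1 ∧
      series2 (dY^[m] (principal c κ₁ κ₂)) x y ≠ 0) : HasGoodWeights c ε := by
  refine ⟨κ₁, κ₂, hκ₁, hκ₂, hε, hκ, fun x y hxy => ?_⟩
  by_cases hx : x = 0
  · have hy : y ≠ 0 := by
      rcases hxy with h | h
      · exact absurd hx h
      · exact h
    subst hx
    refine ⟨a', haε, Or.inr ?_⟩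
    rw [← principal_swap]
    refine series2_iterate_dY_axis hκ₂ (a₀ := b') ?_ hy
    unfold principal
    rw [if_pos (by simp only; linarith)]
    exact hab'
  · by_cases hy : y = 0
    · subst hy
      refine ⟨b, hbε, Or.inl (series2_iterate_dY_axis hκ₁ (a₀ := a) ?_ hx)⟩
      unfold principal
      rw [if_pos hab1]
      exact hab
    · obtain ⟨m, hm, h⟩ := hoff x y hx hy
      exact ⟨m, hm, Or.inl h⟩

/-- With a single exponent on the line, the principal part is a monomial. It has no zeros off the
axes, and on the axes its exponents are the orders of differentiation. -/
theorem hasGoodWeights_of_monomial {c : ℕ × ℕ → ℝ} {ε κ₁ κ₂ : ℝ} (hκ₁ : 0 < κ₁) (hκ₂ : 0 < κ₂)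
    (hε : ε < κ₁ + κ₂) {a b : ℕ} (hab : c (a, b) ≠ 0) (hab1 : κ₁ * a + κ₂ * b = 1)
    (haε : a * ε < 1) (hbε : b * ε < 1)
    (hκ : ∀ a' b', c (a', b') ≠ 0 → (a', b') ≠ (a, b) → 1 < κ₁ * a' + κ₂ * b') :
    HasGoodWeights c ε := by
  refine hasGoodWeights_of_axes hκ₁ hκ₂ hε ?_ hab hab1 hbε hab hab1 haε ?_
  · rintro ⟨a', b'⟩ h
    by_cases he : (a', b') = (a, b)
    · rw [he]; exact hab1.ge
    · exact (hκ a' b' h he).le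
  · intro x y hx hy
    refine ⟨0, by simp, ?_⟩
    simp only [Function.iterate_zero, id]
    unfold series2
    rw [tsum_eq_single (a, b)]
    · simp only [principal, hab1, if_true]
      exact mul_ne_zero (mul_ne_zero hab (pow_ne_zero _ hx)) (pow_ne_zero _ hy)
    · rintro ⟨a', b'⟩ hne
      have : principal c κ₁ κ₂ (a', b') = 0 := by
        unfold principal
        split_ifs with h1
        · by_contra h
          exact (hκ a' b' h hne).ne' h1
        · rfl
      simp [this]

/-- The case where the diagonal meets the polygon on the vertical ray. -/
theorem hasGoodWeights_of_vertical {c : ℕ × ℕ → ℝ} {ε d : ℝ} (hd : 0 < d) (hε0 : 0 < ε)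
    (hεd : d * ε < 1) (hdN : (d, d) ∈ polygon c) (hmin : ∀ w ∈ polygon c, d ≤ w.1) :
    HasGoodWeights c ε := by
  classical
  obtain ⟨a₁, b₁, h1⟩ := exists_ne_zero_of_mem_polygon hdN
  have hex : ∃ a, ∃ b, c (a, b) ≠ 0 := ⟨a₁, b₁, h1⟩
  obtain ⟨a, ha, hamin⟩ : ∃ a, (∃ b, c (a, b) ≠ 0) ∧ ∀ a' b', c (a', b') ≠ 0 → a ≤ a' :=
    ⟨Nat.find hex, Nat.find_spec hex, fun a' b' h => Nat.find_min' hex ⟨b', h⟩⟩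
  obtain ⟨b, hab, hbmin⟩ : ∃ b, c (a, b) ≠ 0 ∧ ∀ b', c (a, b') ≠ 0 → b ≤ b' :=
    ⟨Nat.find ha, Nat.find_spec ha, fun b' h => Nat.find_min' ha h⟩
  have had : (a : ℝ) = d := by
    apply le_antisymm
    · have := le_of_mem_polygon (κ₁ := 1) (κ₂ := 0) (t := a) (by norm_num) le_rfl
        (fun a' b' h => by simpa using hamin a' b' h) hdN
      simpa using this
    · exact hmin _ (mem_polygon hab)
  have hapos : (0 : ℝ) < a := had ▸ hd
  -- This slope makes `(a, b)` the unique minimizer of `x + τ y` among the exponents: a larger first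
  -- exponent adds at least `1`, and `τ b < 1`.
  set τ : ℝ := 1 / (b + 1) with hτ
  have hτpos : 0 < τ := by positivity
  have hτb : τ * b < 1 := by rw [hτ, div_mul_eq_mul_div, div_lt_one (by positivity)]; linarith
  have hineq : ∀ a' b', c (a', b') ≠ 0 → (a', b') ≠ (a, b) →
      (a : ℝ) + τ * b < 1 * a' + τ * b' := by
    intro a' b' h hne
    rcases eq_or_lt_of_le (hamin a' b' h) with h2 | h2
    · subst h2
      have h3 : b < b' := lt_of_le_of_ne (hbmin b' h) fun h4 => hne (by rw [h4])
      have h4 : (b : ℝ) < b' := by exact_mod_cast h3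
      have := mul_lt_mul_of_pos_left h4 hτpos
      linarith
    · have h3 : (a : ℝ) + 1 ≤ a' := by exact_mod_cast h2
      have : 0 ≤ τ * b' := by positivity
      linarith
  -- The point `(d, d)` of the polygon has abscissa `a` and satisfies `a + τ b ≤ d + τ d`.
  have hba : (b : ℝ) ≤ a := by
    have := le_of_mem_polygon (κ₁ := 1) (κ₂ := τ) (t := a + τ * b) (by norm_num) hτpos.le
      (fun a' b' h => by
        by_cases he : (a', b') = (a, b)
        · obtain ⟨rfl, rfl⟩ := Prod.mk.inj he; simp
        · exact (hineq a' b' h he).le) hdN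
    rw [← had] at this
    simp only [one_mul] at this
    exact le_of_mul_le_mul_left (by linarith) hτpos
  set T : ℝ := a + τ * b with hT
  have hTpos : 0 < T := by positivity
  refine hasGoodWeights_of_monomial (κ₁ := 1 / T) (κ₂ := τ / T) (by positivity) (by positivity) ?_
    hab ?_ (by rw [had]; exact hεd) ?_ ?_
  -- Since `b ≤ a`, `ε T ≤ ε a (1 + τ) < 1 + τ`.
  · rw [← add_div, lt_div_iff₀ hTpos, hT]
    have h2 : ε * a < 1 := by rw [had, mul_comm]; exact hεd
    have h3 : ε * (τ * b) ≤ τ * (ε * a) := by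
      have : τ * (ε * b) ≤ τ * (ε * a) := by gcongr
      linarith
    nlinarith
  · field_simp
    linarith
  · refine lt_of_le_of_lt ?_ hεd
    rw [← had]
    gcongr
  · intro a' b' h hne
    have := hineq a' b' h hne
    rw [div_mul_eq_mul_div, div_mul_eq_mul_div, ← add_div, lt_div_iff₀ hTpos]
    linarith

theorem hasGoodWeights_of_horizontal {c : ℕ × ℕ → ℝ} {ε d : ℝ} (hd : 0 < d) (hε0 : 0 < ε)
    (hεd : d * ε < 1) (hdN : (d, d) ∈ polygon c) (hmin : ∀ w ∈ polygon c, d ≤ w.2) :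
    HasGoodWeights c ε := by
  refine HasGoodWeights.swap (hasGoodWeights_of_vertical hd hε0 hεd (polygon_swap hdN) ?_)
  intro w hw
  have := polygon_swap hw
  rw [Function.comp_assoc, Prod.swap_swap_eq, Function.comp_id] at this
  exact hmin _ this

open scoped Pointwise in
/-- The case where the diagonal meets the polygon at a vertex. -/
theorem hasGoodWeights_of_vertex {c : ℕ × ℕ → ℝ} {ε d : ℝ} (hd : 0 < d)
    (hεd : d * ε < 1) (hext : (d, d) ∈ (polygon c).extremePoints ℝ) :
    HasGoodWeights c ε := by
  classical
  have hconv : Convex ℝ (polygon c) := convex_convexHull ℝ _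
  have hdN : (d, d) ∈ polygon c := hext.1
  -- `z + q` is the midpoint of `z` and `z + 2q`, both in the polygon, so extremality forces `q =
  -- 0`. Hence `(d, d)` is itself an exponent.
  have hmid : ∀ z q : ℝ × ℝ, z ∈ polygon c → 0 ≤ q → z + q = (d, d) → q = 0 := by
    intro z q hz hq hzq
    have h1 : z + (q + q) ∈ polygon c := add_mem_polygon hz (add_nonneg hq hq)
    have h2 : (d, d) ∈ openSegment ℝ z (z + (q + q)) := by
      refine ⟨1 / 2, 1 / 2, by norm_num, by norm_num, by norm_num, ?_⟩
      rw [← hzq, smul_add, smul_add, ← add_assoc, ← add_smul, ← add_smul]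
      norm_num
    have h3 := hext.2 hz h1 h2
    rw [h3] at hzq
    simpa using hzq
  obtain ⟨a, b, hab, had, hbd⟩ := extremePoints_convexHull_subset hext
  have hq := hmid (a, b) (d - a, d - b) (mem_polygon hab)
    ⟨sub_nonneg.2 had, sub_nonneg.2 hbd⟩ (by ext <;> simp)
  have had : (a : ℝ) = d := by have := congrArg Prod.fst hq; simp at this; linarith
  have hbd : (b : ℝ) = d := by have := congrArg Prod.snd hq; simp at this; linarith
  -- Dickson's lemma: finitely many minimal exponents lie below all others.
  obtain ⟨F, hFfin, hFsub, hFle⟩ : ∃ F : Set (ℕ × ℕ), F.Finite ∧ (∀ z ∈ F, c z ≠ 0) ∧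
      ∀ z, c z ≠ 0 → ∃ w ∈ F, w ≤ z := by
    refine ⟨{z | Minimal (fun z => c z ≠ 0) z},
      WellQuasiOrderedLE.finite_of_isAntichain (setOfPred_minimal_antichain _),
      fun z hz => hz.1, fun z hz => ?_⟩
    obtain ⟨w, hw1, hw2⟩ := exists_minimal_le_of_wellFoundedLT (fun z => c z ≠ 0) z hz
    exact ⟨w, hw2, hw1⟩
  -- The extra point `(d + 1, d + 1)` keeps `G` nonempty and serves below to determine the signs of
  -- the weights.
  let G : Set (ℝ × ℝ) := insert (d + 1, d + 1)
    ((fun z : ℕ × ℕ => ((z.1 : ℝ), (z.2 : ℝ))) '' (F \ {(a, b)}))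
  have hGfin : G.Finite := (hFfin.sdiff.image _).insert _
  have hGsub : G ⊆ polygon c \ {(d, d)} := by
    rintro z (rfl | ⟨w, ⟨hw, hwab⟩, rfl⟩)
    · refine ⟨?_, by simp⟩
      have := add_mem_polygon (q := (1, 1)) hdN ⟨zero_le_one, zero_le_one⟩
      simpa using this
    · refine ⟨mem_polygon (hFsub w hw), fun h => hwab ?_⟩
      obtain ⟨h1, h2⟩ := Prod.mk.inj h
      rw [← had] at h1
      rw [← hbd] at h2
      exact Prod.ext (by exact_mod_cast h1) (by exact_mod_cast h2)
  have hhull : convexHull ℝ G ⊆ polygon c \ {(d, d)} :=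
    convexHull_min hGsub ((hconv.mem_extremePoints_iff_convex_sdiff).1 hext).2
  -- A compact set plus a closed quadrant, hence closed; as it misses `(d, d)`, the separation is
  -- strict.
  let K : Set (ℝ × ℝ) := convexHull ℝ G + Set.Ici (0 : ℝ × ℝ)
  have hKconv : Convex ℝ K := (convex_convexHull ℝ G).add (convex_Ici 0)
  have hKcl : IsClosed K := isClosed_Ici.add_left_of_isCompact (hGfin.isCompact_convexHull ℝ)
  have hpK : (d, d) ∉ K := by
    rintro ⟨z, hz, q, hq, hzq⟩
    have h0 := hmid z q (hhull hz).1 hq hzq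
    rw [h0] at hzq
    exact (hhull hz).2 (by simpa using hzq)
  obtain ⟨f, u, hfp, hfK⟩ := geometric_hahn_banach_point_closed hKconv hKcl hpK
  have hGK : ∀ z ∈ G, ∀ q : ℝ × ℝ, 0 ≤ q → u < f (1, 0) * (z.1 + q.1) + f (0, 1) * (z.2 + q.2) := by
    intro z hz q hq
    have := hfK (z + q) (Set.add_mem_add (subset_convexHull ℝ _ hz) hq)
    rwa [clm_apply_prod] at this
  rw [clm_apply_prod] at hfp
  generalize f (1, 0) = α at *
  generalize f (0, 1) = β at *
  have hα : 0 ≤ α := nonneg_of_forall_lt (A := u) (B := α * (d + 1) + β * (d + 1)) fun s hs => by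
    have := hGK (d + 1, d + 1) (Set.mem_insert _ _) (s, 0) ⟨hs.le, le_rfl⟩
    simp only at this
    linarith
  have hβ : 0 ≤ β := nonneg_of_forall_lt (A := u) (B := α * (d + 1) + β * (d + 1)) fun s hs => by
    have := hGK (d + 1, d + 1) (Set.mem_insert _ _) (0, s) ⟨le_rfl, hs.le⟩
    simp only at this
    linarith
  simp only at hfp
  -- Adding `τ` to both weights makes them positive and uses up half of the gap between `u` and the
  -- value at `(d, d)`.
  set τ : ℝ := (u - (α * d + β * d)) / (4 * d) with hτ
  have hτpos : 0 < τ := div_pos (by linarith) (by linarith)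
  have hτd : τ * d = (u - (α * d + β * d)) / 4 := by rw [hτ]; field_simp
  set T : ℝ := (α + τ) * d + (β + τ) * d with hT
  have hTpos : 0 < T := by positivity
  have hTu : T < u := by rw [hT]; linarith
  have hkey : ∀ a' b', c (a', b') ≠ 0 → (a', b') ≠ (a, b) →
      T < (α + τ) * a' + (β + τ) * b' := by
    intro a' b' h hne
    obtain ⟨w, hwF, hw⟩ := hFle (a', b') h
    have hw1 : (w.1 : ℝ) ≤ a' := by exact_mod_cast hw.1
    have hw2 : (w.2 : ℝ) ≤ b' := by exact_mod_cast hw.2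
    -- Exponents above `(a, b)` are separated by the positivity of the new weights, all others by
    -- the hyperplane.
    by_cases hwab : w = (a, b)
    · rw [hwab] at hw1 hw2
      simp only at hw1 hw2
      have hne' : a' ≠ a ∨ b' ≠ b := by
        by_contra! hcon
        exact hne (Prod.ext hcon.1 hcon.2)
      have hατ : 0 < α + τ := by positivity
      have hβτ : 0 < β + τ := by positivity
      rw [hT, ← had]
      nth_rewrite 2 [had]
      rw [← hbd]
      rcases hne' with h1 | h1
      · have : (a : ℝ) < a' := lt_of_le_of_ne hw1 (by exact_mod_cast h1.symm)
        nlinarith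
      · have : (b : ℝ) < b' := lt_of_le_of_ne hw2 (by exact_mod_cast h1.symm)
        nlinarith
    · have h1 := hGK ((w.1 : ℝ), (w.2 : ℝ)) (Set.mem_insert_of_mem _ ⟨w, ⟨hwF, hwab⟩, rfl⟩)
        (a' - w.1, b' - w.2) ⟨sub_nonneg.2 hw1, sub_nonneg.2 hw2⟩
      simp only [add_sub_cancel] at h1
      have h2 : 0 ≤ τ * a' := by positivity
      have h3 : 0 ≤ τ * b' := by positivity
      linarith
  have hTab : T = (α + τ) * a + (β + τ) * b := by rw [hT, had, hbd]
  refine hasGoodWeights_of_monomial (κ₁ := (α + τ) / T) (κ₂ := (β + τ) / T) (by positivity)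
    (by positivity) ?_ hab ?_ (by rwa [had]) (by rwa [hbd]) ?_
  · rw [← add_div, lt_div_iff₀ hTpos, hT, ← add_mul]
    have : 0 < α + τ + (β + τ) := by positivity
    nlinarith
  · rw [div_mul_eq_mul_div, div_mul_eq_mul_div, ← add_div, ← hTab, div_self hTpos.ne']
  · intro a' b' h hne
    rw [div_mul_eq_mul_div, div_mul_eq_mul_div, ← add_div, lt_div_iff₀ hTpos, one_mul]
    exact hkey a' b' h hne

/-! ### The case of a compact edge -/

open Polynomial in
theorem iteratedDeriv_polynomial_eval (P : ℝ[X]) (m : ℕ) (y : ℝ) :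
    iteratedDeriv m (fun y => P.eval y) y = (derivative^[m] P).eval y := by
  induction m generalizing y with
  | zero => simp
  | succ m ih =>
    rw [iteratedDeriv_succ, funext ih, Polynomial.deriv, Function.iterate_succ_apply']

-- Otherwise the multiplicity of `ν` would exceed the supremum. The degree bounds the set of
-- multiplicities, so `sSup` is a genuine supremum.
open Polynomial in
theorem exists_iterate_derivative_ne_zero {P : ℝ[X]} (hP : P ≠ 0) {ν : ℂ} (hν : ν ≠ 0) :
    ∃ m ≤ sSup {n : ℕ | ∃ y : ℂ, y ≠ 0 ∧ n = (P.map (algebraMap ℝ ℂ)).rootMultiplicity y},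
      (derivative^[m] (P.map (algebraMap ℝ ℂ))).eval ν ≠ 0 := by
  by_contra! hcon
  have hP' : P.map (algebraMap ℝ ℂ) ≠ 0 := (Polynomial.map_ne_zero_iff (algebraMap ℝ ℂ).injective).2 hP
  have h1 := lt_rootMultiplicity_of_isRoot_iterate_derivative hP' hcon
  have hbdd : BddAbove {n : ℕ | ∃ y : ℂ, y ≠ 0 ∧
      n = (P.map (algebraMap ℝ ℂ)).rootMultiplicity y} := by
    refine ⟨(P.map (algebraMap ℝ ℂ)).natDegree, ?_⟩
    rintro n ⟨y, -, rfl⟩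
    have h2 := natDegree_le_of_dvd (pow_rootMultiplicity_dvd (P.map (algebraMap ℝ ℂ)) y) hP'
    rwa [natDegree_pow, natDegree_X_sub_C, mul_one] at h2
  exact absurd (le_csSup hbdd ⟨ν, hν, rfl⟩) (not_le.2 h1)

open Polynomial in
theorem eval_iterate_derivative_comp (P : ℂ[X]) (E μ : ℂ) (m : ℕ) (y : ℂ) :
    (derivative^[m] (C E * P.comp (C μ * X))).eval y =
      E * μ ^ m * (derivative^[m] P).eval (μ * y) := by
  have h : derivative^[m] (C E * P.comp (C μ * X)) =
      C (E * μ ^ m) * (derivative^[m] P).comp (C μ * X) := by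
    induction m with
    | zero => simp
    | succ m ih =>
      rw [Function.iterate_succ_apply', ih, Function.iterate_succ_apply', derivative_C_mul,
        derivative_comp, derivative_C_mul, derivative_X, mul_one, pow_succ, ← mul_assoc E,
        C_mul (a := E * μ ^ m)]
      ring
  rw [h]
  simp

/-- A box of lattice points that contains all nonnegative lattice points of the line
`κ₁ a + κ₂ b = 1`. -/
noncomputable def lineBox (κ₁ κ₂ : ℝ) : Finset (ℕ × ℕ) :=
  Finset.range (⌊1 / κ₁⌋₊ + 1) ×ˢ Finset.range (⌊1 / κ₂⌋₊ + 1)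

theorem mem_lineBox {κ₁ κ₂ : ℝ} (hκ₁ : 0 < κ₁) (hκ₂ : 0 < κ₂) {ab : ℕ × ℕ}
    (h : κ₁ * ab.1 + κ₂ * ab.2 = 1) : ab ∈ lineBox κ₁ κ₂ := by
  have h1 : 0 ≤ κ₁ * ab.1 := by positivity
  have h2 : 0 ≤ κ₂ * ab.2 := by positivity
  refine Finset.mem_product.2 ⟨Finset.mem_range_succ_iff.2 (Nat.le_floor ?_),
    Finset.mem_range_succ_iff.2 (Nat.le_floor ?_)⟩
  · rw [le_div_iff₀ hκ₁]; linarith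
  · rw [le_div_iff₀ hκ₂]; linarith

theorem principal_eq_zero_of_notMem {c : ℕ × ℕ → ℝ} {κ₁ κ₂ : ℝ} (hκ₁ : 0 < κ₁) (hκ₂ : 0 < κ₂)
    {ab : ℕ × ℕ} (h : ab ∉ lineBox κ₁ κ₂) : principal c κ₁ κ₂ ab = 0 :=
  if_neg fun h1 => h (mem_lineBox hκ₁ hκ₂ h1)

open Polynomial in
/-- The derivatives of a quasi-homogeneous polynomial vanish to the order of vanishing of its
restriction to the line `x = 1`. -/
theorem exists_series2_principal_ne_zero {c : ℕ × ℕ → ℝ} {κ₁ κ₂ : ℝ} (hκ₁ : 0 < κ₁)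
    (hκ₂ : 0 < κ₂) {P : ℝ[X]}
    (hP : P = ∑ ab ∈ lineBox κ₁ κ₂, monomial ab.2 (principal c κ₁ κ₂ ab)) (hP0 : P ≠ 0) {x y : ℝ}
    (hx : x ≠ 0) (hy : y ≠ 0) :
    ∃ m ≤ sSup {n : ℕ | ∃ y : ℂ, y ≠ 0 ∧ n = (P.map (algebraMap ℝ ℂ)).rootMultiplicity y},
      series2 (dY^[m] (principal c κ₁ κ₂)) x y ≠ 0 := by
  set u := principal c κ₁ κ₂ with hu
  have hu0 : ∀ ab, ab ∉ lineBox κ₁ κ₂ → u ab = 0 := fun ab h =>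
    principal_eq_zero_of_notMem hκ₁ hκ₂ h
  let Q : ℝ[X] := ∑ ab ∈ lineBox κ₁ κ₂, monomial ab.2 (u ab * x ^ ab.1)
  have hconv : ConvOn u (|x| + |y| + 1) := fun r _ _ =>
    summable_of_ne_finset_zero (s := lineBox κ₁ κ₂) fun ab h => by simp [hu0 ab h]
  have hQ : ∀ z, Q.eval z = series2 u x z := by
    intro z
    unfold series2
    rw [tsum_eq_sum (s := lineBox κ₁ κ₂) fun ab h => by simp [hu0 ab h]]
    simp [Q, eval_finsetSum]
  have hder : ∀ m, series2 (dY^[m] u) x y = (derivative^[m] Q).eval y := by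
    intro m
    rw [← iteratedDeriv_polynomial_eval]
    refine (hconv.iteratedDeriv_eq ?_ _ (fun z _ => hQ z) m y ?_).symm
    · linarith [abs_nonneg y]
    · linarith [abs_nonneg x]
  -- On the line `a = (1 - κ₂ b) / κ₁`, so `x ^ a = E * μ ^ b` and the restriction to abscissa `x`
  -- is `E * P (μ y)`. As `x` may be negative, the fractional powers are taken through the complex
  -- logarithm; this is why complex zeros enter.
  set l := Complex.log x with hl
  have hxl : (x : ℂ) = Complex.exp l := (Complex.exp_log (by exact_mod_cast hx)).symm
  set E := Complex.exp (l / κ₁) with hE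
  set μ := Complex.exp (-(l * κ₂ / κ₁)) with hμ
  have hQP : Q.map (algebraMap ℝ ℂ) = C E * (P.map (algebraMap ℝ ℂ)).comp (C μ * X) := by
    rw [hP, Polynomial.map_sum, Polynomial.map_sum, Polynomial.sum_comp, Finset.mul_sum]
    refine Finset.sum_congr rfl fun ab _ => ?_
    rw [map_monomial, map_monomial, monomial_comp, mul_pow, ← C_pow, ← mul_assoc, ← mul_assoc,
      ← C_mul, ← C_mul, C_mul_X_pow_eq_monomial]
    congr 1
    by_cases h : u ab = 0
    · simp [h]
    · have h1 : κ₁ * ab.1 + κ₂ * ab.2 = 1 := by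
        by_contra hne
        exact h (if_neg hne)
      have h2 : (x : ℂ) ^ ab.1 = E * μ ^ ab.2 := by
        rw [hxl, hE, hμ, ← Complex.exp_nat_mul, ← Complex.exp_nat_mul, ← Complex.exp_add]
        congr 1
        have h3 : (κ₁ : ℂ) * ab.1 + κ₂ * ab.2 = 1 := by exact_mod_cast congrArg Complex.ofReal h1
        have h4 : (κ₁ : ℂ) ≠ 0 := by exact_mod_cast hκ₁.ne'
        field_simp
        linear_combination l * h3
      rw [map_mul, map_pow]
      change _ * (x : ℂ) ^ ab.1 = _
      rw [h2]
      ring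
  have hyC : (y : ℂ) ≠ 0 := by exact_mod_cast hy
  obtain ⟨m, hm, hne⟩ := exists_iterate_derivative_ne_zero hP0 (ν := μ * y)
    (mul_ne_zero (Complex.exp_ne_zero _) hyC)
  refine ⟨m, hm, fun h0 => hne ?_⟩
  rw [hder] at h0
  have h5 := eval_iterate_derivative_comp (P.map (algebraMap ℝ ℂ)) E μ m y
  rw [← hQP, iterate_derivative_map] at h5
  have h6 : ((derivative^[m] Q).map (algebraMap ℝ ℂ)).eval ((algebraMap ℝ ℂ) y) = 0 := by
    rw [eval_map_apply, h0, map_zero]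
  rw [show (algebraMap ℝ ℂ) y = (y : ℂ) from rfl, h5] at h6
  exact (mul_eq_zero.1 h6).resolve_left
    (mul_ne_zero (Complex.exp_ne_zero _) (pow_ne_zero _ (Complex.exp_ne_zero _)))

open Polynomial in
/-- The case where the diagonal meets the polygon in the interior of a compact edge. -/
theorem hasGoodWeights_of_edge {c : ℕ × ℕ → ℝ} {ε d : ℝ} (hd : 0 < d) (hε0 : 0 < ε)
    (hεd : d * ε < 1) {e : Set (ℝ × ℝ)} {v w : ℝ × ℝ} (hvw : v ≠ w) (he : e = segment ℝ v w)
    (hexp : IsExposed ℝ (polygon c) e) (hmem : (d, d) ∈ openSegment ℝ v w)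
    (hord : (sSup {n : ℕ | ∃ y : ℂ, y ≠ 0 ∧
      n = (((∑ᶠ ab ∈ {ab : ℕ × ℕ | ((ab.1 : ℝ), (ab.2 : ℝ)) ∈ e}, monomial ab.2 (c ab)) :
        ℝ[X]).map (algebraMap ℝ ℂ)).rootMultiplicity y} : ℕ) ≤ d) :
    HasGoodWeights c ε := by
  have hve : v ∈ e := he ▸ left_mem_segment ℝ v w
  have hwe : w ∈ e := he ▸ right_mem_segment ℝ v w
  have hpe : (d, d) ∈ e := he ▸ openSegment_subset_segment ℝ v w hmem
  obtain ⟨l, hl⟩ := hexp ⟨v, hve⟩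
  -- Exposed faces are defined by maximizing; with the sign reversed, the edge minimizes `α x + β
  -- y`.
  have hlz : ∀ z, l z = -(-l (1, 0) * z.1 + -l (0, 1) * z.2) := by
    intro z; rw [clm_apply_prod]; ring
  have hl' : ∀ z, z ∈ e ↔ z ∈ polygon c ∧
      ∀ y ∈ polygon c, -l (1, 0) * z.1 + -l (0, 1) * z.2 ≤ -l (1, 0) * y.1 + -l (0, 1) * y.2 := by
    intro z
    rw [hl]
    refine and_congr_right fun _ => forall₂_congr fun y _ => ?_
    rw [hlz z, hlz y, neg_le_neg_iff]
  generalize -l (1, 0) = α at hl'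
  generalize -l (0, 1) = β at hl'
  obtain ⟨hpN, hpmin⟩ := (hl' _).1 hpe
  have hnonneg : ∀ q : ℝ × ℝ, 0 ≤ q → 0 ≤ α * q.1 + β * q.2 := by
    intro q hq
    have := hpmin _ (add_mem_polygon hpN hq)
    simp only [Prod.fst_add, Prod.snd_add] at this
    linarith
  have hedge : ∀ q : ℝ × ℝ, 0 ≤ q → α * q.1 + β * q.2 = 0 → (d, d) + q ∈ e := by
    intro q hq h0
    refine (hl' _).2 ⟨add_mem_polygon hpN hq, fun y hy => ?_⟩
    have := hpmin y hy
    simp only [Prod.fst_add, Prod.snd_add] at this ⊢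
    linarith
  have hbdd : Bornology.IsBounded e := by
    rw [he, ← convexHull_pair]
    exact isBounded_convexHull.2 (Set.Finite.isBounded (by simp))
  obtain ⟨R, hR⟩ := hbdd.exists_norm_le
  -- If a weight vanished, the edge would contain a ray from `(d, d)`, contrary to boundedness.
  have hα : 0 < α := by
    refine lt_of_le_of_ne (by simpa using hnonneg (1, 0) ⟨zero_le_one, le_rfl⟩) fun h0 => ?_
    have h1 := hR _ (hedge (|R| + 1, 0) ⟨by positivity, le_rfl⟩ (by simp [← h0]))
    have h2 := (norm_fst_le ((d, d) + ((|R| + 1, 0) : ℝ × ℝ))).trans h1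
    simp only [Prod.fst_add, Real.norm_eq_abs] at h2
    linarith [le_abs_self (d + (|R| + 1)), le_abs_self R]
  have hβ : 0 < β := by
    refine lt_of_le_of_ne (by simpa using hnonneg (0, 1) ⟨le_rfl, zero_le_one⟩) fun h0 => ?_
    have h1 := hR _ (hedge (0, |R| + 1) ⟨le_rfl, by positivity⟩ (by simp [← h0]))
    have h2 := (norm_snd_le ((d, d) + ((0, |R| + 1) : ℝ × ℝ))).trans h1
    simp only [Prod.snd_add, Real.norm_eq_abs] at h2
    linarith [le_abs_self (d + (|R| + 1)), le_abs_self R]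
  set T : ℝ := α * d + β * d with hT
  have hTpos : 0 < T := by positivity
  set κ₁ : ℝ := α / T with hκ₁def
  set κ₂ : ℝ := β / T with hκ₂def
  have hκ₁ : 0 < κ₁ := by positivity
  have hκ₂ : 0 < κ₂ := by positivity
  have hκz : ∀ z : ℝ × ℝ, κ₁ * z.1 + κ₂ * z.2 = (α * z.1 + β * z.2) / T := by
    intro z; rw [hκ₁def, hκ₂def]; ring
  have hface : ∀ z, z ∈ e ↔ z ∈ polygon c ∧ κ₁ * z.1 + κ₂ * z.2 = 1 := by
    intro z
    rw [hl', hκz, div_eq_one_iff_eq hTpos.ne']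
    refine and_congr_right fun hz => ⟨fun h => le_antisymm (h _ hpN) (hpmin z hz), fun h y hy => ?_⟩
    rw [h]
    exact hpmin y hy
  have hκ : ∀ a b, c (a, b) ≠ 0 → 1 ≤ κ₁ * a + κ₂ * b := by
    intro a b h
    have h1 := hκz ((a : ℝ), (b : ℝ))
    simp only at h1
    rw [h1, le_div_iff₀ hTpos, one_mul]
    exact hpmin _ (mem_polygon h)
  have hsum : d * (κ₁ + κ₂) = 1 := by
    rw [hκ₁def, hκ₂def, ← add_div, hT, ← add_mul]
    have : 0 < α + β := by positivity
    field_simp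
  obtain ⟨s, t, hs, ht, hst, hp⟩ := hmem
  have hp1 : s * v.1 + t * w.1 = d := by simpa using congrArg Prod.fst hp
  have hv1 := ((hface v).1 hve).2
  have hw1 := ((hface w).1 hwe).2
  have hne1 : v.1 ≠ w.1 := by
    intro h
    refine hvw (Prod.ext h (mul_left_cancel₀ hκ₂.ne' ?_))
    rw [h] at hv1
    linarith
  have hpt : ∃ z ∈ e, z.1 < d := by
    rcases lt_or_gt_of_ne hne1 with h | h
    · exact ⟨v, hve, by nlinarith⟩
    · exact ⟨w, hwe, by nlinarith⟩
  have hpt' : ∃ z ∈ e, z.2 < d := by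
    have h1 : ∃ z ∈ e, d < z.1 := by
      rcases lt_or_gt_of_ne hne1 with h | h
      · exact ⟨w, hwe, by nlinarith⟩
      · exact ⟨v, hve, by nlinarith⟩
    obtain ⟨z, hz, hzd⟩ := h1
    refine ⟨z, hz, ?_⟩
    have h2 := ((hface z).1 hz).2
    have h3 := mul_lt_mul_of_pos_left hzd hκ₁
    exact lt_of_mul_lt_mul_left (by linarith : κ₂ * z.2 < κ₂ * d) hκ₂.le
  obtain ⟨z, hze, hzd⟩ := hpt
  -- As `(d, d)` is inside the edge, one end lies to its left and one below it, and lattice points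
  -- of the edge do too. These bound the orders of differentiation needed on the two axes.
  obtain ⟨a', b', hab', hab1', ha'⟩ := exists_lattice_point_on_face (α := 1) (β := 0) (t' := d)
    hκ₁ hκ₂ hκ ((hface z).1 hze).1 ((hface z).1 hze).2 (by simpa using hzd)
  obtain ⟨z', hze', hzd'⟩ := hpt'
  obtain ⟨a, b, hab, hab1, hb⟩ := exists_lattice_point_on_face (α := 0) (β := 1) (t' := d)
    hκ₁ hκ₂ hκ ((hface z').1 hze').1 ((hface z').1 hze').2 (by simpa using hzd')
  have hle : ∀ m : ℕ, (m : ℝ) ≤ d → m * ε < 1 := fun m hm =>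
    (mul_le_mul_of_nonneg_right hm hε0.le).trans_lt hεd
  refine hasGoodWeights_of_axes hκ₁ hκ₂ ?_ (fun ab h => hκ ab.1 ab.2 h) hab hab1
    (hle b (by linarith)) hab' hab1' (hle a' (by linarith)) fun x y hx hy => ?_
  · nlinarith
  · have hP : ((∑ᶠ ab ∈ {ab : ℕ × ℕ | ((ab.1 : ℝ), (ab.2 : ℝ)) ∈ e}, monomial ab.2 (c ab)) : ℝ[X]) =
        ∑ ab ∈ lineBox κ₁ κ₂, monomial ab.2 (principal c κ₁ κ₂ ab) := by
      rw [← finsum_mem_coe_finset]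
      have hterm : ∀ ab : ℕ × ℕ, (∑ᶠ (_ : ab ∈ {ab : ℕ × ℕ | ((ab.1 : ℝ), (ab.2 : ℝ)) ∈ e}),
          (monomial ab.2 (c ab) : ℝ[X])) = ∑ᶠ (_ : ab ∈ lineBox κ₁ κ₂),
            monomial ab.2 (principal c κ₁ κ₂ ab) := by
        classical
        rintro ⟨i, j⟩
        by_cases h0 : c (i, j) = 0
        · have : principal c κ₁ κ₂ (i, j) = 0 := by
            unfold principal; rw [h0, ite_self]
          simp [h0, this]
        · have h1 : (i, j) ∈ {ab : ℕ × ℕ | ((ab.1 : ℝ), (ab.2 : ℝ)) ∈ e} ↔ κ₁ * i + κ₂ * j = 1 := by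
            rw [Set.mem_ofPred_eq, hface]
            exact and_iff_right (mem_polygon h0)
          by_cases h2 : κ₁ * i + κ₂ * j = 1
          · rw [finsum_eq_if, finsum_eq_if, if_pos (h1.2 h2), if_pos (mem_lineBox hκ₁ hκ₂ h2)]
            unfold principal
            rw [if_pos h2]
          · have : principal c κ₁ κ₂ (i, j) = 0 := if_neg h2
            rw [this, finsum_eq_if, if_neg (fun h => h2 (h1.1 h))]
            simp
      exact finsum_congr hterm
    have hP0 : ((∑ᶠ ab ∈ {ab : ℕ × ℕ | ((ab.1 : ℝ), (ab.2 : ℝ)) ∈ e}, monomial ab.2 (c ab)) :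
        ℝ[X]) ≠ 0 := by
      rw [hP]
      intro h0
      have h1 := congrArg (fun P : ℝ[X] => P.coeff b) h0
      simp only [finsetSum_coeff, coeff_monomial, coeff_zero] at h1
      rw [Finset.sum_eq_single (a, b)] at h1
      · rw [if_pos rfl] at h1
        unfold principal at h1
        rw [if_pos hab1] at h1
        exact hab h1
      · rintro ⟨i, j⟩ _ hne
        split_ifs with hj
        · simp only at hj
          subst hj
          refine principal_eq_zero_of_ne hκ₁ (a₀ := a) ?_ fun h => hne (by rw [h])
          unfold principal
          rw [if_pos hab1]
          exact hab
        · rfl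
      · intro h
        exact absurd (mem_lineBox hκ₁ hκ₂ hab1) h
    obtain ⟨m, hm, hne⟩ := exists_series2_principal_ne_zero hκ₁ hκ₂ hP hP0 hx hy
    exact ⟨m, hle m (le_trans (by exact_mod_cast hm) hord), hne⟩

/-! ### The growth exponent -/

/-- If `β > α`, dividing by `δ ^ α` and letting `δ → 0` would give `A ≤ 0`. -/
theorem le_of_rpow_bound {A B δ₀ α β : ℝ} (hA : 0 < A) (hδ₀ : 0 < δ₀)
    (h : ∀ δ, 0 < δ → δ ≤ δ₀ → A * δ ^ α ≤ B * δ ^ β) : β ≤ α := by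
  by_contra! hlt
  have hlim : Filter.Tendsto (fun δ : ℝ => B * δ ^ (β - α)) (𝓝[>] 0) (𝓝 0) := by
    have h1 : Filter.Tendsto (fun δ : ℝ => B * δ ^ (β - α)) (𝓝 0) (𝓝 (B * 0 ^ (β - α))) :=
      (Real.continuousAt_rpow_const 0 _ (Or.inr (by linarith))).tendsto.const_mul B
    rw [Real.zero_rpow (by linarith), mul_zero] at h1
    exact h1.mono_left nhdsWithin_le_nhds
  obtain ⟨δ, h1, h2, h3⟩ := ((hlim.eventually (gt_mem_nhds hA)).and
    (Ioc_mem_nhdsGT hδ₀)).exists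
  have h4 := h δ h2 h3
  have h5 : δ ^ β = δ ^ (β - α) * δ ^ α := by rw [← Real.rpow_add h2]; congr 1; ring
  rw [h5, ← mul_assoc] at h4
  exact absurd (le_of_mul_le_mul_right h4 (Real.rpow_pos_of_pos h2 _)) (not_le.2 h1)

theorem volume_closedBall_prod (x : ℝ × ℝ) {r : ℝ} (hr : 0 ≤ r) :
    volume (Metric.closedBall x r) = ENNReal.ofReal (4 * r ^ 2) := by
  rw [← closedBall_prod_same, Measure.volume_eq_prod, Measure.prod_prod, Real.volume_closedBall,
    Real.volume_closedBall, ← ENNReal.ofReal_mul (by positivity)]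
  congr 1; ring

/-- A real `sSup` is meaningful only for bounded sets. From `|S t| ≤ L ‖t‖`, the integral over the
ball of radius `δ` is at least a constant times `δ ^ (2 - ε)`, so `ε ≤ 2`. Nonvanishing almost
everywhere matters because `0 ^ (-ε) = 0` for real powers. -/
theorem bddAbove_of_rpow_neg_integrable {S : ℝ × ℝ → ℝ} {L r₀ : ℝ} (hr₀ : 0 < r₀)
    (hL : ∀ t, ‖t‖ ≤ r₀ → |S t| ≤ L * ‖t‖)
    (hae : ∃ V ∈ 𝓝 (0 : ℝ × ℝ), ∀ᵐ t ∂volume.restrict V, S t ≠ 0) :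
    BddAbove {ε : ℝ | 0 < ε ∧ ∃ V ∈ 𝓝 (0 : ℝ × ℝ),
      IntegrableOn (fun t => |S t| ^ (-ε)) V volume} := by
  obtain ⟨V₀, hV₀, hne⟩ := hae
  refine ⟨2, ?_⟩
  rintro ε ⟨hε, V, hV, hint⟩
  obtain ⟨r₁, hr₁, hball⟩ := Metric.mem_nhds_iff.1 (Filter.inter_mem hV₀ hV)
  have hfin := hint.hasFiniteIntegral
  unfold HasFiniteIntegral at hfin
  set M := ∫⁻ t in V, ‖|S t| ^ (-ε)‖ₑ with hM
  set L' := |L| + 1 with hL'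
  have hL'pos : 0 < L' := by positivity
  have key : ∀ δ, 0 < δ → δ ≤ min r₀ (r₁ / 2) →
      (4 * L' ^ (-ε)) * δ ^ (2 - ε) ≤ M.toReal * δ ^ (0 : ℝ) := by
    intro δ hδ hδ1
    have hδ0 : δ ≤ r₀ := hδ1.trans (min_le_left _ _)
    have hδ2 : δ < r₁ := (hδ1.trans (min_le_right _ _)).trans_lt (by linarith)
    have hsub : Metric.closedBall (0 : ℝ × ℝ) δ ⊆ V₀ ∩ V :=
      (Metric.closedBall_subset_ball hδ2).trans hball
    rw [Real.rpow_zero, mul_one, ← ENNReal.ofReal_le_iff_le_toReal hfin.ne]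
    calc ENNReal.ofReal (4 * L' ^ (-ε) * δ ^ (2 - ε))
        = ENNReal.ofReal ((L' * δ) ^ (-ε)) * volume (Metric.closedBall (0 : ℝ × ℝ) δ) := by
          rw [volume_closedBall_prod _ hδ.le, ← ENNReal.ofReal_mul (by positivity),
            Real.mul_rpow hL'pos.le hδ.le, sub_eq_add_neg, Real.rpow_add hδ, Real.rpow_two]
          congr 1; ring
      _ = ∫⁻ t in Metric.closedBall (0 : ℝ × ℝ) δ, ENNReal.ofReal ((L' * δ) ^ (-ε)) :=
          (setLIntegral_const _ _).symm
      _ ≤ ∫⁻ t in Metric.closedBall (0 : ℝ × ℝ) δ, ‖|S t| ^ (-ε)‖ₑ := by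
          refine lintegral_mono_ae ?_
          filter_upwards [ae_restrict_of_ae_restrict_of_subset (hsub.trans Set.inter_subset_left)
            hne, ae_restrict_mem Metric.isClosed_closedBall.measurableSet] with t ht htb
          rw [Real.enorm_eq_ofReal (by positivity)]
          apply ENNReal.ofReal_le_ofReal
          have htn : ‖t‖ ≤ δ := by simpa using htb
          refine Real.rpow_le_rpow_of_nonpos (abs_pos.2 ht) ?_ (by linarith)
          calc |S t| ≤ L * ‖t‖ := hL t (htn.trans hδ0)
            _ ≤ L' * δ := by
              refine mul_le_mul ?_ htn (norm_nonneg _) hL'pos.le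
              rw [hL']; linarith [le_abs_self L]
      _ ≤ M := lintegral_mono_set (hsub.trans Set.inter_subset_right)
  have := le_of_rpow_bound (by positivity) (by positivity) key
  linarith

/-- In `ℝ≥0∞` the power `0 ^ (-ε)` is `⊤`, so a finite integral also shows that `S` is nonzero
almost everywhere. -/
theorem integrableOn_rpow_neg_of_lintegral {S : ℝ × ℝ → ℝ} {D V : Set (ℝ × ℝ)} {ε : ℝ} (hε : 0 < ε)
    (hD : D ∈ 𝓝 (0 : ℝ × ℝ)) (hS : ContinuousOn S D) (hV : V ∈ 𝓝 (0 : ℝ × ℝ))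
    (hlt : ∫⁻ t in V, ‖S t‖ₑ ^ (-ε) < ⊤) :
    ∃ V ∈ 𝓝 (0 : ℝ × ℝ), IntegrableOn (fun t => |S t| ^ (-ε)) V volume ∧
      ∀ᵐ t ∂volume.restrict V, S t ≠ 0 := by
  obtain ⟨r, hr, hball⟩ := Metric.mem_nhds_iff.1 (Filter.inter_mem hD hV)
  have hmeas : AEMeasurable S (volume.restrict (Metric.ball 0 r)) :=
    (hS.mono (hball.trans Set.inter_subset_left)).aemeasurable Metric.isOpen_ball.measurableSet
  have hlt' : ∫⁻ t in Metric.ball (0 : ℝ × ℝ) r, ‖S t‖ₑ ^ (-ε) < ⊤ :=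
    (lintegral_mono_set (hball.trans Set.inter_subset_right)).trans_lt hlt
  refine ⟨Metric.ball 0 r, Metric.ball_mem_nhds _ hr, ⟨?_, ?_⟩, ?_⟩
  · exact ((measurable_norm.comp_aemeasurable hmeas).pow_const (-ε)).aestronglyMeasurable
  · refine lt_of_le_of_lt (lintegral_mono fun t => ?_) hlt'
    by_cases h : S t = 0
    · simp [h, hε.ne', Real.zero_rpow]
    · rw [Real.enorm_eq_ofReal (by positivity), Real.enorm_eq_ofReal_abs,
        ENNReal.ofReal_rpow_of_pos (abs_pos.2 h)]
  · filter_upwards [ae_lt_top' (hmeas.enorm.pow_const (-ε)) hlt'.ne] with t ht h0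
    rw [h0] at ht
    simp [hε] at ht

/-- The Taylor expansion of an analytic function of two variables. -/
theorem AnalyticAt.exists_taylor {S : ℝ × ℝ → ℝ} (hS : AnalyticAt ℝ S 0) :
    ∃ ρ > 0, ConvOn (fun ab => Averaging.taylorCoeff S ab.1 ab.2) ρ ∧
      ∀ x y, |x| < ρ → |y| < ρ →
        S (x, y) = series2 (fun ab => Averaging.taylorCoeff S ab.1 ab.2) x y := by
  obtain ⟨u, ρ, hρ, hu, h⟩ := AnalyticAt.exists_series2 hS
  have : (fun ab : ℕ × ℕ => Averaging.taylorCoeff S ab.1 ab.2) = u :=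
    funext fun ab => hu.taylorCoeff_eq hρ S h ab.1 ab.2
  rw [this]
  exact ⟨ρ, hρ, hu, h⟩

theorem exists_taylorCoeff_ne_zero {S : ℝ × ℝ → ℝ} (hS : AnalyticAt ℝ S 0)
    (hne : ∃ᶠ t in 𝓝 (0 : ℝ × ℝ), S t ≠ 0) : ∃ a b, Averaging.taylorCoeff S a b ≠ 0 := by
  by_contra! hcon
  obtain ⟨ρ, hρ, -, h⟩ := AnalyticAt.exists_taylor hS
  refine hne ?_
  filter_upwards [Metric.ball_mem_nhds (0 : ℝ × ℝ) hρ] with t ht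
  rw [mem_ball_zero_iff, Prod.norm_def, max_lt_iff] at ht
  rw [not_not, ← Prod.mk.eta (p := t), h _ _ ht.1 ht.2]
  simp [series2, hcon]

/-! ### The Newton distance and the growth exponent -/

theorem taylorCoeff_zero_zero (S : ℝ × ℝ → ℝ) : Averaging.taylorCoeff S 0 0 = S 0 := by
  simp [Averaging.taylorCoeff, Prod.mk_zero_zero]

theorem newtonDistance_bddBelow (S : ℝ × ℝ → ℝ) :
    0 ∈ lowerBounds {x : ℝ | (x, x) ∈ Averaging.newtonPolygon S} := by
  intro x hx
  have := le_of_mem_polygon (c := fun ab => Averaging.taylorCoeff S ab.1 ab.2) (κ₁ := 1) (κ₂ := 0)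
    (t := 0) zero_le_one le_rfl (fun a b _ => by positivity) hx
  simpa using this

/-- As `S 0 = 0`, all exponents satisfy `a + b ≥ 1`, and so does the polygon; hence `d ≥ 1/2`. -/
theorem newtonDistance_pos {S : ℝ × ℝ → ℝ} (hS0 : S 0 = 0)
    (hne : ∃ a b, Averaging.taylorCoeff S a b ≠ 0) : 0 < Averaging.newtonDistance S := by
  obtain ⟨a, b, hab⟩ := hne
  have hnon : {x : ℝ | (x, x) ∈ Averaging.newtonPolygon S}.Nonempty :=
    ⟨max a b, subset_convexHull ℝ _ ⟨a, b, hab, le_max_left _ _, le_max_right _ _⟩⟩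
  refine lt_of_lt_of_le (by norm_num : (0 : ℝ) < 1 / 2) (le_csInf hnon fun x hx => ?_)
  have := le_of_mem_polygon (c := fun ab => Averaging.taylorCoeff S ab.1 ab.2) (κ₁ := 1) (κ₂ := 1)
    (t := 1) zero_le_one zero_le_one (fun a b h => by
      have h1 : a + b ≠ 0 := by
        intro h2
        obtain ⟨rfl, rfl⟩ := Nat.add_eq_zero_iff.1 h2
        exact h (by rw [taylorCoeff_zero_zero, hS0])
      have h2 : 1 ≤ a + b := Nat.one_le_iff_ne_zero.2 h1
      have h3 : (1 : ℝ) ≤ a + b := by exact_mod_cast h2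
      linarith) hx
  simp only at this
  linarith

theorem notMem_newtonPolygon_of_lt {S : ℝ × ℝ → ℝ} {x : ℝ} (hx : x < Averaging.newtonDistance S) :
    (x, x) ∉ Averaging.newtonPolygon S :=
  fun h => absurd (csInf_le ⟨0, newtonDistance_bddBelow S⟩ h) (not_le.2 hx)

theorem hasGoodWeights_of_diagonalCondition {S : ℝ × ℝ → ℝ} (hd : 0 < Averaging.newtonDistance S)
    (hN : Averaging.DiagonalCondition S) {ε : ℝ} (hε : 0 < ε)
    (hεd : Averaging.newtonDistance S * ε < 1) :
    HasGoodWeights (fun ab => Averaging.taylorCoeff S ab.1 ab.2) ε := by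
  rcases hN with h | ⟨h1, h2⟩ | ⟨h1, h2⟩ | ⟨e, v, w, ⟨hvw, he, hexp⟩, hmem, hord⟩
  · exact hasGoodWeights_of_vertex hd hεd h
  · exact hasGoodWeights_of_horizontal hd hε hεd h1 h2
  · exact hasGoodWeights_of_vertical hd hε hεd h1 h2
  · exact hasGoodWeights_of_edge hd hε hεd hvw he hexp hmem hord

/-- In adapted coordinates the growth exponent is at least the inverse of the Newton distance. -/
theorem one_div_newtonDistance_le_growthExponent {S : ℝ × ℝ → ℝ} (hS : AnalyticAt ℝ S 0)
    (hS0 : S 0 = 0) (hne : ∃ᶠ t in 𝓝 (0 : ℝ × ℝ), S t ≠ 0) (hN : Averaging.DiagonalCondition S) :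
    1 / Averaging.newtonDistance S ≤ Averaging.growthExponent S := by
  have hd := newtonDistance_pos hS0 (exists_taylorCoeff_ne_zero hS hne)
  obtain ⟨ρ, hρ, hconv, hexp⟩ := AnalyticAt.exists_taylor hS
  obtain ⟨D, hD, hcont⟩ : ∃ D ∈ 𝓝 (0 : ℝ × ℝ), ContinuousOn S D :=
    ⟨_, hS.eventually_analyticAt, fun t ht => ContinuousAt.continuousWithinAt (AnalyticAt.continuousAt ht)⟩
  have hint : ∀ ε, 0 < ε → ε < 1 / Averaging.newtonDistance S →
      ∃ V ∈ 𝓝 (0 : ℝ × ℝ), IntegrableOn (fun t => |S t| ^ (-ε)) V volume ∧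
        ∀ᵐ t ∂volume.restrict V, S t ≠ 0 := by
    intro ε hε hεd
    rw [lt_div_iff₀ hd, mul_comm] at hεd
    obtain ⟨κ₁, κ₂, h1, h2, h3, h4, h5⟩ := hasGoodWeights_of_diagonalCondition hd hN hε hεd
    have h5' : ∀ x y : ℝ, (x ≠ 0 ∨ y ≠ 0) → _ := h5
    unfold principal at h5'
    obtain ⟨V, hV, hlt⟩ := exists_lintegral_rpow_neg_lt_top hρ hconv κ₁ κ₂ h1 h2 h4 ε hε h3
      (by convert h5') S hexp
    exact integrableOn_rpow_neg_of_lintegral hε hD hcont hV hlt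
  have hbdd : BddAbove {ε : ℝ | 0 < ε ∧ ∃ V ∈ 𝓝 (0 : ℝ × ℝ),
      IntegrableOn (fun t => |S t| ^ (-ε)) V volume} := by
    obtain ⟨V, hV, -, hae⟩ := hint (1 / Averaging.newtonDistance S / 2) (by positivity)
      (half_lt_self (by positivity))
    have hO := hS.differentiableAt.isBigO_sub
    obtain ⟨L, hL⟩ := hO.bound
    obtain ⟨r, hr, hball⟩ := Metric.mem_nhds_iff.1 hL
    refine bddAbove_of_rpow_neg_integrable (L := L) (r₀ := r / 2) (by positivity) (fun t ht => ?_)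
      ⟨V, hV, hae⟩
    have := hball (show t ∈ Metric.ball 0 r by rw [mem_ball_zero_iff]; linarith)
    simpa [hS0] using this
  refine le_of_forall_lt fun ε hε => ?_
  have hpos : 0 < 1 / Averaging.newtonDistance S := by positivity
  obtain ⟨ε', h1, h2⟩ := exists_between (max_lt hε hpos)
  obtain ⟨V, hV, hi, -⟩ := hint ε' ((le_max_right _ _).trans_lt h1) h2
  exact ((le_max_left _ _).trans_lt h1).trans_le
    (le_csSup hbdd ⟨(le_max_right _ _).trans_lt h1, V, hV, hi⟩)

/-! ### Test functions -/

/-- Fubini with the last coordinate innermost, after regrouping `ℝ × ℝ × ℝ` as `(ℝ × ℝ) × ℝ`. -/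
theorem volume_of_slices {T : Set (ℝ × ℝ × ℝ)} (hT : MeasurableSet T) {A : Set (ℝ × ℝ)}
    (hA : MeasurableSet A) (v : ℝ≥0∞) (h1 : ∀ z ∈ A, volume {s : ℝ | (z.1, z.2, s) ∈ T} = v)
    (h2 : ∀ z ∉ A, {s : ℝ | (z.1, z.2, s) ∈ T} = ∅) : volume T = v * volume A := by
  have hmp := volume_preserving_prodAssoc (α₁ := ℝ) (β₁ := ℝ) (γ₁ := ℝ)
  rw [← hmp.measure_preimage hT.nullMeasurableSet, Measure.volume_eq_prod,
    Measure.prod_apply (MeasurableEquiv.prodAssoc.measurable hT), ← setLIntegral_const,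
    ← lintegral_indicator hA]
  refine lintegral_congr fun z => ?_
  by_cases hz : z ∈ A
  · rw [Set.indicator_of_mem hz]
    exact h1 z hz
  · rw [Set.indicator_of_notMem hz]
    exact (congrArg volume (h2 z hz)).trans measure_empty

/-- The closed box with half-widths `a`, `b`, `c`. -/
def closedBox (a b c : ℝ) : Set (ℝ × ℝ × ℝ) :=
  Set.Icc (-a) a ×ˢ Set.Icc (-b) b ×ˢ Set.Icc (-c) c

/-- The open box with half-widths `a`, `b`, `c`. -/
def openBox (a b c : ℝ) : Set (ℝ × ℝ × ℝ) :=
  Set.Ioo (-a) a ×ˢ Set.Ioo (-b) b ×ˢ Set.Ioo (-c) c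

theorem mem_closedBox {a b c : ℝ} {x : ℝ × ℝ × ℝ} :
    x ∈ closedBox a b c ↔ |x.1| ≤ a ∧ |x.2.1| ≤ b ∧ |x.2.2| ≤ c := by
  simp only [closedBox, Set.mem_prod, Set.mem_Icc, abs_le]

theorem isClosed_closedBox (a b c : ℝ) : IsClosed (closedBox a b c) :=
  isClosed_Icc.prod (isClosed_Icc.prod isClosed_Icc)

theorem isOpen_openBox (a b c : ℝ) : IsOpen (openBox a b c) :=
  isOpen_Ioo.prod (isOpen_Ioo.prod isOpen_Ioo)

theorem isBounded_openBox (a b c : ℝ) : Bornology.IsBounded (openBox a b c) :=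
  (Metric.isBounded_Ioo _ _).prod ((Metric.isBounded_Ioo _ _).prod (Metric.isBounded_Ioo _ _))

theorem closedBox_subset_openBox {a b c a' b' c' : ℝ} (ha : a < a') (hb : b < b') (hc : c < c') :
    closedBox a b c ⊆ openBox a' b' c' :=
  Set.prod_mono (Set.Icc_subset_Ioo (by linarith) ha)
    (Set.prod_mono (Set.Icc_subset_Ioo (by linarith) hb) (Set.Icc_subset_Ioo (by linarith) hc))

theorem volume_closedBox {a b c : ℝ} (ha : 0 ≤ a) (hb : 0 ≤ b) :
    volume (closedBox a b c) = ENNReal.ofReal (8 * (a * b * c)) := by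
  rw [closedBox, Measure.volume_eq_prod, Measure.volume_eq_prod, Measure.prod_prod,
    Measure.prod_prod, Real.volume_Icc, Real.volume_Icc, Real.volume_Icc,
    ← ENNReal.ofReal_mul (by linarith), ← ENNReal.ofReal_mul (by linarith)]
  congr 1; ring

theorem volume_openBox {a b c : ℝ} (ha : 0 ≤ a) (hb : 0 ≤ b) :
    volume (openBox a b c) = ENNReal.ofReal (8 * (a * b * c)) := by
  rw [openBox, Measure.volume_eq_prod, Measure.volume_eq_prod, Measure.prod_prod,
    Measure.prod_prod, Real.volume_Ioo, Real.volume_Ioo, Real.volume_Ioo,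
    ← ENNReal.ofReal_mul (by linarith), ← ENNReal.ofReal_mul (by linarith)]
  congr 1; ring

-- Indicator functions are not Schwartz; a smooth function between those of `K` and `U` replaces
-- them. The real-valued `f` is kept for positivity.
open scoped Manifold in
theorem exists_schwartz_urysohn {K U : Set (ℝ × ℝ × ℝ)} (hK : IsClosed K) (hU : IsOpen U)
    (hKU : K ⊆ U) (hUb : Bornology.IsBounded U) :
    ∃ (f : ℝ × ℝ × ℝ → ℝ) (F : 𝓢(ℝ × ℝ × ℝ, ℂ)), (∀ x, F x = (f x : ℂ)) ∧ Continuous f ∧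
      (∀ x, 0 ≤ f x) ∧ (∀ x, f x ≤ 1) ∧ (∀ x ∉ U, f x = 0) ∧ ∀ x ∈ K, f x = 1 := by
  obtain ⟨f, hf, hrange, h0, h1⟩ := exists_contMDiff_zero_iff_one_iff_of_isClosed (n := ⊤)
    𝓘(ℝ, ℝ × ℝ × ℝ) hU.isClosed_compl hK (Set.disjoint_compl_left_iff_subset.2 hKU)
  have hf' : ContDiff ℝ ∞ f := hf.contDiff
  have hsupp : HasCompactSupport (fun x => (f x : ℂ)) := by
    refine HasCompactSupport.of_support_subset_isCompact hUb.isCompact_closure fun x hx => ?_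
    refine subset_closure ?_
    by_contra hxU
    exact hx (by simp [(h0 x).1 hxU])
  have hsm : ContDiff ℝ ∞ (fun x => (f x : ℂ)) := Complex.ofRealCLM.contDiff.comp hf'
  exact ⟨f, hsupp.toSchwartzMap hsm, fun x => rfl, hf'.continuous,
    fun x => (hrange ⟨x, rfl⟩).1, fun x => (hrange ⟨x, rfl⟩).2, fun x hx => (h0 x).1 hx,
    fun x hx => (h1 x).1 hx⟩

/-- Lower bound for the operator norm by testing on functions between the indicator functions of
`K` and `U`. -/
theorem testing_bound {S φ : ℝ × ℝ → ℝ} {D : Set (ℝ × ℝ)} (hD : IsOpen D) (hS : ContinuousOn S D)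
    (hφ : Continuous φ) (hφc : HasCompactSupport φ) (hφD : tsupport φ ⊆ D) (hφ0 : ∀ t, 0 ≤ φ t)
    {p q : ℝ≥0∞} (hq : 1 ≤ q) {C : ℝ≥0}
    (hC : ∀ f : 𝓢(ℝ × ℝ × ℝ, ℂ), eLpNorm (Averaging.avgOp S φ f) q volume ≤ C * eLpNorm f p volume)
    {K U E : Set (ℝ × ℝ × ℝ)} (hK : IsClosed K) (hU : IsOpen U) (hKU : K ⊆ U)
    (hUb : Bornology.IsBounded U) (hE0 : volume E ≠ 0) (hE : MeasurableSet E)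
    (W : ℝ × ℝ × ℝ → Set (ℝ × ℝ)) {c₀ w : ℝ} (hc₀ : 0 ≤ c₀)
    (hWm : ∀ x ∈ E, MeasurableSet (W x)) (hWv : ∀ x ∈ E, ENNReal.ofReal w ≤ volume (W x))
    (hWφ : ∀ x ∈ E, ∀ t ∈ W x, c₀ ≤ φ t)
    (hWK : ∀ x ∈ E, ∀ t ∈ W x, (x.1 - t.1, x.2.1 - t.2, x.2.2 - S t) ∈ K) :
    ENNReal.ofReal (c₀ * w) * volume E ^ (1 / q).toReal ≤ C * volume U ^ (1 / p).toReal := by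
  obtain ⟨f, F, hF, hfc, hf0, hf1, hfU, hfK⟩ := exists_schwartz_urysohn hK hU hKU hUb
  have hlow : ∀ x ∈ E, ENNReal.ofReal (c₀ * w) ≤ ‖Averaging.avgOp S φ F x‖ₑ := by
    intro x hx
    let G : ℝ × ℝ → ℝ := fun t => f (x.1 - t.1, x.2.1 - t.2, x.2.2 - S t) * φ t
    have hGeq : Averaging.avgOp S φ F x = ((∫ t, G t : ℝ) : ℂ) := by
      rw [← integral_complex_ofReal]
      unfold Averaging.avgOp
      refine integral_congr_ae (Filter.Eventually.of_forall fun t => ?_)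
      simp only [G, hF]
      push_cast
      rfl
    have hG0 : ∀ t, 0 ≤ G t := fun t => mul_nonneg (hf0 _) (hφ0 t)
    -- `S` is controlled only on `D`, but off `D` the factor `φ` vanishes in a neighborhood.
    have hGcont : Continuous G := by
      rw [continuous_iff_continuousAt]
      intro t
      by_cases ht : t ∈ D
      · have hSt : ContinuousAt S t := hS.continuousAt (hD.mem_nhds ht)
        refine ContinuousAt.mul ?_ hφ.continuousAt
        refine ContinuousAt.comp (f := fun t : ℝ × ℝ => (x.1 - t.1, x.2.1 - t.2, x.2.2 - S t))
          hfc.continuousAt ?_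
        exact (continuousAt_const.sub continuousAt_fst).prodMk
          ((continuousAt_const.sub continuousAt_snd).prodMk (continuousAt_const.sub hSt))
      · have ht' : t ∉ tsupport φ := fun h => ht (hφD h)
        have hev : (fun _ => (0 : ℝ)) =ᶠ[𝓝 t] G := by
          filter_upwards [(isClosed_tsupport φ).isOpen_compl.mem_nhds ht'] with s hs
          simp only [G, image_eq_zero_of_notMem_tsupport hs, mul_zero]
        exact continuousAt_const.congr hev
    have hGint : Integrable G := hGcont.integrable_of_hasCompactSupport hφc.mul_left
    rw [hGeq]
    have hI0 : 0 ≤ ∫ t, G t := integral_nonneg hG0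
    rw [← ofReal_norm, Complex.norm_real, Real.norm_of_nonneg hI0,
      ofReal_integral_eq_lintegral_ofReal hGint (Filter.Eventually.of_forall hG0),
      ENNReal.ofReal_mul hc₀]
    calc ENNReal.ofReal c₀ * ENNReal.ofReal w ≤ ENNReal.ofReal c₀ * volume (W x) :=
          mul_le_mul_right (hWv x hx) _
      _ = ∫⁻ _ in W x, ENNReal.ofReal c₀ := (setLIntegral_const _ _).symm
      _ ≤ ∫⁻ t in W x, ENNReal.ofReal (G t) := by
          refine setLIntegral_mono' (hWm x hx) fun t ht => ENNReal.ofReal_le_ofReal ?_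
          simp only [G, hfK _ (hWK x hx t ht), one_mul]
          exact hWφ x hx t ht
      _ ≤ ∫⁻ t, ENNReal.ofReal (G t) := setLIntegral_le_lintegral _ _
  have hexp : ∀ r : ℝ≥0∞, (1 / r).toReal = 1 / r.toReal := fun r => by
    rw [one_div, ENNReal.toReal_inv, one_div]
  rw [hexp, hexp]
  calc ENNReal.ofReal (c₀ * w) * volume E ^ (1 / q.toReal)
      = eLpNorm (E.indicator fun _ => ENNReal.ofReal (c₀ * w)) q volume := by
        -- Positive measure of `E` makes the formula valid for `q = ∞` as well, where the exponent
        -- is `0`.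
        rw [eLpNorm_indicator_const' hE hE0 (zero_lt_one.trans_le hq).ne', enorm_eq_self]
    _ ≤ eLpNorm (Averaging.avgOp S φ F) q volume := by
        refine eLpNorm_mono_enorm fun x => ?_
        by_cases hx : x ∈ E
        · rw [Set.indicator_of_mem hx, enorm_eq_self]; exact hlow x hx
        · rw [Set.indicator_of_notMem hx]; simp
    _ ≤ C * eLpNorm F p volume := hC F
    _ ≤ C * eLpNorm (U.indicator fun _ => (1 : ℝ)) p volume := by
        refine mul_le_mul_right (eLpNorm_mono_enorm fun x => ?_) _
        rw [hF]
        by_cases hx : x ∈ U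
        · rw [Set.indicator_of_mem hx, ← ofReal_norm, ← ofReal_norm,
            Complex.norm_real, Real.norm_of_nonneg (hf0 x), norm_one]
          exact ENNReal.ofReal_le_ofReal (hf1 x)
        · rw [hfU x hx]; simp
    _ ≤ C * volume U ^ (1 / p.toReal) := by
        refine mul_le_mul_right ((eLpNorm_indicator_const_le (1 : ℝ) p).trans ?_) _
        simp

/-- Comparison of exponents resulting from a one-parameter family of tests. -/
theorem exponent_le_of_bounded {S φ : ℝ × ℝ → ℝ} {D : Set (ℝ × ℝ)} (hD : IsOpen D)
    (hS : ContinuousOn S D) (hφ : Continuous φ) (hφc : HasCompactSupport φ) (hφD : tsupport φ ⊆ D)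
    (hφ0 : ∀ t, 0 ≤ φ t) {p q : ℝ≥0∞} (hq : 1 ≤ q)
    (hb : Averaging.IsLpLqBounded (Averaging.avgOp S φ) p q) {α β γ δ₀ e w u c₀ : ℝ}
    (hδ₀ : 0 < δ₀) (he : 0 < e) (hw : 0 < w) (hu : 0 < u) (hc₀ : 0 < c₀)
    (K U E : ℝ → Set (ℝ × ℝ × ℝ)) (W : ℝ → ℝ × ℝ × ℝ → Set (ℝ × ℝ))
    (hK : ∀ δ, 0 < δ → δ ≤ δ₀ → IsClosed (K δ)) (hU : ∀ δ, 0 < δ → δ ≤ δ₀ → IsOpen (U δ))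
    (hKU : ∀ δ, 0 < δ → δ ≤ δ₀ → K δ ⊆ U δ)
    (hUb : ∀ δ, 0 < δ → δ ≤ δ₀ → Bornology.IsBounded (U δ))
    (hE : ∀ δ, 0 < δ → δ ≤ δ₀ → MeasurableSet (E δ))
    (hEv : ∀ δ, 0 < δ → δ ≤ δ₀ → volume (E δ) = ENNReal.ofReal (e * δ ^ α))
    (hUv : ∀ δ, 0 < δ → δ ≤ δ₀ → volume (U δ) = ENNReal.ofReal (u * δ ^ γ))
    (hWm : ∀ δ, 0 < δ → δ ≤ δ₀ → ∀ x ∈ E δ, MeasurableSet (W δ x))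
    (hWv : ∀ δ, 0 < δ → δ ≤ δ₀ → ∀ x ∈ E δ, volume (W δ x) = ENNReal.ofReal (w * δ ^ β))
    (hWφ : ∀ δ, 0 < δ → δ ≤ δ₀ → ∀ x ∈ E δ, ∀ t ∈ W δ x, c₀ ≤ φ t)
    (hWK : ∀ δ, 0 < δ → δ ≤ δ₀ → ∀ x ∈ E δ, ∀ t ∈ W δ x,
      (x.1 - t.1, x.2.1 - t.2, x.2.2 - S t) ∈ K δ) :
    γ * (1 / p).toReal ≤ β + α * (1 / q).toReal := by
  obtain ⟨C, hC⟩ := hb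
  set P := (1 / p).toReal
  set Q := (1 / q).toReal
  have hP : 0 ≤ P := ENNReal.toReal_nonneg
  have hQ : 0 ≤ Q := ENNReal.toReal_nonneg
  -- With `P = 1/p` and `Q = 1/q` the test reads `c₀ w e ^ Q δ ^ (β + α Q) ≤ C u ^ P δ ^ (γ P)`.
  refine le_of_rpow_bound (A := c₀ * w * e ^ Q) (B := C * u ^ P) (δ₀ := δ₀) (by positivity) hδ₀
    fun δ h1 h2 => ?_
  have hpow : ∀ s : ℝ, 0 < δ ^ s := fun s => Real.rpow_pos_of_pos h1 s
  have hE0 : volume (E δ) ≠ 0 := by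
    rw [hEv δ h1 h2, Ne, ENNReal.ofReal_eq_zero, not_le]
    exact mul_pos he (hpow _)
  have h := testing_bound hD hS hφ hφc hφD hφ0 (p := p) hq hC (hK δ h1 h2) (hU δ h1 h2)
    (hKU δ h1 h2) (hUb δ h1 h2) hE0 (hE δ h1 h2) (W δ) hc₀.le (hWm δ h1 h2)
    (fun x hx => (hWv δ h1 h2 x hx).ge) (hWφ δ h1 h2) (hWK δ h1 h2)
  have hα := mul_pos he (hpow α)
  have hβ := mul_pos hw (hpow β)
  have hγ := mul_pos hu (hpow γ)
  rw [hEv δ h1 h2, hUv δ h1 h2, ENNReal.ofReal_rpow_of_pos hα, ENNReal.ofReal_rpow_of_pos hγ,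
    ← ENNReal.ofReal_mul (by positivity), ← ENNReal.ofReal_coe_nnreal (p := C),
    ← ENNReal.ofReal_mul C.coe_nonneg, ENNReal.ofReal_le_ofReal_iff (by positivity)] at h
  rw [Real.mul_rpow he.le (hpow α).le, Real.mul_rpow hu.le (hpow γ).le, ← Real.rpow_mul h1.le,
    ← Real.rpow_mul h1.le] at h
  rw [Real.rpow_add h1]
  linarith

/-! ### Necessary conditions for boundedness -/

/-- Measure of a neighborhood of a graph. -/
theorem volume_graph_nhd_closed {A : Set (ℝ × ℝ)} (hA : IsClosed A) {g : ℝ × ℝ → ℝ}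
    (hg : ContinuousOn g A) (h : ℝ) :
    IsClosed {y : ℝ × ℝ × ℝ | (y.1, y.2.1) ∈ A ∧ |y.2.2 - g (y.1, y.2.1)| ≤ h} ∧
    volume {y : ℝ × ℝ × ℝ | (y.1, y.2.1) ∈ A ∧ |y.2.2 - g (y.1, y.2.1)| ≤ h} =
      ENNReal.ofReal (2 * h) * volume A := by
  have hπ : Continuous fun y : ℝ × ℝ × ℝ => (y.1, y.2.1) := by fun_prop
  have hcl : IsClosed {y : ℝ × ℝ × ℝ | (y.1, y.2.1) ∈ A ∧ |y.2.2 - g (y.1, y.2.1)| ≤ h} := by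
    have hc : ContinuousOn (fun y : ℝ × ℝ × ℝ => |y.2.2 - g (y.1, y.2.1)|)
        ((fun y : ℝ × ℝ × ℝ => (y.1, y.2.1)) ⁻¹' A) :=
      (ContinuousOn.sub (by fun_prop) (hg.comp hπ.continuousOn fun y hy => hy)).abs
    exact hc.preimage_isClosed_of_isClosed (hA.preimage hπ) (isClosed_Iic (a := h))
  refine ⟨hcl, volume_of_slices hcl.measurableSet hA.measurableSet _ (fun z hz => ?_)
    fun z hz => ?_⟩
  · have : {s : ℝ | (z.1, z.2, s) ∈ {y : ℝ × ℝ × ℝ | (y.1, y.2.1) ∈ A ∧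
        |y.2.2 - g (y.1, y.2.1)| ≤ h}} = Metric.closedBall (g z) h := by
      ext s
      rw [Metric.mem_closedBall, Real.dist_eq]
      exact and_iff_right hz
    rw [this, Real.volume_closedBall]
  · ext s
    exact iff_of_false (fun hs => hz hs.1) id

theorem volume_graph_nhd_open {A : Set (ℝ × ℝ)} (hA : IsOpen A) {g : ℝ × ℝ → ℝ}
    (hg : ContinuousOn g A) (h : ℝ) :
    IsOpen {y : ℝ × ℝ × ℝ | (y.1, y.2.1) ∈ A ∧ |y.2.2 - g (y.1, y.2.1)| < h} ∧
    volume {y : ℝ × ℝ × ℝ | (y.1, y.2.1) ∈ A ∧ |y.2.2 - g (y.1, y.2.1)| < h} =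
      ENNReal.ofReal (2 * h) * volume A := by
  have hπ : Continuous fun y : ℝ × ℝ × ℝ => (y.1, y.2.1) := by fun_prop
  have hop : IsOpen {y : ℝ × ℝ × ℝ | (y.1, y.2.1) ∈ A ∧ |y.2.2 - g (y.1, y.2.1)| < h} := by
    have hc : ContinuousOn (fun y : ℝ × ℝ × ℝ => |y.2.2 - g (y.1, y.2.1)|)
        ((fun y : ℝ × ℝ × ℝ => (y.1, y.2.1)) ⁻¹' A) :=
      (ContinuousOn.sub (by fun_prop) (hg.comp hπ.continuousOn fun y hy => hy)).abs
    exact hc.isOpen_inter_preimage (hA.preimage hπ) (isOpen_Iio (a := h))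
  refine ⟨hop, volume_of_slices hop.measurableSet hA.measurableSet _ (fun z hz => ?_)
    fun z hz => ?_⟩
  · have : {s : ℝ | (z.1, z.2, s) ∈ {y : ℝ × ℝ × ℝ | (y.1, y.2.1) ∈ A ∧
        |y.2.2 - g (y.1, y.2.1)| < h}} = Metric.ball (g z) h := by
      ext s
      rw [Metric.mem_ball, Real.dist_eq]
      exact and_iff_right hz
    rw [this, Real.volume_ball]
  · ext s
    exact iff_of_false (fun hs => hz hs.1) id

theorem volume_ball_prod (x : ℝ × ℝ) {r : ℝ} (hr : 0 ≤ r) :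
    volume (Metric.ball x r) = ENNReal.ofReal (4 * r ^ 2) := by
  rw [← ball_prod_same, Measure.volume_eq_prod, Measure.prod_prod, Real.volume_ball,
    Real.volume_ball, ← ENNReal.ofReal_mul (by positivity)]
  congr 1; ring

theorem norm_le_iff_abs {t : ℝ × ℝ} {r : ℝ} : ‖t‖ ≤ r ↔ |t.1| ≤ r ∧ |t.2| ≤ r := by
  rw [Prod.norm_def, max_le_iff, Real.norm_eq_abs, Real.norm_eq_abs]

theorem rpow_ofNat_three (δ : ℝ) : δ ^ (3 : ℝ) = δ ^ 3 := by
  exact_mod_cast Real.rpow_natCast δ 3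

theorem rpow_neg_three {δ : ℝ} (hδ : 0 < δ) : δ ^ (-3 : ℝ) = δ⁻¹ ^ 3 := by
  rw [Real.rpow_neg hδ.le, rpow_ofNat_three, inv_pow]

/-- Boundedness of the averaging operator forces the four inequalities on the exponents. -/
theorem exponents_of_isLpLqBounded {S φ : ℝ × ℝ → ℝ} {D : Set (ℝ × ℝ)} (hD : IsOpen D)
    (hD0 : (0 : ℝ × ℝ) ∈ D) (hS : AnalyticOnNhd ℝ S D) (hS0 : S 0 = 0)
    (hne : ∃ᶠ t in 𝓝 (0 : ℝ × ℝ), S t ≠ 0) (hφ : Continuous φ) (hφc : HasCompactSupport φ)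
    (hφD : tsupport φ ⊆ D) (hφ0 : ∀ t, 0 ≤ φ t) (hφpos : 0 < φ 0) {p q : ℝ≥0∞} (hq : 1 ≤ q)
    (hb : Averaging.IsLpLqBounded (Averaging.avgOp S φ) p q) :
    (1 + 1 / Averaging.newtonDistance S) * (1 / p).toReal ≤
      1 / Averaging.newtonDistance S + (1 + 1 / Averaging.newtonDistance S) * (1 / q).toReal ∧
    3 * (1 / p).toReal ≤ 2 + (1 / q).toReal ∧
    (1 / p).toReal ≤ 3 * (1 / q).toReal ∧
    (1 / q).toReal ≤ (1 / p).toReal := by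
  have hScont : ContinuousOn S D := hS.continuousOn
  set c₀ := φ 0 / 2 with hc₀def
  have hc₀ : 0 < c₀ := by positivity
  obtain ⟨L, N, hN, hLip⟩ := ((hS 0 hD0).contDiffAt (n := 1)).exists_lipschitzOnWith
  obtain ⟨ρ, hρ, hconv, hexp⟩ := AnalyticAt.exists_taylor (hS 0 hD0)
  obtain ⟨r, hr, hrρ, hball⟩ : ∃ r > 0, r < ρ ∧ Metric.closedBall (0 : ℝ × ℝ) r ⊆
      {t | c₀ ≤ φ t} ∩ N ∩ D := by
    have h1 : {t | c₀ ≤ φ t} ∈ 𝓝 (0 : ℝ × ℝ) :=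
      (hφ.continuousAt.eventually (lt_mem_nhds (half_lt_self hφpos))).mono fun t ht => le_of_lt ht
    obtain ⟨r', hr', h2⟩ := Metric.nhds_basis_closedBall.mem_iff.1
      (Filter.inter_mem (Filter.inter_mem h1 hN) (hD.mem_nhds hD0))
    refine ⟨min r' (ρ / 2), lt_min hr' (by positivity),
      (min_le_right _ _).trans_lt (half_lt_self hρ),
      (Metric.closedBall_subset_closedBall (min_le_left _ _)).trans h2⟩
  have hball' : ∀ t : ℝ × ℝ, ‖t‖ ≤ r → c₀ ≤ φ t ∧ t ∈ N ∧ t ∈ D := fun t ht => by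
    have := hball (mem_closedBall_zero_iff.2 ht)
    exact ⟨this.1.1, this.1.2, this.2⟩
  have hSL : ∀ s t : ℝ × ℝ, ‖s‖ ≤ r → ‖t‖ ≤ r → |S s - S t| ≤ L * ‖s - t‖ := by
    intro s t hs ht
    rw [← dist_eq_norm, ← Real.dist_eq]
    exact hLip.dist_le_mul s (hball' s hs).2.1 t (hball' t ht).2.1
  have hSL0 : ∀ t : ℝ × ℝ, ‖t‖ ≤ r → |S t| ≤ L * ‖t‖ := by
    intro t ht
    have := hSL t 0 ht (by simpa using hr.le)
    simpa [hS0] using this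
  have hL0 : (0 : ℝ) ≤ L := L.coe_nonneg
  refine ⟨?_, ?_, ?_, ?_⟩
  -- Newton polygon test: each monomial on the box with sides of order `δ ^ κ₁`, `δ ^ κ₂` gains `δ ^
  -- (κ₁ a + κ₂ b) ≤ δ`, so `|S| ≤ M δ` there. Both `E` and `U` have measure of order `δ ^ (1 + κ₁ +
  -- κ₂)`, and `W` of order `δ ^ (κ₁ + κ₂)`.
  · have hnz := exists_taylorCoeff_ne_zero (hS 0 hD0) hne
    have hd := newtonDistance_pos hS0 hnz
    obtain ⟨κ₁, κ₂, hκ₁, hκ₂, hκ, hsupp⟩ := exists_supporting_weights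
      (c := fun ab => Averaging.taylorCoeff S ab.1 ab.2) hd hnz
      fun x hx => notMem_newtonPolygon_of_lt hx
    rw [← hκ]
    set M : ℝ := ∑' ab : ℕ × ℕ, |Averaging.taylorCoeff S ab.1 ab.2| * r ^ (ab.1 + ab.2) with hM
    have hM0 : 0 ≤ M := tsum_nonneg fun ab => by positivity
    have hSM : ∀ δ, 0 < δ → δ ≤ 1 → ∀ t : ℝ × ℝ, |t.1| ≤ r * δ ^ κ₁ → |t.2| ≤ r * δ ^ κ₂ →
        |S t| ≤ M * δ := by
      intro δ hδ hδ1 t ht1 ht2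
      have h1 : ∀ κ : ℝ, 0 ≤ κ → r * δ ^ κ < ρ := fun κ hκ =>
        (mul_le_of_le_one_right hr.le (Real.rpow_le_one hδ.le hδ1 hκ)).trans_lt hrρ
      rw [← Prod.mk.eta (p := t), hexp _ _ (ht1.trans_lt (h1 _ hκ₁)) (ht2.trans_lt (h1 _ hκ₂)), hM,
        ← tsum_mul_right, ← Real.norm_eq_abs]
      refine tsum_of_norm_bounded ((hconv r hr.le hrρ).mul_right δ).hasSum fun ab => ?_
      by_cases h0 : Averaging.taylorCoeff S ab.1 ab.2 = 0
      · simp [h0]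
      rw [Real.norm_eq_abs, abs_mul, abs_mul, abs_pow, abs_pow, mul_assoc, mul_assoc]
      refine mul_le_mul_of_nonneg_left ?_ (abs_nonneg _)
      calc |t.1| ^ ab.1 * |t.2| ^ ab.2 ≤ (r * δ ^ κ₁) ^ ab.1 * (r * δ ^ κ₂) ^ ab.2 := by gcongr
        _ = r ^ (ab.1 + ab.2) * δ ^ (κ₁ * ab.1 + κ₂ * ab.2) := by
          rw [Real.rpow_add hδ, Real.rpow_mul hδ.le, Real.rpow_mul hδ.le, Real.rpow_natCast,
            Real.rpow_natCast, mul_pow, mul_pow, pow_add]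
          ring
        _ ≤ r ^ (ab.1 + ab.2) * δ := by
          gcongr
          calc δ ^ (κ₁ * ab.1 + κ₂ * ab.2) ≤ δ ^ (1 : ℝ) :=
                Real.rpow_le_rpow_of_exponent_ge hδ hδ1 (hsupp _ _ h0)
            _ = δ := Real.rpow_one δ
    have hprod : ∀ δ : ℝ, 0 < δ → δ ^ κ₁ * δ ^ κ₂ * δ = δ ^ (1 + (κ₁ + κ₂)) := by
      intro δ hδ
      rw [Real.rpow_add hδ, Real.rpow_add hδ, Real.rpow_one]; ring
    refine exponent_le_of_bounded hD hScont hφ hφc hφD hφ0 hq hb (δ₀ := 1) (e := 8 * r ^ 2)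
      (w := 4 * r ^ 2) (u := 8 * ((4 * r) * (4 * r) * (2 * (M + 1)))) one_pos (by positivity)
      (by positivity) (by positivity) hc₀
      (fun δ => closedBox (2 * (r * δ ^ κ₁)) (2 * (r * δ ^ κ₂)) ((M + 1) * δ))
      (fun δ => openBox (4 * r * δ ^ κ₁) (4 * r * δ ^ κ₂) (2 * (M + 1) * δ))
      (fun δ => closedBox (r * δ ^ κ₁) (r * δ ^ κ₂) δ)
      (fun δ _ => Set.Icc (-(r * δ ^ κ₁)) (r * δ ^ κ₁) ×ˢ Set.Icc (-(r * δ ^ κ₂)) (r * δ ^ κ₂))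
      (fun δ _ _ => isClosed_closedBox _ _ _) (fun δ _ _ => isOpen_openBox _ _ _)
      (fun δ h1 _ => ?_) (fun δ _ _ => isBounded_openBox _ _ _)
      (fun δ _ _ => (isClosed_closedBox _ _ _).measurableSet) (fun δ h1 _ => ?_)
      (fun δ h1 _ => ?_) (fun δ _ _ x _ => measurableSet_Icc.prod measurableSet_Icc)
      (fun δ h1 _ x _ => ?_) (fun δ h1 h2 x _ t ht => ?_) (fun δ h1 h2 x hx t ht => ?_)
    · have e1 : 0 < r * δ ^ κ₁ := by positivity
      have e2 : 0 < r * δ ^ κ₂ := by positivity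
      have e3 : 0 < (M + 1) * δ := by positivity
      exact closedBox_subset_openBox (by linarith) (by linarith) (by linarith)
    · rw [volume_closedBox (by positivity) (by positivity), ← hprod δ h1]
      congr 1; ring
    · rw [volume_openBox (by positivity) (by positivity), ← hprod δ h1]
      congr 1; ring
    · rw [Measure.volume_eq_prod, Measure.prod_prod, Real.volume_Icc, Real.volume_Icc,
        ← ENNReal.ofReal_mul (by ring_nf; positivity), Real.rpow_add h1]
      congr 1; ring
    · refine (hball' t (norm_le_iff_abs.2 ⟨?_, ?_⟩)).1
      · exact (abs_le.2 ht.1).trans (mul_le_of_le_one_right hr.le (Real.rpow_le_one h1.le h2 hκ₁))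
      · exact (abs_le.2 ht.2).trans (mul_le_of_le_one_right hr.le (Real.rpow_le_one h1.le h2 hκ₂))
    · obtain ⟨hx1, hx2, hx3⟩ := mem_closedBox.1 hx
      have ht1 := abs_le.2 ht.1
      have ht2 := abs_le.2 ht.2
      refine mem_closedBox.2 ⟨?_, ?_, ?_⟩
      · refine (abs_sub _ _).trans ?_
        linarith
      · refine (abs_sub _ _).trans ?_
        linarith
      · refine (abs_sub _ _).trans ?_
        linarith [hSM δ h1 h2 t ht1 ht2]
  -- Small box test: for `x` within `δ` of the graph, the `t` within `δ` of `(x₁, x₂)` send `x - (t,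
  -- S t)` into a box of size `δ`, by the Lipschitz bound.
  · have h := exponent_le_of_bounded hD hScont hφ hφc hφD hφ0 hq hb (δ₀ := r / 2) (α := 1) (β := 2)
      (γ := 3) (e := 2 * r ^ 2) (w := 4) (u := 8 * (2 * 2 * (2 * (1 + L)))) (by positivity)
      (by positivity) (by positivity) (by positivity) hc₀
      (fun δ => closedBox δ δ ((1 + L) * δ))
      (fun δ => openBox (2 * δ) (2 * δ) (2 * (1 + L) * δ))
      (fun δ => {y : ℝ × ℝ × ℝ | (y.1, y.2.1) ∈ Metric.closedBall (0 : ℝ × ℝ) (r / 2) ∧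
        |y.2.2 - S (y.1, y.2.1)| ≤ δ})
      (fun δ x => Metric.closedBall (x.1, x.2.1) δ)
      (fun δ _ _ => isClosed_closedBox _ _ _) (fun δ _ _ => isOpen_openBox _ _ _)
      (fun δ h1 _ => ?_) (fun δ _ _ => isBounded_openBox _ _ _) (fun δ h1 h2 => ?_)
      (fun δ h1 h2 => ?_) (fun δ h1 _ => ?_)
      (fun δ _ _ x _ => Metric.isClosed_closedBall.measurableSet)
      (fun δ h1 _ x _ => ?_) (fun δ h1 h2 x hx t ht => ?_) (fun δ h1 h2 x hx t ht => ?_)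
    · linarith
    · have : 0 < (1 + (L : ℝ)) * δ := by positivity
      exact closedBox_subset_openBox (by linarith) (by linarith) (by linarith)
    · exact (volume_graph_nhd_closed Metric.isClosed_closedBall (hScont.mono fun t ht =>
        (hball' t ((mem_closedBall_zero_iff.1 ht).trans (by linarith))).2.2) δ).1.measurableSet
    · rw [(volume_graph_nhd_closed Metric.isClosed_closedBall (hScont.mono fun t ht =>
        (hball' t ((mem_closedBall_zero_iff.1 ht).trans (by linarith))).2.2) δ).2,
        volume_closedBall_prod _ (by positivity), ← ENNReal.ofReal_mul (by positivity),
        Real.rpow_one]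
      congr 1; ring
    · rw [volume_openBox (by positivity) (by positivity), rpow_ofNat_three]
      congr 1; ring
    · rw [volume_closedBall_prod _ h1.le]
      norm_num
    · have h3 := mem_closedBall_iff_norm.1 ht
      have h4 := mem_closedBall_zero_iff.1 hx.1
      refine (hball' t ?_).1
      calc ‖t‖ = ‖(t - (x.1, x.2.1)) + (x.1, x.2.1)‖ := by rw [sub_add_cancel]
        _ ≤ _ := norm_add_le _ _
        _ ≤ r := by linarith
    · have h3 := mem_closedBall_iff_norm'.1 ht
      have h4 := mem_closedBall_zero_iff.1 hx.1
      have h5 : ‖t‖ ≤ r := by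
        calc ‖t‖ = ‖(x.1, x.2.1) - ((x.1, x.2.1) - t)‖ := by rw [sub_sub_cancel]
          _ ≤ _ := norm_sub_le _ _
          _ ≤ r := by linarith
      have h6 := hSL (x.1, x.2.1) t (h4.trans (by linarith)) h5
      have h7 : (L : ℝ) * ‖(x.1, x.2.1) - t‖ ≤ L * δ := by gcongr
      obtain ⟨h8, h9⟩ := norm_le_iff_abs.1 h3
      refine mem_closedBox.2 ⟨h8, h9, ?_⟩
      calc |x.2.2 - S t| = |(x.2.2 - S (x.1, x.2.1)) + (S (x.1, x.2.1) - S t)| := by ring_nf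
        _ ≤ _ := abs_add_le _ _
        _ ≤ (1 + L) * δ := by linarith [hx.2]
  -- Dual test: for `x` in a box of size `δ`, the points `x - (t, S t)` stay near the reflected
  -- graph `y₃ = -S (-y₁, -y₂)` for all `t` of norm at most `r / 2`. The radii `3r/4` and `r` leave
  -- room for the shift by `x`.
  · have hneg : ∀ R ≤ r, ContinuousOn (fun y : ℝ × ℝ => -S (-y)) {y | ‖y‖ ≤ R} := fun R hR =>
      (hScont.comp continuous_neg.continuousOn fun y hy =>
        (hball' (-y) ((norm_neg y).le.trans (le_trans hy hR))).2.2).neg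
    have h := exponent_le_of_bounded hD hScont hφ hφc hφD hφ0 hq hb (δ₀ := r / 4) (α := 3) (β := 0)
      (γ := 1) (e := 8) (w := r ^ 2) (u := 4 * (1 + L) * (4 * r ^ 2)) (by positivity)
      (by positivity) (by positivity) (by positivity) hc₀
      (fun δ => {y : ℝ × ℝ × ℝ | (y.1, y.2.1) ∈ Metric.closedBall (0 : ℝ × ℝ) (3 * r / 4) ∧
        |y.2.2 - -S (-(y.1, y.2.1))| ≤ (1 + L) * δ})
      (fun δ => {y : ℝ × ℝ × ℝ | (y.1, y.2.1) ∈ Metric.ball (0 : ℝ × ℝ) r ∧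
        |y.2.2 - -S (-(y.1, y.2.1))| < 2 * (1 + L) * δ})
      (fun δ => closedBox δ δ δ) (fun δ x => Metric.closedBall 0 (r / 2))
      (fun δ _ _ => (volume_graph_nhd_closed Metric.isClosed_closedBall
        ((hneg (3 * r / 4) (by linarith)).mono fun y hy => mem_closedBall_zero_iff.1 hy) _).1)
      (fun δ _ _ => (volume_graph_nhd_open Metric.isOpen_ball
        ((hneg r le_rfl).mono fun y hy => (mem_ball_zero_iff.1 hy).le) _).1)
      (fun δ h1 h2 => ?_) (fun δ h1 h2 => ?_)
      (fun δ _ _ => (isClosed_closedBox _ _ _).measurableSet)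
      (fun δ h1 h2 => ?_) (fun δ h1 h2 => ?_)
      (fun δ _ _ x _ => Metric.isClosed_closedBall.measurableSet)
      (fun δ h1 _ x _ => ?_) (fun δ h1 h2 x hx t ht => ?_) (fun δ h1 h2 x hx t ht => ?_)
    · linarith
    · rintro y ⟨hy1, hy2⟩
      have : 0 < (1 + (L : ℝ)) * δ := by positivity
      exact ⟨Metric.closedBall_subset_ball (by linarith) hy1, hy2.trans_lt (by linarith)⟩
    · refine (isBounded_openBox (r + 1) (r + 1) (2 * (1 + L) * δ + L * r + 1)).subset ?_
      refine Set.Subset.trans ?_ (closedBox_subset_openBox (lt_add_one r) (lt_add_one r)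
        (lt_add_one _))
      rintro y ⟨hy1, hy2⟩
      have h3 := (mem_ball_zero_iff.1 hy1).le
      obtain ⟨h4, h5⟩ := norm_le_iff_abs.1 h3
      refine mem_closedBox.2 ⟨h4, h5, ?_⟩
      have h6 := hSL0 (-(y.1, y.2.1)) (by rwa [norm_neg])
      rw [norm_neg] at h6
      have h7 : (L : ℝ) * ‖((y.1, y.2.1) : ℝ × ℝ)‖ ≤ L * r := by gcongr
      calc |y.2.2| = |(y.2.2 - -S (-(y.1, y.2.1))) - S (-(y.1, y.2.1))| := by ring_nf
        _ ≤ _ := abs_sub _ _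
        _ ≤ _ := by linarith
    · rw [volume_closedBox h1.le h1.le, rpow_ofNat_three]
      congr 1; ring
    · rw [(volume_graph_nhd_open Metric.isOpen_ball
        ((hneg r le_rfl).mono fun y hy => (mem_ball_zero_iff.1 hy).le) _).2,
        volume_ball_prod _ hr.le, ← ENNReal.ofReal_mul (by positivity), Real.rpow_one]
      congr 1; ring
    · rw [volume_closedBall_prod _ (by positivity), Real.rpow_zero]
      congr 1; ring
    · exact (hball' t ((mem_closedBall_zero_iff.1 ht).trans (by linarith))).1
    · have ht' := mem_closedBall_zero_iff.1 ht
      obtain ⟨hx1, hx2, hx3⟩ := mem_closedBox.1 hx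
      have hx' : ‖((x.1, x.2.1) : ℝ × ℝ)‖ ≤ δ := norm_le_iff_abs.2 ⟨hx1, hx2⟩
      have h3 : ‖((x.1 - t.1, x.2.1 - t.2) : ℝ × ℝ)‖ ≤ 3 * r / 4 := by
        calc ‖((x.1 - t.1, x.2.1 - t.2) : ℝ × ℝ)‖ = ‖((x.1, x.2.1) : ℝ × ℝ) - t‖ := rfl
          _ ≤ _ := norm_sub_le _ _
          _ ≤ 3 * r / 4 := by linarith
      refine ⟨mem_closedBall_zero_iff.2 h3, ?_⟩
      -- The two arguments of `S` differ by `(x₁, x₂)`, of norm at most `δ`.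
      have h4 := hSL (-(x.1 - t.1, x.2.1 - t.2)) t (by rw [norm_neg]; linarith) (by linarith)
      have h5 : -((x.1 - t.1, x.2.1 - t.2) : ℝ × ℝ) - t = -(x.1, x.2.1) := by
        ext <;> simp
      rw [h5, norm_neg] at h4
      have h6 : (L : ℝ) * ‖((x.1, x.2.1) : ℝ × ℝ)‖ ≤ L * δ := by gcongr
      simp only
      calc |x.2.2 - S t - -S (-(x.1 - t.1, x.2.1 - t.2))|
          = |x.2.2 + (S (-(x.1 - t.1, x.2.1 - t.2)) - S t)| := by ring_nf
        _ ≤ _ := abs_add_le _ _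
        _ ≤ (1 + L) * δ := by linarith
  -- Large box test, with `δ⁻¹` as the size: for `δ⁻¹ ≥ 1 + r + L r`, the shift by `(t, S t)` stays
  -- within the doubled box.
  · have hden : 0 < 1 + r + L * r := by positivity
    have h := exponent_le_of_bounded hD hScont hφ hφc hφD hφ0 hq hb (δ₀ := 1 / (1 + r + L * r))
      (α := -3) (β := 0) (γ := -3) (e := 8) (w := 4 * r ^ 2) (u := 8 * (4 * 4 * 4))
      (by positivity) (by positivity) (by positivity) (by positivity) hc₀
      (fun δ => closedBox (2 * δ⁻¹) (2 * δ⁻¹) (2 * δ⁻¹))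
      (fun δ => openBox (4 * δ⁻¹) (4 * δ⁻¹) (4 * δ⁻¹))
      (fun δ => closedBox δ⁻¹ δ⁻¹ δ⁻¹) (fun δ x => Metric.closedBall 0 r)
      (fun δ _ _ => isClosed_closedBox _ _ _) (fun δ _ _ => isOpen_openBox _ _ _)
      (fun δ h1 _ => ?_) (fun δ _ _ => isBounded_openBox _ _ _)
      (fun δ _ _ => (isClosed_closedBox _ _ _).measurableSet)
      (fun δ h1 h2 => ?_) (fun δ h1 h2 => ?_)
      (fun δ _ _ x _ => Metric.isClosed_closedBall.measurableSet)
      (fun δ h1 _ x _ => ?_) (fun δ h1 h2 x hx t ht => ?_) (fun δ h1 h2 x hx t ht => ?_)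
    · linarith
    · have : 0 < δ⁻¹ := by positivity
      exact closedBox_subset_openBox (by linarith) (by linarith) (by linarith)
    · rw [volume_closedBox (by positivity) (by positivity), rpow_neg_three h1]
      congr 1; ring
    · rw [volume_openBox (by positivity) (by positivity), rpow_neg_three h1]
      congr 1; ring
    · rw [volume_closedBall_prod _ hr.le, Real.rpow_zero, mul_one]
    · exact (hball' t (mem_closedBall_zero_iff.1 ht)).1
    · have h3 : 1 + r + L * r ≤ δ⁻¹ := by
        rw [le_inv_comm₀ hden h1, ← one_div]; exact h2
      have ht' := mem_closedBall_zero_iff.1 ht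
      obtain ⟨ht1, ht2⟩ := norm_le_iff_abs.1 ht'
      have hSt := hSL0 t ht'
      have h6 : (L : ℝ) * ‖t‖ ≤ L * r := by gcongr
      have h7 : 0 ≤ (L : ℝ) * r := by positivity
      obtain ⟨hx1, hx2, hx3⟩ := mem_closedBox.1 hx
      refine mem_closedBox.2 ⟨?_, ?_, ?_⟩
      · exact (abs_sub _ _).trans (by linarith)
      · exact (abs_sub _ _).trans (by linarith)
      · exact (abs_sub _ _).trans (by linarith)

/-! ### Conclusion: from the test inequalities to the trapezoid -/

theorem theorem1p5
    (S φ : ℝ × ℝ → ℝ) (D : Set (ℝ × ℝ))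
    (hD : IsOpen D) (hD0 : (0 : ℝ × ℝ) ∈ D)
    (hS : AnalyticOnNhd ℝ S D)
    (hS0 : S 0 = 0) (hS1 : fderiv ℝ S 0 = 0)
    (hSne : ∃ᶠ t in 𝓝 (0 : ℝ × ℝ), S t ≠ 0)
    (hH0 : Averaging.hessianDet S 0 = 0)
    (hHne : ∃ᶠ t in 𝓝 (0 : ℝ × ℝ), Averaging.hessianDet S t ≠ 0)
    (hφ : ContDiff ℝ ∞ φ) (hφc : HasCompactSupport φ) (hφD : tsupport φ ⊆ D)
    (hφnonneg : ∀ t, 0 ≤ φ t) (hφpos : 0 < φ 0)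
    (hN : Averaging.DiagonalCondition S)
    (η η' : ℝ) (hη : η = Averaging.growthExponent S)
    (hη' : η' = Averaging.growthExponent (Averaging.hessianDet S)) :
    (∀ p q : ℝ≥0∞, 1 ≤ p → 1 ≤ q →
      (1 / q).toReal < (1 / p).toReal - η / (η + 1) →
      ¬ Averaging.IsLpLqBounded (Averaging.avgOp S φ) p q) ∧
    (η ≤ 2 * η' / (1 + 2 * η') →
      ∀ p q : ℝ≥0∞, 1 ≤ p → 1 ≤ q →
        ((1 / p).toReal, (1 / q).toReal) ∉ Averaging.closedTrapezoid η →
        ¬ Averaging.IsLpLqBounded (Averaging.avgOp S φ) p q) := by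

  have hd := newtonDistance_pos hS0 (exists_taylorCoeff_ne_zero (hS 0 hD0) hSne)
  have hgrowth := one_div_newtonDistance_le_growthExponent (hS 0 hD0) hS0 hSne hN
  rw [← hη] at hgrowth
  have hs : 0 < 1 / Averaging.newtonDistance S := by positivity
  have hcond := fun (p q : ℝ≥0∞) (hq : 1 ≤ q)
    (hb : Averaging.IsLpLqBounded (Averaging.avgOp S φ) p q) =>
    exponents_of_isLpLqBounded hD hD0 hS hS0 hSne hφ.continuous hφc hφD hφnonneg hφpos hq hb
  generalize 1 / Averaging.newtonDistance S = s at hgrowth hs hcond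
  have hline : ∀ p q : ℝ≥0∞, 1 ≤ q → Averaging.IsLpLqBounded (Averaging.avgOp S φ) p q →
      (1 / p).toReal - η / (η + 1) ≤ (1 / q).toReal := by
    intro p q hq hb
    have h1 := (hcond p q hq hb).1
    -- `x / (x + 1)` is increasing, so the lower bound `s ≤ η` turns the Newton distance condition
    -- into the one in `η`.
    have h2 : s / (s + 1) ≤ η / (η + 1) := by
      rw [div_le_div_iff₀ (by linarith) (by linarith)]
      linarith
    have h3 : (1 / p).toReal - (1 / q).toReal ≤ s / (s + 1) := by
      rw [le_div_iff₀ (by linarith)]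
      linarith
    linarith
  refine ⟨fun p q _ hq hlt hb => absurd (hline p q hq hb) (not_le.2 hlt),
    fun _ p q _ hq hnot hb => hnot ?_⟩
  obtain ⟨-, h2, h3, h4⟩ := hcond p q hq hb
  refine ⟨h4, hline p q hq hb, ?_, ?_⟩
  · simp only
    linarith
  · simp only
    linarith
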